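/- **Generalised Pattern Matching (GPM), reporting variant.** The input consists of a text $T\in\Sigma_T^n$, a pattern $P\in\Sigma_P^m$ with $1\le m\le n$, and a matching relation $M\subseteq\Sigma_T\times\Sigma_P$, viewed as a bipartite graph on $\Sigma_T\sqcup\Sigma_P$ (the matching graph); the task is to output all positions $i\in\{1,\dots,n-m+1\}$ such that $(T[i+j-1],P[j])\in M$ for every $j\in\{1,\dots,m\}$. The alphabets have size polynomial in $n$, and $M$ is accessed through three oracles that answer in constant time: (1) is there an edge between $a\in\Sigma_T$ and $b\in\Sigma_P$? (2) what is the degree of a given character of $\Sigma_T$ or of $\Sigma_P$? (3) what is the $k$-th neighbour of $a\in\Sigma_T$, in an arbitrary but fixed order? The model of computation is the randomised word RAM with words of $w\ge K\log_2 (n+1)$ bits for a suitable constant $K$, where in unit time one can perform an arithmetic, logical or memory operation on words, call an oracle, or draw a uniformly random word. **Theorem.** Let $\mathcal D$ be the maximum degree of a vertex of the matching graph $M$, and let $c$ be any constant fixed in advance. There is a Monte Carlo algorithm that solves the reporting variant of GPM in worst-case time $\mathcal O(\mathcal D\, n\log m\log n)$, where in the bound $\mathcal D$, $\log m$, $\log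 n$ are read as $\max(\mathcal D,1)$, $1+\lfloor\log_2 m\rfloor$, $1+\lfloor\log_2 n\rfloor$. The error is one-sided: every outcome of the random choices yields an output that contains all occurrences, so only false positives are possible; and the probability that the output differs from the set of all occurrences is at most $1/n^c$. The algorithm depends only on $c$; for alphabets of size at most $(n+1)^d$, the constant in the time bound and the constant $K$ depend only on $c$ and $d$. -/

import Mathlib

namespace GPM

/-! ### Generalised pattern matching -/

/-- The degree of a text character in the matching graph. -/
def degT {σT σP : ℕ} (M : Fin σT → Fin σP → Bool) (a : Fin σT) : ℕ :=
  (Finset.univ.filter fun b => M a b = true).card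

/-- The degree of a pattern character in the matching graph. -/
def degP {σT σP : ℕ} (M : Fin σT → Fin σP → Bool) (b : Fin σP) : ℕ :=
  (Finset.univ.filter fun a => M a b = true).card

/-- The maximum degree of a vertex (on either side) of the bipartite matching graph. -/
def maxDeg {σT σP : ℕ} (M : Fin σT → Fin σP → Bool) : ℕ :=
  max (Finset.univ.sup (degT M)) (Finset.univ.sup (degP M))

/-- An instance: a text of length `n` over the alphabet `{0, …, σT - 1}`, a pattern of length `m`
over the alphabet `{0, …, σP - 1}`, a matching relation `M`, and the (arbitrary but fixed) order
in which the neighbours of each text character are listed. -/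
structure Input (n m σT σP : ℕ) where
  T : Fin n → Fin σT
  P : Fin m → Fin σP
  M : Fin σT → Fin σP → Bool
  nbr : (a : Fin σT) → Fin (degT M a) ≃ {b : Fin σP // M a b = true}

/-- The (0-based) positions `i ∈ {0, …, n - m}` such that `T[i, i + m - 1]` matches `P`. -/
def occurrences {n m σT σP : ℕ} (I : Input n m σT σP) : Finset ℕ :=
  (Finset.range (n - m + 1)).filter fun i =>
    ∀ j : Fin m, ∃ h : i + j < n, I.M (I.T ⟨i + j, h⟩) (I.P j) = true

/-! ### The three oracles of an instance (all answer `0` on arguments outside their domain) -/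

/-- Is there an edge between the text character `a` and the pattern character `b`? -/
def edgeOracle {n m σT σP : ℕ} (I : Input n m σT σP) (a b : ℕ) : ℕ :=
  if h : a < σT ∧ b < σP then (if I.M ⟨a, h.1⟩ ⟨b, h.2⟩ = true then 1 else 0) else 0

/-- What is the degree of the text character `a`? -/
def degTOracle {n m σT σP : ℕ} (I : Input n m σT σP) (a : ℕ) : ℕ :=
  if h : a < σT then degT I.M ⟨a, h⟩ else 0

/-- What is the degree of the pattern character `b`? -/
def degPOracle {n m σT σP : ℕ} (I : Input n m σT σP) (b : ℕ) : ℕ :=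
  if h : b < σP then degP I.M ⟨b, h⟩ else 0

/-- What is the `k`-th neighbour of the text character `a` (counting from `0`)? -/
def nbrOracle {n m σT σP : ℕ} (I : Input n m σT σP) (a k : ℕ) : ℕ :=
  if h : a < σT then
    (if h' : k < degT I.M ⟨a, h⟩ then ((I.nbr ⟨a, h⟩ ⟨k, h'⟩).1 : ℕ) else 0)
  else 0

/-! ### Randomised word RAM with oracles -/

/-- Binary operations on machine words. -/
inductive BinOp
  | add | sub | mul | div | mod | and | or | xor | shl | shr | lt | eq

/-- The value of a binary operation on words of `w` bits. -/
def BinOp.eval (w : ℕ) : BinOp → ℕ → ℕ → ℕ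
  | .add, x, y => (x + y) % 2 ^ w
  | .sub, x, y => (x + (2 ^ w - y % 2 ^ w)) % 2 ^ w
  | .mul, x, y => (x * y) % 2 ^ w
  | .div, x, y => (x / y) % 2 ^ w
  | .mod, x, y => (x % y) % 2 ^ w
  | .and, x, y => (x &&& y) % 2 ^ w
  | .or, x, y => (x ||| y) % 2 ^ w
  | .xor, x, y => (x ^^^ y) % 2 ^ w
  | .shl, x, y => (x * 2 ^ y) % 2 ^ w
  | .shr, x, y => (x / 2 ^ y) % 2 ^ w
  | .lt, x, y => (if x < y then 1 else 0) % 2 ^ w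
  | .eq, x, y => (if x = y then 1 else 0) % 2 ^ w

/-- Elementary instructions. Arguments are indices of registers, except for the literal `k` in
`const r k`; the first register mentioned receives the result. -/
inductive Instr
  | const (r k : ℕ)
  | bin (o : BinOp) (r x y : ℕ)
  /-- `r := mem[x]` -/
  | load (r x : ℕ)
  /-- `mem[x] := y` -/
  | store (x y : ℕ)
  /-- `r :=` the next uniformly random word -/
  | rand (r : ℕ)
  | edge (r x y : ℕ)
  | degT (r x : ℕ)
  | degP (r x : ℕ)
  | nbr (r x y : ℕ)

/-- Programs: finite pieces of code built from elementary instructions by sequencing, branching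
and loops; a register that is tested counts as true if it is non-zero. -/
inductive Prog
  | skip
  | instr (i : Instr)
  | seq (p q : Prog)
  | ite (r : ℕ) (p q : Prog)
  | loop (r : ℕ) (p : Prog)

/-- The state of the machine: registers, memory, and the number of random words used so far. -/
structure State where
  reg : ℕ → ℕ
  mem : ℕ → ℕ
  used : ℕ

/-- Write `v` into the register `r`. -/
def State.set (s : State) (r v : ℕ) : State :=
  { s with reg := Function.update s.reg r v }

/-- The effect of an elementary instruction on a machine with words of `w` bits that has access to
the oracles of `I`, where `tape` is the sequence of random words. -/
def Instr.apply {n m σT σP : ℕ} (w : ℕ) (I : Input n m σT σP) (tape : ℕ → ℕ) :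
    Instr → State → State
  | .const r k, s => s.set r (k % 2 ^ w)
  | .bin o r x y, s => s.set r (o.eval w (s.reg x) (s.reg y))
  | .load r x, s => s.set r (s.mem (s.reg x))
  | .store x y, s => { s with mem := Function.update s.mem (s.reg x) (s.reg y) }
  | .rand r, s => { s.set r (tape s.used) with used := s.used + 1 }
  | .edge r x y, s => s.set r (edgeOracle I (s.reg x) (s.reg y) % 2 ^ w)
  | .degT r x, s => s.set r (degTOracle I (s.reg x) % 2 ^ w)
  | .degP r x, s => s.set r (degPOracle I (s.reg x) % 2 ^ w)
  | .nbr r x y, s => s.set r (nbrOracle I (s.reg x) (s.reg y) % 2 ^ w)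

/-- `Exec w I tape p s t s'`: started in the state `s`, the program `p` halts after exactly `t` steps
in the state `s'`. Every elementary instruction, every oracle call and every test takes one step. -/
inductive Exec {n m σT σP : ℕ} (w : ℕ) (I : Input n m σT σP) (tape : ℕ → ℕ) :
    Prog → State → ℕ → State → Prop
  | skip (s : State) : Exec w I tape .skip s 1 s
  | instr (i : Instr) (s : State) : Exec w I tape (.instr i) s 1 (i.apply w I tape s)
  | seq {p q : Prog} {s s' s'' : State} {t t' : ℕ} :
      Exec w I tape p s t s' → Exec w I tape q s' t' s'' →
      Exec w I tape (.seq p q) s (t + t') s''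
  | ite_true {r : ℕ} {p q : Prog} {s s' : State} {t : ℕ} :
      s.reg r ≠ 0 → Exec w I tape p s t s' → Exec w I tape (.ite r p q) s (t + 1) s'
  | ite_false {r : ℕ} {p q : Prog} {s s' : State} {t : ℕ} :
      s.reg r = 0 → Exec w I tape q s t s' → Exec w I tape (.ite r p q) s (t + 1) s'
  | loop_done {r : ℕ} {p : Prog} {s : State} :
      s.reg r = 0 → Exec w I tape (.loop r p) s 1 s
  | loop_step {r : ℕ} {p : Prog} {s s' s'' : State} {t t' : ℕ} :
      s.reg r ≠ 0 → Exec w I tape p s t s' → Exec w I tape (.loop r p) s' t' s'' →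
      Exec w I tape (.loop r p) s (t + t' + 1) s''

/-- For a fixed sequence of random words the machine is deterministic. -/
theorem Exec.deterministic {n m σT σP : ℕ} {w : ℕ} {I : Input n m σT σP} {tape : ℕ → ℕ}
    {p : Prog} {s s₁ : State} {t₁ : ℕ} (h₁ : Exec w I tape p s t₁ s₁) :
    ∀ {t₂ : ℕ} {s₂ : State}, Exec w I tape p s t₂ s₂ → t₁ = t₂ ∧ s₁ = s₂ := by
  induction h₁ with
  | skip s => intro t₂ s₂ h; cases h; exact ⟨rfl, rfl⟩
  | instr i s => intro t₂ s₂ h; cases h; exact ⟨rfl, rfl⟩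
  | seq _ _ ih ih' =>
    intro t₂ s₂ h
    cases h with
    | seq a b =>
      obtain ⟨rfl, rfl⟩ := ih a
      obtain ⟨rfl, rfl⟩ := ih' b
      exact ⟨rfl, rfl⟩
  | ite_true hr _ ih =>
    intro t₂ s₂ h
    cases h with
    | ite_true _ a => obtain ⟨rfl, rfl⟩ := ih a; exact ⟨rfl, rfl⟩
    | ite_false h0 _ => exact absurd h0 hr
  | ite_false hr _ ih =>
    intro t₂ s₂ h
    cases h with
    | ite_true h0 _ => exact absurd hr h0
    | ite_false _ a => obtain ⟨rfl, rfl⟩ := ih a; exact ⟨rfl, rfl⟩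
  | loop_done hr =>
    intro t₂ s₂ h
    cases h with
    | loop_done _ => exact ⟨rfl, rfl⟩
    | loop_step h0 _ _ => exact absurd hr h0
  | loop_step hr _ _ ih ih' =>
    intro t₂ s₂ h
    cases h with
    | loop_done h0 => exact absurd h0 hr
    | loop_step _ a b =>
      obtain ⟨rfl, rfl⟩ := ih a
      obtain ⟨rfl, rfl⟩ := ih' b
      exact ⟨rfl, rfl⟩

/-- The initial state: the registers `0, …, 4` hold `n, m, σT, σP, w`, the memory holds the text
followed by the pattern, and everything else is `0`. -/
def initState {n m σT σP : ℕ} (w : ℕ) (I : Input n m σT σP) : State where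
  reg := fun r =>
    if r = 0 then n else if r = 1 then m else if r = 2 then σT else if r = 3 then σP
    else if r = 4 then w else 0
  mem := fun x =>
    if h : x < n then (I.T ⟨x, h⟩ : ℕ) else if h' : x - n < m then (I.P ⟨x - n, h'⟩ : ℕ) else 0
  used := 0

/-- In the halting state `s` the machine reports exactly the elements of `S`, each of them once:
register `0` holds their number, and they are stored in consecutive memory cells, beginning with
the cell whose address is in register `1`. -/
def Reports (s : State) (S : Finset ℕ) : Prop :=
  s.reg 0 = S.card ∧ (Finset.range (s.reg 0)).image (fun k => s.mem (s.reg 1 + k)) = S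

/-- The sequence of random words given by a finite list `ω` of words (padded by zeros; a
computation of at most `B` steps never reads the padding). -/
def tapeOf {w B : ℕ} (ω : Fin B → Fin (2 ^ w)) (k : ℕ) : ℕ :=
  if h : k < B then (ω ⟨k, h⟩ : ℕ) else 0

/-- The probability of the event `E` when `B` words of `w` bits are chosen independently and
uniformly at random. -/
noncomputable def prob {w B : ℕ} (E : Set (Fin B → Fin (2 ^ w))) : ℝ :=
  (E.ncard : ℝ) / (Fintype.card (Fin B → Fin (2 ^ w)) : ℝ)

/-- The running time bound `C · D · n · log m · log n`, with `D`, `log m`, `log n` replaced by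
`max D 1`, `⌊log₂ m⌋ + 1`, `⌊log₂ n⌋ + 1`, so that it does not vanish for `D = 0` or `m = 1`. -/
def timeBound (C D n m : ℕ) : ℕ :=
  C * (max D 1) * n * (Nat.log 2 m + 1) * (Nat.log 2 n + 1)

end GPM

namespace GPM

/-! ### A structured language over the integers, compiled to the word RAM -/

/-! The matching test is randomised by hashing to a small alphabet. Let `D` be the maximum degree of
a character that occurs in the text, and `B` the least power of two with `2 D ≤ B`. A round draws a
random map `H` from the characters of the pattern to `{0, …, B - 1}` and replaces each text
character by the set of the hash values of its neighbours; a position `i` passes if `H (P[j])` lies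
in the set at `i + j` for every `j`. An occurrence passes whatever `H` is (`survives_of_mem`), so
errors are one-sided. At a non-occurrence some `P[j]` is not a neighbour of the text character
facing it. Its hash value is independent of those of the neighbours, which cover at most `D ≤ B / 2`
values, so the position passes with probability at most `1 / 2`. Independent rounds, `⌈c⌉₊ + 1`
times the logarithm of `n + 1` many, and a union bound over at most `n` positions give the error
probability (`two_pow_mul_card_survives_le`, `prob_ne_le`).

Once `H` is drawn, a round is deterministic. For each `β < B`, the pattern positions with hash value
`β` and the text positions whose set contains `β` form two 0/1 sequences. Their cross-correlation,
summed over `β`, counts the agreeing positions `j`, and the count is `m` exactly if the position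
passes (`sum_cntAt`, `sum_eq_iff`). The text is cut into overlapping windows of length `N` with `2 m
≤ N ≤ 4 m`; fast Fourier transforms handle all windows for one `β` in time `O(n log m)`, hence a
round in time `O(B n log m)`, where `B ≤ 4 max(D, 1)`.

The transforms use fixed-point complex numbers with denominator `N ^ 24`. Each stage multiplies the
error by at most 3 and adds a small term, the roots of unity come from integer square roots, and the
total error is small enough for rounding to the nearest integer (`fft_runs`, `corrCmd_runs`,
`round_eq`). The counts are therefore exact and no outcome of the random words loses an occurrence.

To obtain a statement about the machine, the algorithm is written as commands over integers, and
their compilation to the word RAM is shown to cost only a constant factor (`CExec.comp`).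
Correctness and running times of commands are derived with Hoare-style rules such as `Runs.seq'` and
`Runs.loop`. -/

/-- The word that represents an integer in two's complement. -/
def enc (w : ℕ) (v : ℤ) : ℕ := (v % 2 ^ w).toNat

theorem enc_cast (w : ℕ) (v : ℤ) : (enc w v : ℤ) = v % 2 ^ w :=
  Int.toNat_of_nonneg (Int.emod_nonneg _ (by positivity))

theorem enc_natCast (w k : ℕ) : enc w (k : ℤ) = k % 2 ^ w := by
  zify; rw [enc_cast]

/-- The integer `v` is the value of an unsigned word. -/
def InR (w : ℕ) (v : ℤ) : Prop := 0 ≤ v ∧ v < 2 ^ w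

theorem enc_eq {w : ℕ} {v : ℤ} (h : InR w v) : enc w v = v.toNat := by
  rw [enc, Int.emod_eq_of_lt h.1 h.2]

theorem enc_natCast_of_lt {w k : ℕ} (h : k < 2 ^ w) : enc w (k : ℤ) = k := by
  rw [enc_natCast, Nat.mod_eq_of_lt h]

/-- Binary operations on integers. -/
inductive Op
  | add | sub | mul | div | mod | lt | eq

def Op.bin : Op → BinOp
  | .add => .add
  | .sub => .sub
  | .mul => .mul
  | .div => .div
  | .mod => .mod
  | .lt => .lt
  | .eq => .eq

def Op.ev : Op → ℤ → ℤ → ℤ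
  | .add, x, y => x + y
  | .sub, x, y => x - y
  | .mul, x, y => x * y
  | .div, x, y => x / y
  | .mod, x, y => x % y
  | .lt, x, y => if x < y then 1 else 0
  | .eq, x, y => if x = y then 1 else 0

/-- The operands for which the machine operation agrees with the integer operation. -/
def Op.ok (w : ℕ) : Op → ℤ → ℤ → Prop
  | .add, _, _ => True
  | .sub, _, _ => True
  | .mul, _, _ => True
  | .div, x, y => InR w x ∧ InR w y
  | .mod, x, y => InR w x ∧ InR w y
  | .lt, x, y => InR w x ∧ InR w y
  | .eq, x, y => InR w x ∧ InR w y

/-- Reduction modulo `2 ^ w` is a ring homomorphism, so sums, differences and products may be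
negative or too large on the way. Quotients, remainders and comparisons are not compatible with it,
and need operands that are words themselves. -/
theorem Op.bin_eval {w : ℕ} (o : Op) {x y : ℤ} (h : o.ok w x y) :
    o.bin.eval w (enc w x) (enc w y) = enc w (o.ev x y) := by
  cases o with
  | add => simp only [Op.bin, BinOp.eval, Op.ev]; zify; simp only [enc_cast]; simp
  | sub =>
    simp only [Op.bin, BinOp.eval, Op.ev]
    have h1 : enc w y % 2 ^ w ≤ 2 ^ w := (Nat.mod_lt _ (by positivity)).le
    zify [h1]
    simp only [enc_cast, Int.emod_emod]
    rw [show x % 2 ^ w + (2 ^ w - y % 2 ^ w) = (x % 2 ^ w - y % 2 ^ w) + 2 ^ w by ring]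
    simp [Int.sub_emod]
  | mul => simp only [Op.bin, BinOp.eval, Op.ev]; zify; simp only [enc_cast]; simp [Int.mul_emod]
  | div =>
    obtain ⟨⟨hx, hx'⟩, ⟨hy, hy'⟩⟩ := h
    lift x to ℕ using hx
    lift y to ℕ using hy
    norm_cast at hx' hy'
    simp only [Op.bin, BinOp.eval, Op.ev]
    rw [enc_natCast_of_lt hx', enc_natCast_of_lt hy', ← enc_natCast]
    norm_cast
  | mod =>
    obtain ⟨⟨hx, hx'⟩, ⟨hy, hy'⟩⟩ := h
    lift x to ℕ using hx
    lift y to ℕ using hy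
    norm_cast at hx' hy'
    simp only [Op.bin, BinOp.eval, Op.ev]
    rw [enc_natCast_of_lt hx', enc_natCast_of_lt hy', ← enc_natCast]
    norm_cast
  | lt =>
    obtain ⟨⟨hx, hx'⟩, ⟨hy, hy'⟩⟩ := h
    lift x to ℕ using hx
    lift y to ℕ using hy
    norm_cast at hx' hy'
    simp only [Op.bin, BinOp.eval, Op.ev]
    rw [enc_natCast_of_lt hx', enc_natCast_of_lt hy', ← enc_natCast]
    norm_cast
  | eq =>
    obtain ⟨⟨hx, hx'⟩, ⟨hy, hy'⟩⟩ := h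
    lift x to ℕ using hx
    lift y to ℕ using hy
    norm_cast at hx' hy'
    simp only [Op.bin, BinOp.eval, Op.ev]
    rw [enc_natCast_of_lt hx', enc_natCast_of_lt hy', ← enc_natCast]
    norm_cast

/-- Abstract states: integer variables, integer arrays, the number of random words used. -/
structure Abs where
  reg : ℕ → ℤ
  arr : ℕ → ℕ → ℤ
  used : ℕ

def Abs.set (a : Abs) (r : ℕ) (v : ℤ) : Abs := { a with reg := Function.update a.reg r v }

def Abs.put (a : Abs) (id x : ℕ) (v : ℤ) : Abs :=
  { a with arr := Function.update a.arr id (Function.update (a.arr id) x v) }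

@[simp] theorem Abs.set_reg (a : Abs) (r : ℕ) (v : ℤ) (r' : ℕ) :
    (a.set r v).reg r' = if r' = r then v else a.reg r' := by
  simp [Abs.set, Function.update_apply]
@[simp] theorem Abs.set_arr (a : Abs) (r : ℕ) (v : ℤ) : (a.set r v).arr = a.arr := rfl
@[simp] theorem Abs.set_used (a : Abs) (r : ℕ) (v : ℤ) : (a.set r v).used = a.used := rfl
@[simp] theorem Abs.put_reg (a : Abs) (id x : ℕ) (v : ℤ) : (a.put id x v).reg = a.reg := rfl
@[simp] theorem Abs.put_used (a : Abs) (id x : ℕ) (v : ℤ) : (a.put id x v).used = a.used := rfl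
@[simp] theorem Abs.put_arr (a : Abs) (id x : ℕ) (v : ℤ) (id' x' : ℕ) :
    (a.put id x v).arr id' x' = if id' = id ∧ x' = x then v else a.arr id' x' := by
  by_cases h : id' = id
  · subst h; simp [Abs.put, Function.update_apply]
  · simp [Abs.put, h]

/-- Expressions. -/
inductive Ex
  | lit (k : ℕ)
  | var (r : ℕ)
  | op (o : Op) (x y : Ex)
  | rd (id : ℕ) (x : Ex)
  | degT (x : Ex)
  | nbr (x y : Ex)

instance : Add Ex := ⟨Ex.op .add⟩
instance : Sub Ex := ⟨Ex.op .sub⟩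
instance : Mul Ex := ⟨Ex.op .mul⟩
instance : Div Ex := ⟨Ex.op .div⟩
instance : Mod Ex := ⟨Ex.op .mod⟩

def Ex.lt (x y : Ex) : Ex := .op .lt x y
def Ex.eq (x y : Ex) : Ex := .op .eq x y

/-- The array `0` consists of the `b` cells of the input; the other ones are interleaved. -/
def addr (b id x : ℕ) : ℕ := if id = 0 then x else b + 16 * x + id

/-- The valid array indices. -/
def AddrOk (b w id : ℕ) (v : ℤ) : Prop :=
  0 ≤ v ∧ id < 16 ∧ if id = 0 then v < b else b + 16 * v + 16 < 2 ^ w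

/-- Array `0` lies below `b`; above `b`, the arrays `1, …, 15` occupy distinct residue classes
modulo 16. Interleaving avoids fixing the lengths of the arrays in advance. -/
theorem addr_inj {b w id id' x x' : ℕ} (h : AddrOk b w id x) (h' : AddrOk b w id' x')
    (e : addr b id x = addr b id' x') : id = id' ∧ x = x' := by
  simp only [AddrOk, addr] at *
  split_ifs at * <;> omega

theorem addr_lt {b w id x : ℕ} (h : AddrOk b w id x) (hb : b < 2 ^ w) : addr b id x < 2 ^ w := by
  simp only [AddrOk, addr] at *
  split_ifs at * with h0
  · omega
  · zify; omega

section
variable {n m σT σP : ℕ}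

/-- The truncations by `toNat` never matter for expressions that satisfy `Ex.ok`, which makes
indices and oracle arguments non-negative. -/
def Ex.ev (I : Input n m σT σP) (a : Abs) : Ex → ℤ
  | .lit k => k
  | .var r => a.reg r
  | .op o x y => o.ev (x.ev I a) (y.ev I a)
  | .rd id x => a.arr id (x.ev I a).toNat
  | .degT x => degTOracle I (x.ev I a).toNat
  | .nbr x y => nbrOracle I (x.ev I a).toNat (y.ev I a).toNat

/-- The expression can be evaluated by the machine. -/
def Ex.ok (w : ℕ) (I : Input n m σT σP) (a : Abs) : Ex → Prop
  | .lit _ => True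
  | .var _ => True
  | .op o x y => x.ok w I a ∧ y.ok w I a ∧ o.ok w (x.ev I a) (y.ev I a)
  | .rd id x => x.ok w I a ∧ AddrOk (n + m) w id (x.ev I a)
  | .degT x => x.ok w I a ∧ InR w (x.ev I a)
  | .nbr x y => x.ok w I a ∧ y.ok w I a ∧ InR w (x.ev I a) ∧ InR w (y.ev I a)

variable (w : ℕ) (I : Input n m σT σP) (a : Abs)

@[simp] theorem Ex.ev_lit (k : ℕ) : (Ex.lit k).ev I a = k := rfl
@[simp] theorem Ex.ev_var (r : ℕ) : (Ex.var r).ev I a = a.reg r := rfl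
@[simp] theorem Ex.ev_rd (id : ℕ) (x : Ex) :
    (Ex.rd id x).ev I a = a.arr id (x.ev I a).toNat := rfl
@[simp] theorem Ex.ev_degT (x : Ex) : (Ex.degT x).ev I a = degTOracle I (x.ev I a).toNat := rfl
@[simp] theorem Ex.ev_nbr (x y : Ex) :
    (Ex.nbr x y).ev I a = nbrOracle I (x.ev I a).toNat (y.ev I a).toNat := rfl
@[simp] theorem Ex.ev_add (x y : Ex) : (x + y).ev I a = x.ev I a + y.ev I a := rfl
@[simp] theorem Ex.ev_sub (x y : Ex) : (x - y).ev I a = x.ev I a - y.ev I a := rfl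
@[simp] theorem Ex.ev_mul (x y : Ex) : (x * y).ev I a = x.ev I a * y.ev I a := rfl
@[simp] theorem Ex.ev_div (x y : Ex) : (x / y).ev I a = x.ev I a / y.ev I a := rfl
@[simp] theorem Ex.ev_mod (x y : Ex) : (x % y).ev I a = x.ev I a % y.ev I a := rfl
@[simp] theorem Ex.ev_lt (x y : Ex) :
    (x.lt y).ev I a = if x.ev I a < y.ev I a then 1 else 0 := rfl
@[simp] theorem Ex.ev_eq (x y : Ex) :
    (x.eq y).ev I a = if x.ev I a = y.ev I a then 1 else 0 := rfl

@[simp] theorem Ex.ok_lit (k : ℕ) : (Ex.lit k).ok w I a := trivial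
@[simp] theorem Ex.ok_var (r : ℕ) : (Ex.var r).ok w I a := trivial
@[simp] theorem Ex.ok_rd (id : ℕ) (x : Ex) :
    (Ex.rd id x).ok w I a ↔ x.ok w I a ∧ AddrOk (n + m) w id (x.ev I a) := Iff.rfl
@[simp] theorem Ex.ok_nbr (x y : Ex) :
    (Ex.nbr x y).ok w I a ↔ x.ok w I a ∧ y.ok w I a ∧ InR w (x.ev I a) ∧ InR w (y.ev I a) :=
  Iff.rfl
@[simp] theorem Ex.ok_add (x y : Ex) : (x + y).ok w I a ↔ x.ok w I a ∧ y.ok w I a :=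
  ⟨fun h => ⟨h.1, h.2.1⟩, fun h => ⟨h.1, h.2, trivial⟩⟩
@[simp] theorem Ex.ok_sub (x y : Ex) : (x - y).ok w I a ↔ x.ok w I a ∧ y.ok w I a :=
  ⟨fun h => ⟨h.1, h.2.1⟩, fun h => ⟨h.1, h.2, trivial⟩⟩
@[simp] theorem Ex.ok_mul (x y : Ex) : (x * y).ok w I a ↔ x.ok w I a ∧ y.ok w I a :=
  ⟨fun h => ⟨h.1, h.2.1⟩, fun h => ⟨h.1, h.2, trivial⟩⟩
@[simp] theorem Ex.ok_div (x y : Ex) :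
    (x / y).ok w I a ↔ x.ok w I a ∧ y.ok w I a ∧ InR w (x.ev I a) ∧ InR w (y.ev I a) := Iff.rfl
@[simp] theorem Ex.ok_mod (x y : Ex) :
    (x % y).ok w I a ↔ x.ok w I a ∧ y.ok w I a ∧ InR w (x.ev I a) ∧ InR w (y.ev I a) := Iff.rfl
@[simp] theorem Ex.ok_lt (x y : Ex) :
    (x.lt y).ok w I a ↔ x.ok w I a ∧ y.ok w I a ∧ InR w (x.ev I a) ∧ InR w (y.ev I a) := Iff.rfl
@[simp] theorem Ex.ok_eq (x y : Ex) :
    (x.eq y).ok w I a ↔ x.ok w I a ∧ y.ok w I a ∧ InR w (x.ev I a) ∧ InR w (y.ev I a) := Iff.rfl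

end

/-- Commands; `loop i e p` runs `p` for `i = 0, …, e - 1`, where `e` is evaluated once. -/
inductive Cmd
  | skip
  | asg (r : ℕ) (e : Ex)
  | sto (id : ℕ) (x v : Ex)
  | rnd (r b : ℕ)
  | seq (p q : Cmd)
  | ite (e : Ex) (p q : Cmd)
  | loop (i : ℕ) (e : Ex) (p : Cmd)

infixr:60 " ;; " => Cmd.seq

/-- The variable `r` may be changed. -/
def Cmd.wr (r : ℕ) : Cmd → Bool
  | .skip => false
  | .asg r' _ => r' == r
  | .sto _ _ _ => false
  | .rnd r' _ => r' == r
  | .seq p q => p.wr r || q.wr r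
  | .ite _ p q => p.wr r || q.wr r
  | .loop i _ p => i == r || p.wr r

/-- The array `id` may be changed. -/
def Cmd.wa (id : ℕ) : Cmd → Bool
  | .skip => false
  | .asg _ _ => false
  | .sto id' _ _ => id' == id
  | .rnd _ _ => false
  | .seq p q => p.wa id || q.wa id
  | .ite _ p q => p.wa id || q.wa id
  | .loop _ _ p => p.wa id

/-- Random words may be used. -/
def Cmd.rands : Cmd → Bool
  | .skip => false
  | .asg _ _ => false
  | .sto _ _ _ => false
  | .rnd _ _ => true
  | .seq p q => p.rands || q.rands
  | .ite _ p q => p.rands || q.rands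
  | .loop _ _ p => p.rands

/-- Big-step semantics of commands, with the number of steps. -/
inductive CExec {n m σT σP : ℕ} (w : ℕ) (I : Input n m σT σP) (tape : ℕ → ℕ) :
    Cmd → Abs → ℕ → Abs → Prop
  | skip (a : Abs) : CExec w I tape .skip a 1 a
  | asg {r : ℕ} {e : Ex} {a : Abs} : e.ok w I a →
      CExec w I tape (.asg r e) a 1 (a.set r (e.ev I a))
  | sto {id : ℕ} {x v : Ex} {a : Abs} : x.ok w I a → v.ok w I a →
      AddrOk (n + m) w id (x.ev I a) →
      CExec w I tape (.sto id x v) a 1 (a.put id (x.ev I a).toNat (v.ev I a))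
  | rnd {r b : ℕ} {a : Abs} : 0 < a.reg b → a.reg b < 2 ^ w →
      CExec w I tape (.rnd r b) a 1
        { a.set r ((tape a.used % (a.reg b).toNat : ℕ) : ℤ) with used := a.used + 1 }
  | seq {p q : Cmd} {a a' a'' : Abs} {t t' : ℕ} : CExec w I tape p a t a' →
      CExec w I tape q a' t' a'' → CExec w I tape (.seq p q) a (t + t') a''
  | ite_true {e : Ex} {p q : Cmd} {a a' : Abs} {t : ℕ} : e.ok w I a → InR w (e.ev I a) →
      e.ev I a ≠ 0 → CExec w I tape p a t a' → CExec w I tape (.ite e p q) a (t + 1) a'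
  | ite_false {e : Ex} {p q : Cmd} {a a' : Abs} {t : ℕ} : e.ok w I a →
      e.ev I a = 0 → CExec w I tape q a t a' → CExec w I tape (.ite e p q) a (t + 1) a'
  -- `f k` is the state before iteration `k` and `g k` the state after its body. Giving all of them
  -- at once yields one induction hypothesis per iteration. The body must not write the counter,
  -- which is set between iterations.
  | loop {i : ℕ} {e : Ex} {p : Cmd} {a : Abs} (L : ℕ) (f g : ℕ → Abs) (t : ℕ → ℕ) :
      e.ok w I a → e.ev I a = L → L < 2 ^ w → p.wr i = false → f 0 = a.set i 0 →
      (∀ k < L, CExec w I tape p (f k) (t k) (g k)) →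
      (∀ k < L, f (k + 1) = (g k).set i (k + 1 : ℕ)) →
      CExec w I tape (.loop i e p) a (1 + ∑ k ∈ Finset.range L, (t k + 1)) (f L)

/-! ### Compilation -/

/-- The machine register of a variable. -/
def rg (r : ℕ) : ℕ := 4 * r + 20
/-- The machine registers for temporary values. -/
def tm (r : ℕ) : ℕ := 4 * r + 21
/-- The machine register for the limit of the loop with counter `r`. -/
def lm (r : ℕ) : ℕ := 4 * r + 22
/-- The machine register for the test of the loop with counter `r`. -/
def fl (r : ℕ) : ℕ := 4 * r + 23

/-- Turn the array index in `tm t` into an address. -/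
def addrProg (id t : ℕ) : Prog :=
  if id = 0 then .skip else
    .seq (.instr (.const (tm (t + 1)) 16)) (.seq (.instr (.bin .mul (tm t) (tm t) (tm (t + 1))))
      (.seq (.instr (.const (tm (t + 1)) id)) (.seq (.instr (.bin .add (tm t) (tm t) (tm (t + 1))))
        (.instr (.bin .add (tm t) (tm t) 5)))))

def addrCost (id : ℕ) : ℕ := if id = 0 then 1 else 5

/-- The value is left in `tm t`, and only temporaries from `t` on are touched. The machine has no
instruction to move a register; a variable is copied by adding zero. -/
def Ex.comp : Ex → ℕ → Prog
  | .lit k, t => .instr (.const (tm t) k)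
  | .var r, t => .seq (.instr (.const (tm t) 0)) (.instr (.bin .add (tm t) (rg r) (tm t)))
  | .op o x y, t =>
    .seq (x.comp t) (.seq (y.comp (t + 1)) (.instr (.bin o.bin (tm t) (tm t) (tm (t + 1)))))
  | .rd id x, t => .seq (x.comp t) (.seq (addrProg id t) (.instr (.load (tm t) (tm t))))
  | .degT x, t => .seq (x.comp t) (.instr (.degT (tm t) (tm t)))
  | .nbr x y, t =>
    .seq (x.comp t) (.seq (y.comp (t + 1)) (.instr (.nbr (tm t) (tm t) (tm (t + 1)))))

def Ex.cost : Ex → ℕ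
  | .lit _ => 1
  | .var _ => 2
  | .op _ x y => x.cost + (y.cost + 1)
  | .rd id x => x.cost + (addrCost id + 1)
  | .degT x => x.cost + 1
  | .nbr x y => x.cost + (y.cost + 1)

/-- The limit of a loop is kept in a register of its own, `lm i`, because the body overwrites the
temporaries; the test in `fl i` is recomputed at the end of each iteration. -/
def Cmd.comp : Cmd → Prog
  | .skip => .skip
  | .asg r e => .seq (e.comp 0)
      (.seq (.instr (.const (tm 1) 0)) (.instr (.bin .add (rg r) (tm 0) (tm 1))))
  | .sto id x v =>
      .seq (x.comp 0) (.seq (addrProg id 0) (.seq (v.comp 1) (.instr (.store (tm 0) (tm 1)))))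
  | .rnd r b => .seq (.instr (.rand (tm 0))) (.instr (.bin .mod (rg r) (tm 0) (rg b)))
  | .seq p q => .seq p.comp q.comp
  | .ite e p q => .seq (e.comp 0) (.ite (tm 0) p.comp q.comp)
  | .loop i e p =>
      .seq (e.comp 0) (.seq (.instr (.const (tm 1) 0)) (.seq (.instr (.bin .add (lm i) (tm 0) (tm 1)))
        (.seq (.instr (.const (rg i) 0)) (.seq (.instr (.bin .lt (fl i) (rg i) (lm i)))
          (.loop (fl i) (.seq p.comp (.seq (.instr (.const (tm 0) 1))
            (.seq (.instr (.bin .add (rg i) (rg i) (tm 0)))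
              (.instr (.bin .lt (fl i) (rg i) (lm i)))))))))))

/-- A bound for the number of machine steps that a step of the command takes. -/
def Cmd.cost : Cmd → ℕ
  | .skip => 1
  | .asg _ e => e.cost + 2
  | .sto id x v => x.cost + addrCost id + v.cost + 1
  | .rnd _ _ => 2
  | .seq p q => p.cost + q.cost
  | .ite e p q => e.cost + p.cost + q.cost + 1
  | .loop _ e p => e.cost + p.cost + 10

/-- The machine state `s` represents the abstract state `a`. -/
structure Rep (w b : ℕ) (s : State) (a : Abs) : Prop where
  reg : ∀ r, s.reg (rg r) = enc w (a.reg r)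
  mem : ∀ id x : ℕ, AddrOk b w id x → s.mem (addr b id x) = enc w (a.arr id x)
  base : s.reg 5 = b
  lt : b < 2 ^ w
  used : s.used = a.used

/-- The states differ only in the temporary registers from `t` on. -/
structure SameBut (t : ℕ) (s s' : State) : Prop where
  reg : ∀ r, (∀ u, t ≤ u → r ≠ tm u) → s'.reg r = s.reg r
  mem : s'.mem = s.mem
  used : s'.used = s.used

theorem SameBut.refl (t : ℕ) (s : State) : SameBut t s s := ⟨fun _ _ => rfl, rfl, rfl⟩

theorem SameBut.trans {t t' u : ℕ} {s s' s'' : State} (h : SameBut t s s') (h' : SameBut t' s' s'')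
    (hu : u ≤ t) (hu' : u ≤ t') : SameBut u s s'' :=
  ⟨fun r hr => (h'.reg r fun v hv => hr v (by omega)).trans (h.reg r fun v hv => hr v (by omega)),
    h'.mem.trans h.mem, h'.used.trans h.used⟩

theorem SameBut.set {t u : ℕ} (s : State) (v : ℕ) (h : t ≤ u) : SameBut t s (s.set (tm u) v) :=
  ⟨fun r hr => by simp [State.set, Function.update_of_ne (hr u h)], rfl, rfl⟩

theorem SameBut.rep {w b t : ℕ} {s s' : State} {a : Abs} (h : SameBut t s s') (hr : Rep w b s a) :
    Rep w b s' a where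
  reg r := by rw [h.reg _ (fun u _ => by simp only [rg, tm]; omega), hr.reg]
  mem id x hx := by rw [h.mem, hr.mem id x hx]
  base := by rw [h.reg _ (fun u _ => by simp only [tm]; omega), hr.base]
  lt := hr.lt
  used := by rw [h.used, hr.used]

theorem State.set_reg (s : State) (r v r' : ℕ) :
    (s.set r v).reg r' = if r' = r then v else s.reg r' := by
  simp [State.set, Function.update_apply]

section
variable {n m σT σP : ℕ} {w : ℕ} {I : Input n m σT σP} {tape : ℕ → ℕ}

theorem addrProg_exec {id t : ℕ} {v : ℤ} {s : State} (hv : AddrOk (n + m) w id v)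
    (hs : s.reg (tm t) = enc w v) (hb : s.reg 5 = n + m) (hlt : n + m < 2 ^ w) :
    ∃ s', Exec w I tape (addrProg id t) s (addrCost id) s' ∧
      s'.reg (tm t) = addr (n + m) id v.toNat ∧ SameBut t s s' := by
  have hv' : AddrOk (n + m) w id (v.toNat : ℤ) := by rwa [Int.toNat_of_nonneg hv.1]
  have hal := addr_lt hv' hlt
  by_cases h0 : id = 0
  · refine ⟨s, ?_, ?_, SameBut.refl _ _⟩
    · simp only [addrProg, addrCost, if_pos h0]; exact .skip _
    · have : v < 2 ^ w := by
        have := hv.2.2; rw [if_pos h0] at this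
        have h2 : ((n + m : ℕ) : ℤ) < 2 ^ w := by exact_mod_cast hlt
        omega
      rw [hs, enc_eq ⟨hv.1, this⟩, addr, if_pos h0]
  · simp only [addrProg, addrCost, if_neg h0]
    refine ⟨_, .seq (.instr _ _) (.seq (.instr _ _) (.seq (.instr _ _)
      (.seq (.instr _ _) (.instr _ _)))), ?_, ?_⟩
    · have h5 : ∀ u, 5 ≠ tm u := fun u => by simp only [tm]; omega
      have h1 : tm t ≠ tm (t + 1) := by simp only [tm]; omega
      simp only [Instr.apply, State.set_reg, h5, h1, hs, hb, if_true, if_false, ← enc_natCast]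
      have e1 := Op.bin_eval (w := w) .mul (x := v) (y := (16 : ℕ)) trivial
      have e2 := Op.bin_eval (w := w) .add (x := v * (16 : ℕ)) (y := id) trivial
      have e3 := Op.bin_eval (w := w) .add (x := v * (16 : ℕ) + id) (y := (n + m : ℕ)) trivial
      simp only [Op.bin, Op.ev] at e1 e2 e3
      rw [enc_natCast_of_lt hlt] at e3
      rw [e1, e2, e3]
      have : v * (16 : ℕ) + id + (n + m : ℕ) = (addr (n + m) id v.toNat : ℕ) := by
        rw [addr, if_neg h0]; push_cast; rw [Int.toNat_of_nonneg hv.1]; ring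
      rw [this, enc_natCast_of_lt hal]
    · have e (s : State) (v : ℕ) := SameBut.set (t := t) (u := t) s v le_rfl
      have e' (s : State) (v : ℕ) := SameBut.set (t := t) (u := t + 1) s v (by omega)
      exact ((((e' _ _).trans (e _ _) le_rfl le_rfl).trans (e' _ _) le_rfl le_rfl).trans
        (e _ _) le_rfl le_rfl).trans (e _ _) le_rfl le_rfl

/-- `SameBut t` carries the induction: the second operand is evaluated from `t + 1` on, so the first
operand survives in `tm t`, and the represented abstract state is not affected. -/
theorem Ex.comp_exec (e : Ex) : ∀ {t : ℕ} {s : State} {a : Abs}, Rep w (n + m) s a →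
    e.ok w I a → ∃ s', Exec w I tape (e.comp t) s e.cost s' ∧
      s'.reg (tm t) = enc w (e.ev I a) ∧ SameBut t s s' := by
  have htr (u r : ℕ) : rg r ≠ tm u := by simp only [rg, tm]; omega
  have htt (t : ℕ) : tm t ≠ tm (t + 1) := by simp only [tm]; omega
  have hle {t u : ℕ} (h : t + 1 ≤ u) : tm t ≠ tm u := by simp only [tm]; omega
  induction e with
  | lit k =>
    intro t s a _ _
    exact ⟨_, .instr _ _, by simp [Instr.apply, State.set_reg, ← enc_natCast],
      SameBut.set _ _ le_rfl⟩
  | var r =>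
    intro t s a hr _
    refine ⟨_, .seq (.instr _ _) (.instr _ _), ?_,
      (SameBut.set _ _ le_rfl).trans (SameBut.set _ _ le_rfl) le_rfl le_rfl⟩
    have := Op.bin_eval (w := w) .add (x := a.reg r) (y := (0 : ℕ)) trivial
    simp only [Op.bin, Op.ev, Nat.cast_zero, add_zero] at this
    simp only [Instr.apply, State.set_reg, if_true, if_neg (htr _ _), hr.reg, ← enc_natCast,
      Nat.cast_zero, this, Ex.ev]
  | op o x y ihx ihy =>
    intro t s a hr hok
    obtain ⟨s1, h1, v1, b1⟩ := ihx (t := t) hr hok.1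
    obtain ⟨s2, h2, v2, b2⟩ := ihy (t := t + 1) (b1.rep hr) hok.2.1
    refine ⟨_, .seq h1 (.seq h2 (.instr _ _)), ?_,
      (b1.trans b2 le_rfl (Nat.le_succ t)).trans (SameBut.set _ _ le_rfl) le_rfl le_rfl⟩
    have h3 : s2.reg (tm t) = s1.reg (tm t) := b2.reg _ fun u hu => hle hu
    simp only [Instr.apply, State.set_reg, if_true, h3, v1, v2, Ex.ev]
    exact o.bin_eval hok.2.2
  | rd id x ihx =>
    intro t s a hr hok
    obtain ⟨s1, h1, v1, b1⟩ := ihx (t := t) hr hok.1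
    have hr1 := b1.rep hr
    obtain ⟨s2, h2, v2, b2⟩ := addrProg_exec (I := I) (tape := tape) hok.2 v1 hr1.base hr1.lt
    refine ⟨_, .seq h1 (.seq h2 (.instr _ _)), ?_,
      (b1.trans b2 le_rfl le_rfl).trans (SameBut.set _ _ le_rfl) le_rfl le_rfl⟩
    simp only [Instr.apply, State.set_reg, if_true, v2, Ex.ev]
    have : AddrOk (n + m) w id ((x.ev I a).toNat : ℤ) := by
      rw [Int.toNat_of_nonneg hok.2.1]; exact hok.2
    exact (b2.rep hr1).mem _ _ this
  | degT x ihx =>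
    intro t s a hr hok
    obtain ⟨s1, h1, v1, b1⟩ := ihx (t := t) hr hok.1
    refine ⟨_, .seq h1 (.instr _ _), ?_, b1.trans (SameBut.set _ _ le_rfl) le_rfl le_rfl⟩
    simp only [Instr.apply, State.set_reg, if_true, v1, Ex.ev, enc_eq hok.2, enc_natCast]
  | nbr x y ihx ihy =>
    intro t s a hr hok
    obtain ⟨s1, h1, v1, b1⟩ := ihx (t := t) hr hok.1
    obtain ⟨s2, h2, v2, b2⟩ := ihy (t := t + 1) (b1.rep hr) hok.2.1
    refine ⟨_, .seq h1 (.seq h2 (.instr _ _)), ?_,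
      (b1.trans b2 le_rfl (Nat.le_succ t)).trans (SameBut.set _ _ le_rfl) le_rfl le_rfl⟩
    have h3 : s2.reg (tm t) = s1.reg (tm t) := b2.reg _ fun u hu => hle hu
    simp only [Instr.apply, State.set_reg, if_true, h3, v1, v2, Ex.ev, enc_eq hok.2.2.1,
      enc_eq hok.2.2.2, enc_natCast]

theorem Rep.set {b : ℕ} {s : State} {a : Abs} (h : Rep w b s a) (r : ℕ) {v : ℕ} {z : ℤ}
    (hv : v = enc w z) : Rep w b (s.set (rg r) v) (a.set r z) where
  reg r' := by
    have : rg r' = rg r ↔ r' = r := by simp only [rg]; omega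
    simp only [State.set_reg, Abs.set_reg, this]
    split_ifs with h'
    · exact hv
    · exact h.reg r'
  mem := h.mem
  base := by
    rw [State.set_reg, if_neg (by simp only [rg]; omega)]; exact h.base
  lt := h.lt
  used := h.used

/-- The bookkeeping registers of loops are invisible to the abstract state. -/
theorem Rep.of_reg {b : ℕ} {s s' : State} {a : Abs} (h : Rep w b s a)
    (hreg : ∀ r, (∀ i, r ≠ lm i) → (∀ i, r ≠ fl i) → s'.reg r = s.reg r)
    (hmem : s'.mem = s.mem) (hused : s'.used = s.used) : Rep w b s' a where
  reg r := by
    rw [hreg _ (fun i => by simp only [rg, lm]; omega) (fun i => by simp only [rg, fl]; omega),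
      h.reg]
  mem id x hx := by rw [hmem, h.mem id x hx]
  base := by
    rw [hreg _ (fun i => by simp only [lm]; omega) (fun i => by simp only [fl]; omega), h.base]
  lt := h.lt
  used := by rw [hused, h.used]

theorem Rep.store {b : ℕ} {s : State} {a : Abs} (h : Rep w b s a) {id x : ℕ}
    (hx : AddrOk b w id x) {v : ℕ} {z : ℤ} (hv : v = enc w z) :
    Rep w b { s with mem := Function.update s.mem (addr b id x) v } (a.put id x z) where
  reg := h.reg
  mem id' x' hx' := by
    rw [Abs.put_arr]
    by_cases he : id' = id ∧ x' = x
    · rw [if_pos he, he.1, he.2]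
      exact (Function.update_self ..).trans hv
    · rw [if_neg he, ← h.mem id' x' hx']
      refine Function.update_of_ne ?_ ..
      intro e
      exact he (addr_inj hx' hx e)
  base := h.base
  lt := h.lt
  used := h.used

/-- The loop of a compiled `loop` command, from iteration `k` on. -/
theorem loop_exec {i : ℕ} {p : Cmd} {L c : ℕ} (hL : L < 2 ^ w) (f g : ℕ → Abs) (t : ℕ → ℕ)
    (hp : p.wr i = false)
    (hstep : ∀ k < L, f (k + 1) = (g k).set i (k + 1 : ℕ))
    (hreg : ∀ k ≤ L, (f k).reg i = k)
    (hg : ∀ k < L, (g k).reg i = k)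
    (ih : ∀ k < L, ∀ s, Rep w (n + m) s (f k) → ∃ t' s', t' ≤ c * t k ∧
      Exec w I tape p.comp s t' s' ∧ Rep w (n + m) s' (g k) ∧
      ∀ j, p.wr j = false → s'.reg (lm j) = s.reg (lm j)) :
    ∀ d k, k + d = L → ∀ s, Rep w (n + m) s (f k) → s.reg (lm i) = L →
      s.reg (fl i) = enc w (Op.lt.ev k L) → ∃ t' s',
      t' ≤ (c + 4) * ∑ j ∈ Finset.Ico k L, (t j + 1) + 1 ∧
      Exec w I tape (.loop (fl i) (.seq p.comp (.seq (.instr (.const (tm 0) 1))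
            (.seq (.instr (.bin .add (rg i) (rg i) (tm 0)))
              (.instr (.bin .lt (fl i) (rg i) (lm i))))))) s t' s' ∧ Rep w (n + m) s' (f L) ∧
      ∀ j, p.wr j = false → s'.reg (lm j) = s.reg (lm j) := by
  -- Induction on the number `d` of remaining iterations. An iteration costs the body plus three
  -- instructions and one test, whence `c + 4`.
  intro d
  induction d with
  | zero =>
    intro k hk s hr hl hf
    obtain rfl : k = L := by omega
    refine ⟨1, s, by omega, .loop_done ?_, hr, fun _ _ => rfl⟩
    rw [hf]; simp [Op.ev, enc]
  | succ d ihd =>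
    intro k hk s hr hl hf
    have hkL : k < L := by omega
    have h2 : 1 < 2 ^ w := by omega
    obtain ⟨t1, s1, ht1, e1, r1, l1⟩ := ih k hkL s hr
    set s2 := s1.set (tm 0) (1 % 2 ^ w) with hs2
    have r2 : Rep w (n + m) s2 (g k) := (SameBut.set s1 _ le_rfl).rep r1
    have hc : BinOp.eval w .add (s2.reg (rg i)) (s2.reg (tm 0)) = enc w ((k + 1 : ℕ) : ℤ) := by
      rw [r2.reg, hg k hkL, show s2.reg (tm 0) = enc w ((1 : ℕ) : ℤ) by
        rw [hs2, State.set_reg, if_pos rfl, enc_natCast]]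
      have := Op.bin_eval (w := w) .add (x := k) (y := (1 : ℕ)) trivial
      simp only [Op.bin, Op.ev] at this
      rw [this]; push_cast; rfl
    set s3 := s2.set (rg i) (BinOp.eval w .add (s2.reg (rg i)) (s2.reg (tm 0))) with hs3
    have r3 : Rep w (n + m) s3 (f (k + 1)) := by
      rw [hstep k hkL]; exact r2.set i hc
    have hl3 (j : ℕ) : s3.reg (lm j) = s1.reg (lm j) := by
      rw [hs3, State.set_reg, if_neg (by simp only [lm, rg]; omega), hs2, State.set_reg,
        if_neg (by simp only [lm, tm]; omega)]
    have hli : s3.reg (lm i) = L := by rw [hl3, l1 i hp, hl]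
    have hb : BinOp.eval w .lt (s3.reg (rg i)) (s3.reg (lm i)) =
        enc w (Op.lt.ev (k + 1 : ℕ) L) := by
      rw [hli, r3.reg, hreg (k + 1) hkL]
      have := Op.bin_eval (w := w) .lt (x := (k + 1 : ℕ)) (y := L) ⟨⟨?_, ?_⟩, ?_, ?_⟩
      · rwa [enc_natCast_of_lt hL] at this
      · positivity
      · exact_mod_cast (show k + 1 < 2 ^ w by omega)
      · positivity
      · exact_mod_cast hL
    set s4 := s3.set (fl i) (BinOp.eval w .lt (s3.reg (rg i)) (s3.reg (lm i))) with hs4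
    have hq (r : ℕ) (h : r ≠ fl i) : s4.reg r = s3.reg r := by
      rw [hs4, State.set_reg, if_neg h]
    have hlf (j : ℕ) : lm j ≠ fl i := by simp only [lm, fl]; omega
    have r4 : Rep w (n + m) s4 (f (k + 1)) :=
      r3.of_reg (fun r _ h => hq r (h i)) rfl rfl
    obtain ⟨t5, s5, ht5, e5, r5, l5⟩ := ihd (k + 1) (by omega) s4 r4
      (by rw [hq _ (hlf i), hli]) (by rw [hs4, State.set_reg, if_pos rfl, hb])
    refine ⟨_, s5, ?_, .loop_step ?_ (.seq e1 (.seq (.instr _ _) (.seq (.instr _ _)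
      (.instr _ _)))) e5, r5, fun j hj => ?_⟩
    · rw [Finset.sum_eq_sum_Ico_succ_bot hkL]
      nlinarith
    · rw [hf, Op.ev, if_pos (by exact_mod_cast hkL)]
      have := enc_natCast_of_lt h2
      simp only [Nat.cast_one] at this
      rw [this]; exact one_ne_zero
    · rw [l5 j hj, hq _ (hlf j), hl3, l1 j hj]

/-- This and the next two lemmas reduce non-interference to a syntactic check, so that for concrete
commands it can mostly be discharged by `rfl`. -/
theorem CExec.wr {c : Cmd} {a a' : Abs} {t : ℕ} (h : CExec w I tape c a t a') :
    ∀ r, c.wr r = false → a'.reg r = a.reg r := by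
  induction h with
  | skip => intro r _; rfl
  | asg => intro r hr; simp [Cmd.wr] at hr; simp [Ne.symm hr]
  | sto => intro r _; rfl
  | rnd => intro r hr; simp [Cmd.wr] at hr; simp [Ne.symm hr]
  | seq _ _ ih ih' =>
    intro r hr
    simp [Cmd.wr] at hr
    rw [ih' r hr.2, ih r hr.1]
  | ite_true _ _ _ _ ih => intro r hr; simp [Cmd.wr] at hr; exact ih r hr.1
  | ite_false _ _ _ ih => intro r hr; simp [Cmd.wr] at hr; exact ih r hr.2
  | @loop i e p a L f g t _ _ _ _ h0 _ hs ih =>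
    intro r hr
    simp [Cmd.wr] at hr
    have : ∀ k ≤ L, (f k).reg r = a.reg r := by
      intro k
      induction k with
      | zero => intro _; rw [h0]; simp [Ne.symm hr.1]
      | succ k ihk =>
        intro hk
        rw [hs k hk]
        simp [Ne.symm hr.1, ih k hk r hr.2, ihk (by omega)]
    exact this L le_rfl

theorem CExec.wa {c : Cmd} {a a' : Abs} {t : ℕ} (h : CExec w I tape c a t a') :
    ∀ r, c.wa r = false → a'.arr r = a.arr r := by
  induction h with
  | skip => intro r _; rfl
  | asg => intro r hr; rfl
  | sto => intro r hr; simp [Cmd.wa] at hr; simp [Abs.put, Ne.symm hr]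
  | rnd => intro r hr; rfl
  | seq _ _ ih ih' =>
    intro r hr
    simp [Cmd.wa] at hr
    rw [ih' r hr.2, ih r hr.1]
  | ite_true _ _ _ _ ih => intro r hr; simp [Cmd.wa] at hr; exact ih r hr.1
  | ite_false _ _ _ ih => intro r hr; simp [Cmd.wa] at hr; exact ih r hr.2
  | @loop i e p a L f g t _ _ _ _ h0 _ hs ih =>
    intro r hr
    simp [Cmd.wa] at hr
    have : ∀ k ≤ L, (f k).arr r = a.arr r := by
      intro k
      induction k with
      | zero => intro _; rw [h0]; simp
      | succ k ihk =>
        intro hk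
        rw [hs k hk]
        simp [ih k hk r hr, ihk (by omega)]
    exact this L le_rfl

theorem CExec.rands {c : Cmd} {a a' : Abs} {t : ℕ} (h : CExec w I tape c a t a') :
    c.rands = false → a'.used = a.used := by
  induction h with
  | skip => intro _; rfl
  | asg => intro hr; rfl
  | sto => intro hr; rfl
  | rnd => intro hr; simp [Cmd.rands] at hr
  | seq _ _ ih ih' =>
    intro hr
    simp [Cmd.rands] at hr
    rw [ih' hr.2, ih hr.1]
  | ite_true _ _ _ _ ih => intro hr; simp [Cmd.rands] at hr; exact ih hr.1
  | ite_false _ _ _ ih => intro hr; simp [Cmd.rands] at hr; exact ih hr.2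
  | @loop i e p a L f g t _ _ _ _ h0 _ hs ih =>
    intro hr
    simp [Cmd.rands] at hr
    have : ∀ k ≤ L, (f k).used = a.used := by
      intro k
      induction k with
      | zero => intro _; rw [h0]; simp
      | succ k ihk =>
        intro hk
        rw [hs k hk]
        simp [ih k hk hr, ihk (by omega)]
    exact this L le_rfl

/-- The compiled program simulates the command. -/
theorem CExec.comp {c : Cmd} {a a' : Abs} {t : ℕ} (h : CExec w I tape c a t a') :
    ∀ s, Rep w (n + m) s a → ∃ t' s', t' ≤ c.cost * t ∧ Exec w I tape c.comp s t' s' ∧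
      Rep w (n + m) s' a' ∧ ∀ j, c.wr j = false → s'.reg (lm j) = s.reg (lm j) := by
  have hlt (j u : ℕ) : lm j ≠ tm u := by simp only [lm, tm]; omega
  have hlr (j u : ℕ) : lm j ≠ rg u := by simp only [lm, rg]; omega
  have mov (z : ℤ) : BinOp.eval w .add (enc w z) (enc w 0) = enc w z := by
    have := Op.bin_eval (w := w) .add (x := z) (y := 0) trivial
    simpa only [Op.bin, Op.ev, add_zero] using this
  have h0w : 0 % 2 ^ w = enc w 0 := by simp [enc]
  induction h with
  | skip a => intro s hr; exact ⟨1, s, by simp [Cmd.cost], .skip _, hr, fun _ _ => rfl⟩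
  | @asg r e a hok =>
    intro s hr
    obtain ⟨s1, e1, v1, b1⟩ := e.comp_exec (t := 0) hr hok
    have r1 := b1.rep hr
    set s2 := s1.set (tm 1) (0 % 2 ^ w) with hs2
    have r2 : Rep w (n + m) s2 a := (SameBut.set (t := 0) s1 _ (by omega)).rep r1
    refine ⟨_, _, ?_, .seq e1 (.seq (.instr _ _) (.instr _ _)),
      r2.set r (v := BinOp.eval w .add (s2.reg (tm 0)) (s2.reg (tm 1))) ?_, fun j _ => ?_⟩
    · simp [Cmd.cost]
    · rw [hs2, State.set_reg, State.set_reg, if_neg (by simp only [tm]; omega), if_pos rfl, v1,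
        h0w, mov]
    · simp only [Instr.apply, State.set_reg, if_neg (hlr _ _), if_neg (hlt _ _)]
      exact b1.reg _ fun u _ => hlt j u
  | @sto id x v a hx hv hok =>
    intro s hr
    obtain ⟨s1, e1, v1, b1⟩ := x.comp_exec (tape := tape) (t := 0) hr hx
    have r1 := b1.rep hr
    obtain ⟨s2, e2, v2, b2⟩ := addrProg_exec (I := I) (tape := tape) hok v1 r1.base r1.lt
    have r2 := b2.rep r1
    obtain ⟨s3, e3, v3, b3⟩ := v.comp_exec (tape := tape) (t := 1) r2 hv
    have r3 := b3.rep r2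
    have hok' : AddrOk (n + m) w id ((x.ev I a).toNat : ℤ) := by
      rw [Int.toNat_of_nonneg hok.1]; exact hok
    refine ⟨_, _, ?_, .seq e1 (.seq e2 (.seq e3 (.instr _ _))), ?_, fun j _ => ?_⟩
    · simp only [Cmd.cost]; omega
    · have h4 : s3.reg (tm 0) = addr (n + m) id (x.ev I a).toNat := by
        rw [b3.reg _ fun u hu => by simp only [tm]; omega, v2]
      simp only [Instr.apply, h4]
      exact r3.store hok' v3
    · simp only [Instr.apply]
      rw [b3.reg _ fun u _ => hlt j u, b2.reg _ fun u _ => hlt j u, b1.reg _ fun u _ => hlt j u]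
  | @rnd r b a h0 h1 =>
    intro s hr
    refine ⟨_, _, ?_, .seq (.instr _ _) (.instr _ _), ?_, fun j _ => ?_⟩
    · simp [Cmd.cost]
    · set s1 : State := { s.set (tm 0) (tape s.used) with used := s.used + 1 } with hs1
      have hrr (r : ℕ) (h : r ≠ tm 0) : s1.reg r = s.reg r := by
        show (s.set _ _).reg r = _
        rw [State.set_reg, if_neg h]
      have r1 : Rep w (n + m) s1 { a with used := a.used + 1 } :=
        { reg := fun r => by
            rw [hrr _ (by simp only [rg, tm]; omega), hr.reg]
          mem := hr.mem
          base := by rw [hrr _ (by simp only [tm]; omega), hr.base]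
          lt := hr.lt
          used := by show s.used + 1 = _; rw [hr.used] }
      refine r1.set r (v := BinOp.eval w .mod (s1.reg (tm 0)) (s1.reg (rg b))) ?_
      have e1 : s1.reg (tm 0) = tape a.used := by
        rw [← hr.used]; exact Function.update_self (tm 0) (tape s.used) s.reg
      rw [e1, r1.reg, BinOp.eval, enc_eq ⟨h0.le, h1⟩, enc_natCast]
    · simp only [Instr.apply, State.set_reg, if_neg (hlr _ _), if_neg (hlt _ _)]
  | @seq p q a a' a'' t t' _ _ ih ih' =>
    intro s hr
    obtain ⟨t1, s1, c1, e1, r1, l1⟩ := ih s hr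
    obtain ⟨t2, s2, c2, e2, r2, l2⟩ := ih' s1 r1
    refine ⟨_, s2, ?_, .seq e1 e2, r2, fun j hj => ?_⟩
    · simp only [Cmd.cost]; nlinarith
    · simp [Cmd.wr] at hj
      rw [l2 j hj.2, l1 j hj.1]
  | @ite_true e p q a a' t hok hin hne _ ih =>
    intro s hr
    obtain ⟨s1, e1, v1, b1⟩ := e.comp_exec (tape := tape) (t := 0) hr hok
    obtain ⟨t2, s2, c2, e2, r2, l2⟩ := ih s1 (b1.rep hr)
    refine ⟨_, s2, ?_, .seq e1 (.ite_true ?_ e2), r2, fun j hj => ?_⟩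
    · simp only [Cmd.cost]; nlinarith
    · rw [v1, enc_eq hin]
      have := hin.1
      omega
    · simp [Cmd.wr] at hj
      rw [l2 j hj.1, b1.reg _ fun u _ => hlt j u]
  | @ite_false e p q a a' t hok he _ ih =>
    intro s hr
    obtain ⟨s1, e1, v1, b1⟩ := e.comp_exec (tape := tape) (t := 0) hr hok
    obtain ⟨t2, s2, c2, e2, r2, l2⟩ := ih s1 (b1.rep hr)
    refine ⟨_, s2, ?_, .seq e1 (.ite_false ?_ e2), r2, fun j hj => ?_⟩
    · simp only [Cmd.cost]; nlinarith
    · rw [v1, he]; simp [enc]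
    · simp [Cmd.wr] at hj
      rw [l2 j hj.2, b1.reg _ fun u _ => hlt j u]
  -- The body does not write `i`, so it leaves `lm i` alone; this is why the simulation also keeps
  -- track of the limit registers.
  | @loop i e p a L f g t hok hL hlt2 hp hf0 hb hs ih =>
    intro s hr
    obtain ⟨s1, e1, v1, b1⟩ := e.comp_exec (tape := tape) (t := 0) hr hok
    have r1 := b1.rep hr
    set s2 := s1.set (tm 1) (0 % 2 ^ w) with hs2
    have r2 : Rep w (n + m) s2 a := (SameBut.set (t := 0) s1 _ (by omega)).rep r1
    have hL2 : BinOp.eval w .add (s2.reg (tm 0)) (s2.reg (tm 1)) = L := by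
      rw [hs2, State.set_reg, State.set_reg, if_neg (by simp only [tm]; omega), if_pos rfl, v1,
        h0w, mov, hL, enc_natCast_of_lt hlt2]
    set s3 := s2.set (lm i) (BinOp.eval w .add (s2.reg (tm 0)) (s2.reg (tm 1))) with hs3
    have r3 : Rep w (n + m) s3 a := r2.of_reg
      (fun r h _ => by rw [hs3, State.set_reg, if_neg (h i)]) rfl rfl
    set s4 := s3.set (rg i) (0 % 2 ^ w) with hs4
    have r4 : Rep w (n + m) s4 (f 0) := by rw [hf0]; exact r3.set i h0w
    have hl4 : s4.reg (lm i) = L := by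
      rw [hs4, State.set_reg, if_neg (hlr _ _), hs3, State.set_reg, if_pos rfl, hL2]
    set s5 := s4.set (fl i) (BinOp.eval w .lt (s4.reg (rg i)) (s4.reg (lm i))) with hs5
    have r5 : Rep w (n + m) s5 (f 0) := r4.of_reg
      (fun r _ h => by rw [hs5, State.set_reg, if_neg (h i)]) rfl rfl
    have hf5 : s5.reg (fl i) = enc w (Op.lt.ev (0 : ℕ) L) := by
      rw [hs5, State.set_reg, if_pos rfl, hl4, r4.reg, hf0, Abs.set_reg, if_pos rfl]
      have := Op.bin_eval (w := w) .lt (x := (0 : ℕ)) (y := L)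
        ⟨⟨le_rfl, by positivity⟩, by positivity, by exact_mod_cast hlt2⟩
      rwa [enc_natCast_of_lt hlt2] at this
    have hreg : ∀ k ≤ L, (f k).reg i = k := by
      intro k hk
      cases k with
      | zero => rw [hf0]; simp
      | succ k => rw [hs k hk]; simp
    have hg : ∀ k < L, (g k).reg i = k := by
      intro k hk
      rw [(hb k hk).wr i hp, hreg k hk.le]
    obtain ⟨t6, s6, c6, e6, r6, l6⟩ := loop_exec (c := p.cost) hlt2 f g t hp hs hreg hg ih L 0
      (by omega) s5 r5
      (by rw [hs5, State.set_reg, if_neg (by simp only [lm, fl]; omega), hl4]) hf5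
    refine ⟨_, s6, ?_, .seq e1 (.seq (.instr _ _) (.seq (.instr _ _) (.seq (.instr _ _)
      (.seq (.instr _ _) e6)))), r6, fun j hj => ?_⟩
    · simp only [Cmd.cost]
      rw [← Finset.range_eq_Ico] at c6
      have h1 : (p.cost + 4) * ∑ j ∈ Finset.range L, (t j + 1) ≤
          (e.cost + p.cost + 10) * ∑ j ∈ Finset.range L, (t j + 1) :=
        Nat.mul_le_mul_right _ (by omega)
      rw [Nat.mul_add, Nat.mul_one]
      omega
    · simp [Cmd.wr] at hj
      have hij : lm j ≠ lm i := by simp only [lm]; omega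
      rw [l6 j hj.2, hs5, State.set_reg, if_neg (by simp only [lm, fl]; omega), hs4, State.set_reg,
        if_neg (hlr _ _), hs3, State.set_reg, if_neg hij, hs2, State.set_reg, if_neg (hlt _ _),
        b1.reg _ fun u _ => hlt j u]

end

/-! ### Rules for total correctness with running times -/

section
variable {n m σT σP : ℕ} (w : ℕ) (I : Input n m σT σP) (tape : ℕ → ℕ)

/-- What a command cannot change is unchanged. -/
structure Frame (c : Cmd) (a a' : Abs) : Prop where
  reg : ∀ r, c.wr r = false → a'.reg r = a.reg r
  arr : ∀ id, c.wa id = false → a'.arr id = a.arr id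
  used : c.rands = false → a'.used = a.used

/-- The command halts after at most `T` steps in a state that satisfies `Q`. -/
def Runs (c : Cmd) (a : Abs) (T : ℕ) (Q : Abs → Prop) : Prop :=
  ∃ t a', t ≤ T ∧ CExec w I tape c a t a' ∧ Q a'

variable {w I tape} {a : Abs} {T T' : ℕ} {Q Q' : Abs → Prop} {c p q : Cmd}

theorem CExec.frame {a' : Abs} {t : ℕ} (h : CExec w I tape c a t a') : Frame c a a' :=
  ⟨h.wr, h.wa, h.rands⟩

theorem Runs.frame (h : Runs w I tape c a T Q) :
    Runs w I tape c a T (fun a' => Q a' ∧ Frame c a a') := by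
  obtain ⟨t, a', ht, he, hq⟩ := h
  exact ⟨t, a', ht, he, hq, he.frame⟩

theorem Runs.mono (h : Runs w I tape c a T Q) (hT : T ≤ T') (hQ : ∀ a', Q a' → Q' a') :
    Runs w I tape c a T' Q' := by
  obtain ⟨t, a', ht, he, hq⟩ := h
  exact ⟨t, a', ht.trans hT, he, hQ _ hq⟩

theorem Runs.imp (h : Runs w I tape c a T Q) (hQ : ∀ a', Frame c a a' → Q a' → Q' a') :
    Runs w I tape c a T Q' :=
  h.frame.mono le_rfl fun a' h => hQ a' h.2 h.1

theorem Runs.skip (h : Q a) : Runs w I tape .skip a 1 Q := ⟨1, a, le_rfl, .skip a, h⟩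

theorem Runs.asg {r : ℕ} {e : Ex} (hok : e.ok w I a) (h : Q (a.set r (e.ev I a))) :
    Runs w I tape (.asg r e) a 1 Q := ⟨1, _, le_rfl, .asg hok, h⟩

theorem Runs.sto {id : ℕ} {x v : Ex} (hx : x.ok w I a) (hv : v.ok w I a)
    (hi : AddrOk (n + m) w id (x.ev I a)) (h : Q (a.put id (x.ev I a).toNat (v.ev I a))) :
    Runs w I tape (.sto id x v) a 1 Q := ⟨1, _, le_rfl, .sto hx hv hi, h⟩

theorem Runs.rnd {r b : ℕ} (h0 : 0 < a.reg b) (h1 : a.reg b < 2 ^ w)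
    (h : Q { a.set r ((tape a.used % (a.reg b).toNat : ℕ) : ℤ) with used := a.used + 1 }) :
    Runs w I tape (.rnd r b) a 1 Q := ⟨1, _, le_rfl, .rnd h0 h1, h⟩

theorem Runs.seq (h : Runs w I tape p a T (fun a' => Runs w I tape q a' T' Q)) :
    Runs w I tape (p ;; q) a (T + T') Q := by
  obtain ⟨t, a', ht, he, t', a'', ht', he', hq⟩ := h
  exact ⟨_, a'', Nat.add_le_add ht ht', he.seq he', hq⟩

theorem Runs.seq' (h : Runs w I tape p a T Q')
    (h' : ∀ a', Frame p a a' → Q' a' → Runs w I tape q a' T' Q) :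
    Runs w I tape (p ;; q) a (T + T') Q :=
  Runs.seq (h.imp h')

theorem Runs.asg_seq {r : ℕ} {e : Ex} (hok : e.ok w I a)
    (h : Runs w I tape q (a.set r (e.ev I a)) T Q) :
    Runs w I tape (.asg r e ;; q) a (1 + T) Q := Runs.seq (Runs.asg hok h)

theorem Runs.sto_seq {id : ℕ} {x v : Ex} (hx : x.ok w I a) (hv : v.ok w I a)
    (hi : AddrOk (n + m) w id (x.ev I a))
    (h : Runs w I tape q (a.put id (x.ev I a).toNat (v.ev I a)) T Q) :
    Runs w I tape (.sto id x v ;; q) a (1 + T) Q := Runs.seq (Runs.sto hx hv hi h)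

theorem Runs.ite {e : Ex} (hok : e.ok w I a) (hin : InR w (e.ev I a))
    (ht : e.ev I a ≠ 0 → Runs w I tape p a T Q) (hf : e.ev I a = 0 → Runs w I tape q a T Q) :
    Runs w I tape (.ite e p q) a (T + 1) Q := by
  by_cases h : e.ev I a = 0
  · obtain ⟨t, a', h1, h2, h3⟩ := hf h
    exact ⟨t + 1, a', by omega, .ite_false hok h h2, h3⟩
  · obtain ⟨t, a', h1, h2, h3⟩ := ht h
    exact ⟨t + 1, a', by omega, .ite_true hok hin h h2, h3⟩

/-- The Hoare rule for loops, with an invariant `J` indexed by the iteration. The value of the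
counter and the frame condition relative to the start come for free, so invariants need not mention
them. -/
theorem Runs.loop {i : ℕ} {e : Ex} (L : ℕ) (J : ℕ → Abs → Prop) (hok : e.ok w I a)
    (hL : e.ev I a = L) (hlt : L < 2 ^ w) (hw : p.wr i = false) (h0 : J 0 (a.set i 0))
    (hstep : ∀ k < L, ∀ a', a'.reg i = (k : ℤ) → Frame (.loop i e p) a a' → J k a' →
      Runs w I tape p a' T (fun a'' => J (k + 1) (a''.set i (k + 1 : ℕ)))) :
    Runs w I tape (.loop i e p) a (1 + L * (T + 1)) (J L) := by
  classical
  have : ∃ (f g : ℕ → Abs) (t : ℕ → ℕ), f 0 = a.set i 0 ∧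
      (∀ k, f (k + 1) = (g k).set i (k + 1 : ℕ)) ∧
      ∀ k, Runs w I tape p (f k) T (fun a'' => J (k + 1) (a''.set i (k + 1 : ℕ))) →
        t k ≤ T ∧ CExec w I tape p (f k) (t k) (g k) ∧ J (k + 1) (f (k + 1)) := by
    -- A successor state is chosen for all `k` and `b`, with a dummy choice where the body is not
    -- known to run. The sequence `f` can then be defined by recursion before its states are known
    -- to satisfy the invariant.
    have hex : ∀ (k : ℕ) (b : Abs), ∃ x : Abs × ℕ,
        Runs w I tape p b T (fun a'' => J (k + 1) (a''.set i (k + 1 : ℕ))) →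
        x.2 ≤ T ∧ CExec w I tape p b x.2 x.1 ∧ J (k + 1) (x.1.set i (k + 1 : ℕ)) := by
      intro k b
      by_cases h : Runs w I tape p b T (fun a'' => J (k + 1) (a''.set i (k + 1 : ℕ)))
      · obtain ⟨t, b', h1, h2, h3⟩ := h
        exact ⟨(b', t), fun _ => ⟨h1, h2, h3⟩⟩
      · exact ⟨(b, 0), fun h' => absurd h' h⟩
    choose G hG using hex
    let f : ℕ → Abs := fun k => Nat.rec (a.set i 0) (fun k b => (G k b).1.set i (k + 1 : ℕ)) k
    exact ⟨f, fun k => (G k (f k)).1, fun k => (G k (f k)).2, rfl, fun k => rfl,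
      fun k h => hG k (f k) h⟩
  obtain ⟨f, g, t, hf0, hfs, hr⟩ := this
  have key : ∀ k ≤ L, (f k).reg i = k ∧ Frame (.loop i e p) a (f k) ∧ J k (f k) := by
    intro k
    induction k with
    | zero =>
      intro _
      rw [hf0]
      refine ⟨by simp, ⟨fun r hr => ?_, fun _ _ => rfl, fun _ => rfl⟩, h0⟩
      simp [Cmd.wr] at hr
      simp [Ne.symm hr.1]
    | succ k ih =>
      intro hk
      obtain ⟨h1, h2, h3⟩ := ih (by omega)
      obtain ⟨-, h4, h5⟩ := hr k (hstep k hk _ h1 h2 h3)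
      have h6 := h4.frame
      refine ⟨by rw [hfs]; simp, ⟨fun r hr => ?_, fun r hr => ?_, fun hr => ?_⟩, h5⟩
      · have := h2.reg r hr
        simp [Cmd.wr] at hr
        rw [hfs, Abs.set_reg, if_neg (Ne.symm hr.1), h6.reg r hr.2, this]
      · rw [hfs, Abs.set_arr, h6.arr r hr, h2.arr r hr]
      · rw [hfs, Abs.set_used, h6.used hr, h2.used hr]
  have hk : ∀ k < L, t k ≤ T ∧ CExec w I tape p (f k) (t k) (g k) := by
    intro k hk
    obtain ⟨h1, h2, h3⟩ := key k hk.le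
    obtain ⟨h4, h5, -⟩ := hr k (hstep k hk _ h1 h2 h3)
    exact ⟨h4, h5⟩
  refine ⟨_, f L, ?_, .loop L f g t hok hL hlt hw hf0 (fun k h => (hk k h).2) fun k _ => hfs k,
    (key L le_rfl).2.2⟩
  have : ∑ k ∈ Finset.range L, (t k + 1) ≤ ∑ _k ∈ Finset.range L, (T + 1) :=
    Finset.sum_le_sum fun k h => Nat.succ_le_succ (hk k (Finset.mem_range.1 h)).1
  simp only [Finset.sum_const, Finset.card_range, smul_eq_mul] at this
  omega

end

/-! ### The discrete Fourier transform in stages, and rounding errors -/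

/-- The value at position `p` after the stages of the transform that combine `M` entries. -/
noncomputable def stageVal (ω : ℂ) (f : ℕ → ℂ) (len M p : ℕ) : ℂ :=
  ∑ t ∈ Finset.range M, f (p / M + t * len) * ω ^ ((p / M + t * len) * (p % M))

/-- The discrete Fourier transform. -/
noncomputable def dft (ω : ℂ) (N : ℕ) (f : ℕ → ℂ) (p : ℕ) : ℂ :=
  ∑ t ∈ Finset.range N, f t * ω ^ (t * p)

theorem sum_range_two_mul {A : Type*} [AddCommMonoid A] (f : ℕ → A) (M : ℕ) :
    ∑ t ∈ Finset.range (2 * M), f t = ∑ t ∈ Finset.range M, (f (2 * t) + f (2 * t + 1)) := by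
  induction M with
  | zero => simp
  | succ M ih => rw [Nat.mul_succ, Finset.sum_range_succ, Finset.sum_range_succ, ih,
      Finset.sum_range_succ, add_assoc]

/-- Splitting the sum into even and odd `t` gives two sums of half the length. In this self-sorting
(Stockham) layout the two sources are always `len * M` apart, which is half the length of the
transform at every stage, and no bit reversal is needed. -/
theorem stageVal_step {ω : ℂ} {len M : ℕ} (hM : 0 < M) (hω : ω ^ (len * M) = -1) (f : ℕ → ℂ)
    (p : ℕ) :
    stageVal ω f len (2 * M) p = ω ^ (p / M % 2 * (p / (2 * M)) * M) *
      (stageVal ω f (2 * len) M (p / (2 * M) * M + p % M) +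
        (-1) ^ (p / M % 2) * stageVal ω f (2 * len) M (p / (2 * M) * M + p % M + len * M)) := by
  have hr : p % M < M := Nat.mod_lt _ hM
  have hp : p % (2 * M) = p / M % 2 * M + p % M := by
    rw [mul_comm 2 M, Nat.mod_mul]; ring
  set j := p / (2 * M)
  set b := p / M % 2
  set r := p % M
  have d1 : (j * M + r) / M = j := by
    rw [mul_comm, Nat.mul_add_div hM, Nat.div_eq_of_lt hr, add_zero]
  have m1 : (j * M + r) % M = r := by
    rw [mul_comm, Nat.mul_add_mod, Nat.mod_eq_of_lt hr]
  have e2 : j * M + r + len * M = (j + len) * M + r := by ring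
  have d2 : ((j + len) * M + r) / M = j + len := by
    rw [mul_comm, Nat.mul_add_div hM, Nat.div_eq_of_lt hr, add_zero]
  have m2 : ((j + len) * M + r) % M = r := by
    rw [mul_comm, Nat.mul_add_mod, Nat.mod_eq_of_lt hr]
  unfold stageVal
  rw [e2, d1, m1, d2, m2, hp, sum_range_two_mul, Finset.mul_sum, ← Finset.sum_add_distrib,
    Finset.mul_sum]
  refine Finset.sum_congr rfl fun t _ => ?_
  -- In the exponents, multiples of `2 * (len * M)` drop out, and a single `len * M * b` leaves the
  -- sign `(-1) ^ b`.
  have h2 : ω ^ (2 * (len * M)) = 1 := by rw [mul_comm, pow_mul, hω]; norm_num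
  have x1 : ω ^ ((j + 2 * t * len) * (b * M + r)) =
      ω ^ (b * j * M) * ω ^ ((j + t * (2 * len)) * r) := by
    rw [show (j + 2 * t * len) * (b * M + r) =
      b * j * M + (j + t * (2 * len)) * r + 2 * (len * M) * (t * b) by ring, pow_add, pow_add,
      pow_mul ω (2 * (len * M)), h2, one_pow, mul_one]
  have x2 : ω ^ ((j + (2 * t + 1) * len) * (b * M + r)) =
      ω ^ (b * j * M) * ((-1) ^ b * ω ^ ((j + len + t * (2 * len)) * r)) := by
    rw [show (j + (2 * t + 1) * len) * (b * M + r) =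
      b * j * M + (len * M * b + (j + len + t * (2 * len)) * r) + 2 * (len * M) * (t * b) by ring,
      pow_add, pow_add, pow_add, pow_mul ω (2 * (len * M)), h2, one_pow, mul_one,
      pow_mul ω (len * M), hω]
  rw [x1, x2, show j + 2 * t * len = j + t * (2 * len) by ring,
    show j + (2 * t + 1) * len = j + len + t * (2 * len) by ring]
  ring

theorem stageVal_one (ω : ℂ) (f : ℕ → ℂ) (len p : ℕ) : stageVal ω f len 1 p = f p := by
  simp [stageVal, Nat.mod_one]

theorem stageVal_last (ω : ℂ) (f : ℕ → ℂ) {N p : ℕ} (hp : p < N) :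
    stageVal ω f 1 N p = dft ω N f p := by
  simp [stageVal, dft, Nat.div_eq_of_lt hp, Nat.mod_eq_of_lt hp]

theorem norm_stageVal_le {ω : ℂ} (hω : ‖ω‖ = 1) {f : ℕ → ℂ} {B : ℝ} (hf : ∀ x, ‖f x‖ ≤ B)
    (len M p : ℕ) : ‖stageVal ω f len M p‖ ≤ M * B := by
  refine (norm_sum_le _ _).trans ?_
  refine (Finset.sum_le_card_nsmul _ _ B fun t _ => ?_).trans (by simp)
  rw [norm_mul, norm_pow, hω, one_pow, mul_one]
  exact hf _

theorem norm_dft_le {ω : ℂ} (hω : ‖ω‖ = 1) {f : ℕ → ℂ} {B : ℝ} (hf : ∀ x, ‖f x‖ ≤ B)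
    (N p : ℕ) : ‖dft ω N f p‖ ≤ N * B := by
  refine (norm_sum_le _ _).trans ?_
  refine (Finset.sum_le_card_nsmul _ _ B fun t _ => ?_).trans (by simp)
  rw [norm_mul, norm_pow, hω, one_pow, mul_one]
  exact hf _

theorem sum_pow_mul_eq {ω : ℂ} {N : ℕ} (h : IsPrimitiveRoot ω N) (l : ℕ) :
    ∑ y ∈ Finset.range N, ω ^ (l * y) = if N ∣ l then (N : ℂ) else 0 := by
  simp only [pow_mul]
  split_ifs with hl
  · rw [(h.pow_eq_one_iff_dvd l).2 hl]; simp
  · have h1 : ω ^ l ≠ 1 := fun e => hl ((h.pow_eq_one_iff_dvd l).1 e)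
    have h2 := geom_sum_mul (ω ^ l) N
    rw [← pow_mul, mul_comm l N, pow_mul, h.pow_eq_one, one_pow, sub_self] at h2
    exact (mul_eq_zero.1 h2).resolve_right (sub_ne_zero.2 h1)

/-- Cross-correlation by Fourier transforms. -/
theorem dft_dft_mul {ω : ℂ} {N : ℕ} (h : IsPrimitiveRoot ω N) (u v : ℕ → ℂ) {x : ℕ} :
    dft ω N (fun y => dft ω N u y * dft ω N (fun z => v ((N - z) % N)) y) x =
      N * ∑ j ∈ Finset.range N, u j * v ((x + j) % N) := by
  rcases Nat.eq_zero_or_pos N with rfl | hN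
  · simp [dft]
  have e1 : dft ω N (fun y => dft ω N u y * dft ω N (fun z => v ((N - z) % N)) y) x =
      ∑ j ∈ Finset.range N, ∑ z ∈ Finset.range N,
        u j * v ((N - z) % N) * ∑ y ∈ Finset.range N, ω ^ ((j + z + x) * y) := by
    simp only [dft, Finset.sum_mul, Finset.mul_sum]
    conv_rhs => rw [Finset.sum_comm]
    rw [Finset.sum_comm]
    refine Finset.sum_congr rfl fun j _ => ?_
    rw [Finset.sum_comm]
    refine Finset.sum_congr rfl fun z _ => Finset.sum_congr rfl fun y _ => ?_
    rw [show (z + j + x) * y = j * y + z * y + y * x by ring, pow_add, pow_add]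
    ring
  rw [e1, Finset.mul_sum]
  refine Finset.sum_congr rfl fun j _ => ?_
  have hz0 : (N - (x + j) % N) % N < N := Nat.mod_lt _ hN
  have hlt : (x + j) % N < N := Nat.mod_lt _ hN
  -- Orthogonality leaves the one `z` with `N ∣ j + z + x`; the outer reduction modulo `N` covers
  -- the case that `N` divides `x + j`. Since `v` is reflected, a second forward transform takes the
  -- place of the inverse one.
  rw [Finset.sum_eq_single_of_mem _ (Finset.mem_range.2 hz0)]
  · have hd : N ∣ j + (N - (x + j) % N) % N + x := by
      apply Nat.dvd_of_mod_eq_zero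
      rw [Nat.add_mod, Nat.add_mod j, Nat.mod_mod, ← Nat.add_mod j, ← Nat.add_mod,
        show j + (N - (x + j) % N) + x = (x + j) + (N - (x + j) % N) by ring, Nat.add_mod]
      rcases Nat.eq_zero_or_pos ((x + j) % N) with h0 | h0
      · rw [h0]; simp
      · rw [Nat.mod_eq_of_lt (show N - (x + j) % N < N by omega),
          show (x + j) % N + (N - (x + j) % N) = N by omega, Nat.mod_self]
    have hv : (N - (N - (x + j) % N) % N) % N = (x + j) % N := by
      rcases Nat.eq_zero_or_pos ((x + j) % N) with h0 | h0
      · rw [h0]; simp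
      · rw [Nat.mod_eq_of_lt (show N - (x + j) % N < N by omega),
          show N - (N - (x + j) % N) = (x + j) % N by omega, Nat.mod_mod]
    rw [sum_pow_mul_eq h, if_pos hd, hv]; ring
  · intro z hz hne
    have hz := Finset.mem_range.1 hz
    rw [sum_pow_mul_eq h, if_neg, mul_zero]
    intro hd
    apply hne
    have h3 : (j + x + z) % N = 0 := Nat.mod_eq_zero_of_dvd (by convert hd using 1; ring)
    rw [Nat.add_mod, Nat.mod_eq_of_lt hz, add_comm j x] at h3
    rcases Nat.eq_zero_or_pos ((x + j) % N) with h0 | h0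
    · rw [h0, zero_add, Nat.mod_eq_of_lt hz] at h3
      rw [h0]; simp [h3]
    · rw [Nat.mod_eq_of_lt (show N - (x + j) % N < N by omega)]
      obtain ⟨c, hc⟩ := Nat.dvd_of_mod_eq_zero h3
      have : c = 1 := by
        rcases c with _ | _ | c
        · omega
        · rfl
        · have : N * (c + 1 + 1) = N * c + N + N := by ring
          have : 0 ≤ N * c := by positivity
          omega
      subst this; omega

/-! Fixed-point numbers with denominator `Q`. -/

/-- The complex number `(x + i y) / Q`. -/
noncomputable def cval (Q x y : ℤ) : ℂ := ⟨(x : ℝ) / Q, (y : ℝ) / Q⟩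

theorem abs_ediv_sub_le {Q : ℤ} (hQ : 0 < Q) (x : ℤ) :
    |((x / Q : ℤ) : ℝ) - (x : ℝ) / Q| ≤ 1 := by
  have hQ' : (0 : ℝ) < Q := by exact_mod_cast hQ
  have h1 : ((x / Q : ℤ) : ℝ) * Q ≤ x := by exact_mod_cast Int.ediv_mul_le x hQ.ne'
  have h2 : (x : ℝ) < (((x / Q : ℤ) : ℝ) + 1) * Q := by
    exact_mod_cast Int.lt_ediv_add_one_mul_self x hQ
  rw [abs_le]
  constructor
  · have : (x : ℝ) / Q ≤ ((x / Q : ℤ) : ℝ) + 1 := (div_le_iff₀ hQ').2 h2.le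
    linarith
  · have : ((x / Q : ℤ) : ℝ) ≤ (x : ℝ) / Q := (le_div_iff₀ hQ').2 h1
    linarith

/-- Rounding down loses at most one unit of `1 / Q` in each of the two coordinates. -/
theorem norm_cval_mul_sub_le {Q : ℤ} (hQ : 0 < Q) (x y x' y' : ℤ) :
    ‖cval Q ((x * x' - y * y') / Q) ((x * y' + y * x') / Q) - cval Q x y * cval Q x' y'‖ ≤
      2 / Q := by
  have hQ' : (0 : ℝ) < Q := by exact_mod_cast hQ
  have key (z : ℤ) : |((z / Q : ℤ) : ℝ) / Q - (z : ℝ) / Q / Q| ≤ 1 / Q := by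
    rw [← sub_div, abs_div, abs_of_pos hQ']
    exact div_le_div_of_nonneg_right (abs_ediv_sub_le hQ z) hQ'.le
  refine (Complex.norm_le_abs_re_add_abs_im _).trans ?_
  have h1 := key (x * x' - y * y')
  have h2 := key (x * y' + y * x')
  have e1 : (cval Q ((x * x' - y * y') / Q) ((x * y' + y * x') / Q) - cval Q x y * cval Q x' y').re
      = (((x * x' - y * y') / Q : ℤ) : ℝ) / Q - ((x * x' - y * y' : ℤ) : ℝ) / Q / Q := by
    simp only [cval, Complex.sub_re, Complex.mul_re]; push_cast; field_simp
  have e2 : (cval Q ((x * x' - y * y') / Q) ((x * y' + y * x') / Q) - cval Q x y * cval Q x' y').im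
      = (((x * y' + y * x') / Q : ℤ) : ℝ) / Q - ((x * y' + y * x' : ℤ) : ℝ) / Q / Q := by
    simp only [cval, Complex.sub_im, Complex.mul_im]; push_cast; field_simp
  rw [e1, e2, show (2 : ℝ) / Q = 1 / Q + 1 / Q by ring]
  exact add_le_add h1 h2

theorem abs_le_of_norm_cval {Q : ℤ} (hQ : 0 < Q) {x y : ℤ} {B : ℤ} (h : ‖cval Q x y‖ ≤ B) :
    |x| ≤ B * Q ∧ |y| ≤ B * Q := by
  have hQ' : (0 : ℝ) < Q := by exact_mod_cast hQ
  have h1 := (Complex.abs_re_le_norm _).trans h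
  have h2 := (Complex.abs_im_le_norm _).trans h
  simp only [cval, abs_div, abs_of_pos hQ', div_le_iff₀ hQ'] at h1 h2
  exact ⟨by exact_mod_cast h1, by exact_mod_cast h2⟩

/-- The factor 3 is `2 * (3 / 2)`: two inputs with error `e` are added and multiplied by an
approximate root of norm at most `3 / 2`. The error of the root contributes `2 * B * δ`, the final
rounding `ρ`. -/
theorem butterfly_error {τ t su sv zu zv out σ : ℂ} {δ e B ρ : ℝ} (hτ : ‖τ‖ = 1) (hσ : ‖σ‖ = 1)
    (ht : ‖t - τ‖ ≤ δ) (hδ : δ ≤ 1 / 2) (hu : ‖zu - su‖ ≤ e) (hv : ‖zv - sv‖ ≤ e)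
    (hsu : ‖su‖ ≤ B) (hsv : ‖sv‖ ≤ B) (ho : ‖out - (zu + σ * zv) * t‖ ≤ ρ) :
    ‖out - τ * (su + σ * sv)‖ ≤ 3 * e + (2 * B * δ + ρ) := by
  have hδ0 : 0 ≤ δ := (norm_nonneg _).trans ht
  have hB0 : 0 ≤ B := (norm_nonneg _).trans hsu
  have he0 : 0 ≤ e := (norm_nonneg _).trans hu
  have htn : ‖t‖ ≤ 3 / 2 := by
    calc ‖t‖ = ‖(t - τ) + τ‖ := by ring_nf
      _ ≤ ‖t - τ‖ + ‖τ‖ := norm_add_le _ _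
      _ ≤ 3 / 2 := by linarith
  have e1 : out - τ * (su + σ * sv) = (out - (zu + σ * zv) * t) +
      (((zu - su) + σ * (zv - sv)) * t + (su + σ * sv) * (t - τ)) := by ring
  have n1 : ‖(zu - su) + σ * (zv - sv)‖ ≤ 2 * e := by
    refine (norm_add_le _ _).trans ?_
    rw [norm_mul, hσ]; linarith
  have n2 : ‖su + σ * sv‖ ≤ 2 * B := by
    refine (norm_add_le _ _).trans ?_
    rw [norm_mul, hσ]; linarith
  have n3 : ‖((zu - su) + σ * (zv - sv)) * t‖ ≤ 2 * e * (3 / 2) := by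
    rw [norm_mul]; gcongr
  have n4 : ‖(su + σ * sv) * (t - τ)‖ ≤ 2 * B * δ := by
    rw [norm_mul]; gcongr
  rw [e1]
  refine (norm_add_le _ _).trans ?_
  have := norm_add_le (((zu - su) + σ * (zv - sv)) * t) ((su + σ * sv) * (t - τ))
  linarith

theorem mul_error {z z' f f' : ℂ} {e B : ℝ} (h : ‖z - f‖ ≤ e) (h' : ‖z' - f'‖ ≤ e) (hf : ‖f‖ ≤ B)
    (hf' : ‖f'‖ ≤ B) : ‖z * z' - f * f'‖ ≤ e * (2 * B + e) := by
  have he0 : 0 ≤ e := (norm_nonneg _).trans h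
  have hB0 : 0 ≤ B := (norm_nonneg _).trans hf
  rw [show z * z' - f * f' = (z - f) * (z' - f') + ((z - f) * f' + f * (z' - f')) by ring]
  refine (norm_add_le _ _).trans ?_
  have n1 : ‖(z - f) * (z' - f')‖ ≤ e * e := by rw [norm_mul]; gcongr
  have n2 : ‖(z - f) * f'‖ ≤ e * B := by rw [norm_mul]; gcongr
  have n3 : ‖f * (z' - f')‖ ≤ B * e := by rw [norm_mul]; gcongr
  have := norm_add_le ((z - f) * f') (f * (z' - f'))
  linarith

/-- Errors of earlier powers are not amplified, as `ω` has norm 1. As long as the total stays below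
1, the computed powers have norm at most 2, so each multiplication adds at most `2 * δ + ρ`. -/
theorem twiddle_error {ω : ℂ} {t : ℕ → ℂ} {w1 : ℂ} {δ ρ : ℝ} {L : ℕ} (hω : ‖ω‖ = 1) (h0 : t 0 = 1)
    (hw : ‖w1 - ω‖ ≤ δ) (hs : ∀ j < L, ‖t (j + 1) - t j * w1‖ ≤ ρ)
    (hL : L * (2 * δ + ρ) ≤ 1) : ∀ j ≤ L, ‖t j - ω ^ j‖ ≤ j * (2 * δ + ρ) := by
  have hδ0 : 0 ≤ δ := (norm_nonneg _).trans hw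
  intro j
  induction j with
  | zero => intro _; simp [h0]
  | succ j ih =>
    intro hj
    have ih := ih (by omega)
    have hρ0 : 0 ≤ ρ := (norm_nonneg _).trans (hs j hj)
    have h1 : (j : ℝ) * (2 * δ + ρ) ≤ 1 := by
      refine le_trans ?_ hL
      have : (j : ℝ) ≤ L := by exact_mod_cast (show j ≤ L by omega)
      gcongr
    have ht : ‖t j‖ ≤ 2 := by
      calc ‖t j‖ = ‖(t j - ω ^ j) + ω ^ j‖ := by ring_nf
        _ ≤ ‖t j - ω ^ j‖ + ‖ω ^ j‖ := norm_add_le _ _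
        _ ≤ 2 := by rw [norm_pow, hω, one_pow]; linarith
    rw [show t (j + 1) - ω ^ (j + 1) =
      (t (j + 1) - t j * w1) + (t j * (w1 - ω) + (t j - ω ^ j) * ω) by ring]
    refine (norm_add_le _ _).trans ?_
    have n1 : ‖t j * (w1 - ω)‖ ≤ 2 * δ := by rw [norm_mul]; gcongr
    have n2 : ‖(t j - ω ^ j) * ω‖ ≤ j * (2 * δ + ρ) := by rw [norm_mul, hω, mul_one]; exact ih
    have := norm_add_le (t j * (w1 - ω)) ((t j - ω ^ j) * ω)
    have := hs j hj
    push_cast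
    linarith

/-! Square roots. -/

theorem abs_sub_sqrt_le {r y : ℝ} (hr : 0 ≤ r) (h1 : r ^ 2 ≤ y) (h2 : y ≤ (r + 1) ^ 2) :
    |r - √y| ≤ 1 := by
  have h3 : r ≤ √y := Real.le_sqrt_of_sq_le h1
  have h4 : √y ≤ r + 1 := Real.sqrt_le_iff.2 ⟨by linarith, h2⟩
  rw [abs_le]; constructor <;> linarith

/-- The bound `4 / Q` reproduces itself under `cos (θ / 2) = √((1 + cos θ) / 2)`. As `cos θ ≥ 0`,
the root is at least `7 / 10`, so the square root is Lipschitz there and turns the error `2 / Q` of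
the radicand into at most `3 / Q`; the integer square root adds `1 / Q`. -/
theorem half_angle_error {Q C r : ℤ} {θ : ℝ} (hQ : 0 < Q) (hC : 0 ≤ C) (hr : 0 ≤ r)
    (hθ : 0 ≤ Real.cos θ) (hθ2 : 0 ≤ Real.cos (θ / 2))
    (h : |(C : ℝ) / Q - Real.cos θ| ≤ 4 / Q)
    (h1 : r ^ 2 ≤ Q * (Q + C) / 2) (h2 : Q * (Q + C) / 2 < (r + 1) ^ 2) :
    |(r : ℝ) / Q - Real.cos (θ / 2)| ≤ 4 / Q := by
  have hQ' : (0 : ℝ) < Q := by exact_mod_cast hQ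
  have hC' : (0 : ℝ) ≤ C := by exact_mod_cast hC
  have hr' : (0 : ℝ) ≤ r := by exact_mod_cast hr
  have a1 : r ^ 2 * 2 ≤ Q * (Q + C) := by omega
  have a2 : Q * (Q + C) ≤ (r + 1) ^ 2 * 2 := by omega
  have b1 : (r : ℝ) ^ 2 ≤ Q * (Q + C) / 2 := by
    rw [le_div_iff₀ (by norm_num)]; exact_mod_cast a1
  have b2 : (Q : ℝ) * (Q + C) / 2 ≤ (r + 1) ^ 2 := by
    rw [div_le_iff₀ (by norm_num)]; exact_mod_cast a2
  have c1 := abs_sub_sqrt_le hr' b1 b2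
  set u : ℝ := (1 + C / Q) / 2 with hu
  have hu0 : 0 ≤ u := by positivity
  have e1 : √((Q : ℝ) * (Q + C) / 2) = Q * √u := by
    rw [show (Q : ℝ) * (Q + C) / 2 = Q ^ 2 * u by rw [hu]; field_simp,
      Real.sqrt_mul (by positivity), Real.sqrt_sq hQ'.le]
  rw [e1] at c1
  have d1 : |(r : ℝ) / Q - √u| ≤ 1 / Q := by
    rw [show (r : ℝ) / Q - √u = (r - Q * √u) / Q by field_simp, abs_div, abs_of_pos hQ']
    gcongr
  set g := Real.cos (θ / 2)
  have hg : g ^ 2 = (1 + Real.cos θ) / 2 := by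
    rw [Real.cos_sq, show 2 * (θ / 2) = θ by ring]; ring
  have hg1 : 7 / 10 ≤ g := by nlinarith
  have hs : √u ^ 2 = u := Real.sq_sqrt hu0
  have hs0 : 0 ≤ √u := Real.sqrt_nonneg _
  have d2 : |√u - g| ≤ 3 / Q := by
    have e2 : (√u - g) * (√u + g) = (C / Q - Real.cos θ) / 2 := by
      rw [show (√u - g) * (√u + g) = √u ^ 2 - g ^ 2 by ring, hs, hg, hu]; ring
    have e3 : |√u - g| * (√u + g) ≤ 2 / Q := by
      rw [← abs_of_nonneg (show 0 ≤ √u + g by linarith), ← abs_mul, e2, abs_div,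
        abs_of_pos (show (0 : ℝ) < 2 by norm_num), div_le_iff₀ (by norm_num)]
      refine h.trans (le_of_eq ?_); ring
    have e4 : |√u - g| * (7 / 10) ≤ 2 / Q := le_trans (by gcongr; linarith) e3
    have e5 : (2 : ℝ) / Q * (10 / 7) ≤ 3 / Q := by
      rw [div_mul_eq_mul_div]; gcongr; norm_num
    linarith
  have := abs_sub_le ((r : ℝ) / Q) (√u) g
  have e6 : (1 : ℝ) / Q + 3 / Q = 4 / Q := by ring
  linarith

theorem sqrt_add_le_sqrt_add_sqrt {u v : ℝ} (hu : 0 ≤ u) (hv : 0 ≤ v) : √(u + v) ≤ √u + √v := by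
  rw [Real.sqrt_le_iff]
  have h1 := Real.sqrt_nonneg u
  have h2 := Real.sqrt_nonneg v
  refine ⟨by linarith, ?_⟩
  nlinarith [Real.sq_sqrt hu, Real.sq_sqrt hv, mul_nonneg h1 h2]

/-- Hölder continuity with exponent `1 / 2`, which unlike a Lipschitz bound also holds near 0. -/
theorem abs_sqrt_sub_sqrt_le {u v : ℝ} (hu : 0 ≤ u) (hv : 0 ≤ v) : |√u - √v| ≤ √|u - v| := by
  have h1 : √u ≤ √v + √|u - v| :=
    (Real.sqrt_le_sqrt (show u ≤ v + |u - v| by linarith [le_abs_self (u - v)])).trans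
      (sqrt_add_le_sqrt_add_sqrt hv (abs_nonneg _))
  have h2 : √v ≤ √u + √|u - v| :=
    (Real.sqrt_le_sqrt (show v ≤ u + |u - v| by linarith [neg_abs_le (u - v)])).trans
      (sqrt_add_le_sqrt_add_sqrt hu (abs_nonneg _))
  rw [abs_le]; constructor <;> linarith

/-- For small angles the radicand `1 - cos² θ` is close to 0, and the square root loses half of the
digits: from denominator `G ^ 2` only accuracy of order `1 / G` remains. -/
theorem sin_error {G C r : ℤ} {θ : ℝ} (hG : 0 < G) (hC : 0 ≤ C) (hCQ : C ≤ G ^ 2) (hr : 0 ≤ r)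
    (hs : 0 ≤ Real.sin θ) (h : |(C : ℝ) / (G ^ 2 : ℤ) - Real.cos θ| ≤ 4 / (G ^ 2 : ℤ))
    (h1 : r ^ 2 ≤ G ^ 2 * G ^ 2 - C * C) (h2 : G ^ 2 * G ^ 2 - C * C < (r + 1) ^ 2) :
    |(r : ℝ) / (G ^ 2 : ℤ) - Real.sin θ| ≤ 4 / G := by
  have hG' : (0 : ℝ) < G := by exact_mod_cast hG
  have hG1 : (1 : ℝ) ≤ G := by exact_mod_cast hG
  have hr' : (0 : ℝ) ≤ r := by exact_mod_cast hr
  have hC' : (0 : ℝ) ≤ C := by exact_mod_cast hC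
  have hCQ' : (C : ℝ) ≤ G ^ 2 := by exact_mod_cast hCQ
  push_cast at h ⊢
  set c : ℝ := C / G ^ 2 with hc
  have hc0 : 0 ≤ c := by positivity
  have hc1 : c ≤ 1 := by rw [hc, div_le_one (by positivity)]; exact hCQ'
  have c1 := abs_sub_sqrt_le (y := (G : ℝ) ^ 2 * G ^ 2 - C * C) hr' (by exact_mod_cast h1)
    (by exact_mod_cast h2.le)
  have e1 : √((G : ℝ) ^ 2 * G ^ 2 - C * C) = G ^ 2 * √(1 - c ^ 2) := by
    rw [show (G : ℝ) ^ 2 * G ^ 2 - C * C = (G ^ 2) ^ 2 * (1 - c ^ 2) by rw [hc]; field_simp,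
      Real.sqrt_mul (by positivity), Real.sqrt_sq (by positivity)]
  rw [e1] at c1
  have d1 : |(r : ℝ) / G ^ 2 - √(1 - c ^ 2)| ≤ 1 / G ^ 2 := by
    rw [show (r : ℝ) / G ^ 2 - √(1 - c ^ 2) = (r - G ^ 2 * √(1 - c ^ 2)) / G ^ 2 by field_simp,
      abs_div, abs_of_pos (show (0 : ℝ) < G ^ 2 by positivity)]
    gcongr
  have hsin : Real.sin θ = √(1 - Real.cos θ ^ 2) := by
    rw [← Real.sin_sq, Real.sqrt_sq hs]
  have d2 : |√(1 - c ^ 2) - Real.sin θ| ≤ 3 / G := by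
    rw [hsin]
    refine (abs_sqrt_sub_sqrt_le (by nlinarith) (by nlinarith [Real.cos_sq_le_one θ])).trans ?_
    rw [Real.sqrt_le_iff]
    refine ⟨by positivity, ?_⟩
    rw [show 1 - c ^ 2 - (1 - Real.cos θ ^ 2) = -((c - Real.cos θ) * (c + Real.cos θ)) by ring,
      abs_neg, abs_mul]
    have h5 : |c + Real.cos θ| ≤ 2 := by
      rw [abs_le]; constructor <;> linarith [Real.cos_le_one θ, Real.neg_one_le_cos θ]
    calc |c - Real.cos θ| * |c + Real.cos θ| ≤ 4 / G ^ 2 * 2 := by gcongr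
      _ ≤ (3 / G) ^ 2 := by
        rw [div_pow, div_mul_eq_mul_div]; gcongr; norm_num
  have h6 : (1 : ℝ) / G ^ 2 ≤ 1 / G := by
    gcongr; nlinarith
  have := abs_sub_le ((r : ℝ) / G ^ 2) (√(1 - c ^ 2)) (Real.sin θ)
  have e6 : (1 : ℝ) / G + 3 / G = 4 / G := by ring
  linarith

/-! ### The fast Fourier transform as a command -/

section
variable {n m σT σP : ℕ} {w : ℕ} {I : Input n m σT σP} {tape : ℕ → ℕ} {a : Abs}

theorem inR_natCast {w x : ℕ} (h : x < 2 ^ w) : InR w (x : ℤ) :=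
  ⟨by positivity, by exact_mod_cast h⟩

theorem addrOk_of_lt {b w id x L : ℕ} (h0 : id ≠ 0) (h16 : id < 16) (hx : x < L)
    (hL : b + 16 * L < 2 ^ w) : AddrOk b w id x := by
  refine ⟨by positivity, h16, ?_⟩
  rw [if_neg h0]
  have : (b : ℤ) + 16 * L < 2 ^ w := by exact_mod_cast hL
  omega

theorem addrOk_zero {b w x : ℕ} (hx : x < b) : AddrOk b w 0 x :=
  ⟨by positivity, by norm_num, by simpa using hx⟩

/-- A loop that computes the entries of an array one by one. -/
theorem Runs.map {i dst : ℕ} {e v : Ex} (L : ℕ) (g : ℕ → ℤ) (hok : e.ok w I a)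
    (hL : e.ev I a = L) (hlt : L < 2 ^ w) (haddr : ∀ p < L, AddrOk (n + m) w dst p)
    (hv : ∀ p < L, ∀ a', a'.reg i = (p : ℤ) → (∀ r, r ≠ i → a'.reg r = a.reg r) →
      (∀ id, id ≠ dst → a'.arr id = a.arr id) → (∀ x, p ≤ x → a'.arr dst x = a.arr dst x) →
      v.ok w I a' ∧ v.ev I a' = g p) :
    Runs w I tape (.loop i e (.sto dst (.var i) v)) a (1 + L * 2) (fun a' =>
      (∀ p < L, a'.arr dst p = g p) ∧ (∀ p, L ≤ p → a'.arr dst p = a.arr dst p)) := by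
  refine Runs.loop (T := 1) L (fun k a' => (∀ p < k, a'.arr dst p = g p) ∧
    (∀ p, k ≤ p → a'.arr dst p = a.arr dst p)) hok hL hlt rfl
    ⟨fun p hp => absurd hp (Nat.not_lt_zero p), fun _ _ => rfl⟩ fun k hk a' hi hf hJ => ?_
  obtain ⟨h1, h2⟩ := hv k hk a' hi
    (fun r hr => hf.reg r (by simp [Cmd.wr, Ne.symm hr]))
    (fun id hid => hf.arr id (by simp [Cmd.wa, Ne.symm hid])) hJ.2
  refine Runs.sto trivial h1 (by rw [Ex.ev_var, hi]; exact haddr k hk) ?_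
  simp only [Ex.ev_var, hi, h2, Int.toNat_natCast, Abs.set_arr, Abs.put_arr, true_and]
  refine ⟨fun p hp => ?_, fun p hp => ?_⟩
  · split_ifs with h
    · rw [h]
    · exact hJ.1 p (by omega)
  · rw [if_neg (by omega)]
    exact hJ.2 p (by omega)

/-- Variables used by the Fourier transform: `2` holds the length `N`, `3` its logarithm, `4` holds
`N / 2`, `5` the denominator `Q` of fixed-point numbers, `6` holds `Q ^ 2`. -/
structure FftRegs (N k Q : ℕ) (a : Abs) : Prop where
  r2 : a.reg 2 = N
  r3 : a.reg 3 = k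
  r4 : a.reg 4 = (N / 2 : ℕ)
  r5 : a.reg 5 = Q
  r6 : a.reg 6 = (Q : ℤ) ^ 2

/-- Division by `Q`, rounded down, of a number that may be negative. -/
def fdivE (e : Ex) : Ex := (e + .var 5 * .var 6) / .var 5 - .var 6

/-- Machine division is unsigned. Adding `Q * Q ^ 2` makes the numerator non-negative and shifts the
quotient by exactly `Q ^ 2`, which is subtracted afterwards. -/
theorem fdivE_ok {N k Q : ℕ} (hr : FftRegs N k Q a) (hQ : 0 < Q) (hW : 2 * Q ^ 3 < 2 ^ w) {e : Ex}
    (hok : e.ok w I a) (hb : |e.ev I a| ≤ (Q : ℤ) ^ 3) :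
    (fdivE e).ok w I a ∧ (fdivE e).ev I a = e.ev I a / Q := by
  have hQ' : (0 : ℤ) < Q := by exact_mod_cast hQ
  have hW' : 2 * (Q : ℤ) ^ 3 < 2 ^ w := by exact_mod_cast hW
  have hb' := abs_le.1 hb
  have e3 : (Q : ℤ) * Q ^ 2 = Q ^ 3 := by ring
  constructor
  · simp only [fdivE, Ex.ok_sub, Ex.ok_div, Ex.ok_add, Ex.ok_mul, Ex.ok_var, Ex.ev_add, Ex.ev_mul,
      Ex.ev_var, hr.r5, hr.r6, hok, true_and, and_true, e3]
    refine ⟨⟨by linarith, by linarith⟩, inR_natCast ?_⟩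
    calc Q ≤ Q ^ 3 := Nat.le_self_pow (by norm_num) Q
      _ < 2 ^ w := by omega
  · simp only [fdivE, Ex.ev_sub, Ex.ev_div, Ex.ev_add, Ex.ev_mul, Ex.ev_var, hr.r5, hr.r6]
    rw [Int.add_mul_ediv_left _ _ hQ'.ne']; ring

/-- The complex number at position `p` of the arrays `1` and `2`. -/
noncomputable def dat (Q : ℕ) (a : Abs) (p : ℕ) : ℂ := cval Q (a.arr 1 p) (a.arr 2 p)

/-- The root of unity at position `p` of the arrays `5` and `6`. -/
noncomputable def twid (Q : ℕ) (a : Abs) (p : ℕ) : ℂ := cval Q (a.arr 5 p) (a.arr 6 p)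

/-- Copy the arrays `3` and `4` to `1` and `2`. -/
def copyBack : Cmd :=
  .loop 26 (.var 2) (.sto 1 (.var 26) (.rd 3 (.var 26))) ;;
  .loop 26 (.var 2) (.sto 2 (.var 26) (.rd 4 (.var 26)))

theorem copyBack_runs {N k Q : ℕ} (hr : FftRegs N k Q a) (hW : n + m + 16 * N < 2 ^ w) :
    Runs w I tape copyBack a (2 + N * 4) (fun a' => ∀ p < N, a'.arr 1 p = a.arr 3 p ∧
      a'.arr 2 p = a.arr 4 p) := by
  have hN : N < 2 ^ w := by omega
  refine Runs.mono (Runs.seq' (Runs.map (i := 26) N (fun p => a.arr 3 p) trivial hr.r2 hN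
      (fun p hp => addrOk_of_lt (by norm_num) (by norm_num) hp hW)
      fun p hp a' h1 h2 h3 h4 => ?_)
    fun a1 f1 q1 => (Runs.map (i := 26) N (fun p => a.arr 4 p) (Ex.ok_var _ _ _ _)
      ((f1.reg 2 rfl).trans hr.r2) hN
      (fun p hp => addrOk_of_lt (by norm_num) (by norm_num) hp hW)
      fun p hp a' h1 h2 h3 h4 => ?_).imp fun a2 f2 q2 => ?_) (by omega) fun _ h => h
  · rw [Ex.ok_rd, Ex.ev_rd, Ex.ev_var, h1, h3 3 (by norm_num)]
    exact ⟨⟨trivial, addrOk_of_lt (by norm_num) (by norm_num) hp hW⟩, rfl⟩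
  · rw [Ex.ok_rd, Ex.ev_rd, Ex.ev_var, h1, h3 4 (by norm_num), f1.arr 4 rfl]
    exact ⟨⟨trivial, addrOk_of_lt (by norm_num) (by norm_num) hp hW⟩, rfl⟩
  · intro p hp
    rw [f2.arr 1 rfl]
    exact ⟨q1.1 p hp, q2.1 p hp⟩

/-- The block, the half of the block, the source position and the exponent of the root of unity
for the target position `26` of a stage that combines `10` entries. -/
def blkE : Ex := .var 26 / (.lit 2 * .var 10)
def bitE : Ex := .var 26 / .var 10 % .lit 2
def srcE : Ex := blkE * .var 10 + .var 26 % .var 10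
def expE : Ex := bitE * blkE * .var 10
def combE (id : ℕ) : Ex := .rd id srcE + (.lit 1 - .lit 2 * bitE) * .rd id (srcE + .var 4)

def fftStage : Cmd :=
  .loop 26 (.var 2) (.sto 3 (.var 26) (fdivE (combE 1 * .rd 5 expE - combE 2 * .rd 6 expE))) ;;
  .loop 26 (.var 2) (.sto 4 (.var 26) (fdivE (combE 1 * .rd 6 expE + combE 2 * .rd 5 expE))) ;;
  copyBack ;;
  .asg 10 (.lit 2 * .var 10)

def fft : Cmd := .asg 10 (.lit 1) ;; .loop 25 (.var 3) fftStage

/-- The coefficient `1 - 2 b` is the sign `(-1) ^ b` of the butterfly, and `N / 2` is the constant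
distance of the two sources. -/
def combV (N M : ℕ) (f : ℕ → ℤ) (p : ℕ) : ℤ :=
  f (p / (2 * M) * M + p % M) +
    (1 - 2 * ((p / M % 2 : ℕ) : ℤ)) * f (p / (2 * M) * M + p % M + N / 2)

/-- The first source lies in the lower half, so the second one, `N / 2` further, is still in range.
The exponent is below `N / 2`, so a table of `N / 2` roots suffices. -/
theorem srcE_bounds {N M p : ℕ} (hd : 2 * M ∣ N) (hM : 0 < M) (hp : p < N) :
    p / (2 * M) * M + p % M < N / 2 ∧ p / M % 2 * (p / (2 * M)) * M < N / 2 := by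
  obtain ⟨c, rfl⟩ := hd
  have h1 : p / (2 * M) < c := Nat.div_lt_of_lt_mul hp
  have h2 : p % M < M := Nat.mod_lt _ hM
  have h3 : p / M % 2 < 2 := Nat.mod_lt _ (by norm_num)
  have h4 : 2 * M * c / 2 = c * M := by
    rw [mul_assoc, Nat.mul_div_cancel_left _ (by norm_num), mul_comm]
  rw [h4]
  have h5 : (p / (2 * M) + 1) * M ≤ c * M := Nat.mul_le_mul_right _ h1
  rw [add_mul, one_mul] at h5
  refine ⟨by omega, ?_⟩
  have h6 : p / M % 2 * (p / (2 * M)) ≤ p / (2 * M) := by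
    calc _ ≤ 1 * (p / (2 * M)) := Nat.mul_le_mul_right _ (by omega)
      _ = _ := one_mul _
  have := Nat.mul_le_mul_right M h6
  omega

theorem stageE_ok {N k Q M p : ℕ} (hr : FftRegs N k Q a) (h10 : a.reg 10 = M)
    (h26 : a.reg 26 = p) (hd : 2 * M ∣ N) (hM : 0 < M) (hp : p < N)
    (hW : n + m + 16 * N < 2 ^ w) :
    (∀ id, id ≠ 0 → id < 16 → (combE id).ok w I a ∧ (combE id).ev I a = combV N M (a.arr id) p) ∧
    (∀ id, id ≠ 0 → id < 16 → (Ex.rd id expE).ok w I a ∧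
      (Ex.rd id expE).ev I a = a.arr id (p / M % 2 * (p / (2 * M)) * M)) := by
  obtain ⟨b1, b2⟩ := srcE_bounds hd hM hp
  have hMN : 2 * M ≤ N := Nat.le_of_dvd (by omega) hd
  have i1 : InR w (p : ℤ) := inR_natCast (by omega)
  have i2 : InR w (M : ℤ) := inR_natCast (by omega)
  have i3 : InR w (2 * M : ℤ) := by exact_mod_cast inR_natCast (w := w) (x := 2 * M) (by omega)
  have i4 : InR w (2 : ℤ) := by exact_mod_cast inR_natCast (w := w) (x := 2) (by omega)
  have i5 : InR w ((p : ℤ) / M) := by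
    rw [← Int.natCast_div]; exact inR_natCast (by have := Nat.div_le_self p M; omega)
  have e1 : (blkE).ev I a = (p / (2 * M) : ℕ) := by simp [blkE, h26, h10]
  have e2 : (bitE).ev I a = (p / M % 2 : ℕ) := by simp [bitE, h26, h10]
  have e3 : (srcE).ev I a = (p / (2 * M) * M + p % M : ℕ) := by simp [srcE, e1, h26, h10]
  have e4 : (expE).ev I a = (p / M % 2 * (p / (2 * M)) * M : ℕ) := by simp [expE, e1, e2, h10]
  have o1 : (blkE).ok w I a := by simp [blkE, h26, h10, i1, i3]
  have o2 : (bitE).ok w I a := by simp [bitE, h26, h10, i1, i2, i4, i5]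
  have o3 : (srcE).ok w I a := by simp [srcE, o1, h26, h10, i1, i2]
  have o4 : (expE).ok w I a := by simp [expE, o1, o2]
  have e5 : (srcE + .var 4).ev I a = (p / (2 * M) * M + p % M + N / 2 : ℕ) := by
    rw [Ex.ev_add, e3, Ex.ev_var, hr.r4]; push_cast; ring
  refine ⟨fun id h0 h16 => ⟨?_, ?_⟩, fun id h0 h16 => ⟨?_, ?_⟩⟩
  · simp only [combE, Ex.ok_add, Ex.ok_rd, Ex.ok_mul, Ex.ok_sub, Ex.ok_lit, Ex.ok_var, o2, o3,
      true_and, and_true]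
    exact ⟨by rw [e3]; exact addrOk_of_lt h0 h16 (by omega) hW,
      by rw [e5]; exact addrOk_of_lt h0 h16 (by omega) hW⟩
  · rw [combE, Ex.ev_add, Ex.ev_rd, Ex.ev_mul, Ex.ev_rd, e5, e3]
    simp only [Ex.ev_sub, Ex.ev_mul, Ex.ev_lit, e2, Int.toNat_natCast, combV]
    rfl
  · rw [Ex.ok_rd, e4]
    exact ⟨o4, addrOk_of_lt h0 h16 (by omega) hW⟩
  · rw [Ex.ev_rd, e4, Int.toNat_natCast]

theorem abs_combV_le {N M p : ℕ} {f : ℕ → ℤ} {B : ℤ} (hd : 2 * M ∣ N) (hM : 0 < M) (hp : p < N)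
    (hf : ∀ x < N, |f x| ≤ B) : |combV N M f p| ≤ 2 * B := by
  obtain ⟨b1, b2⟩ := srcE_bounds hd hM hp
  have h1 := hf (p / (2 * M) * M + p % M) (by omega)
  have h2 := hf (p / (2 * M) * M + p % M + N / 2) (by omega)
  rw [abs_le] at *
  unfold combV
  rcases Nat.mod_two_eq_zero_or_one (p / M) with h | h <;> rw [h] <;> constructor <;>
    push_cast <;> linarith

theorem cval_combV {N M p : ℕ} (Q : ℤ) (f g : ℕ → ℤ) :
    cval Q (combV N M f p) (combV N M g p) =
      cval Q (f (p / (2 * M) * M + p % M)) (g (p / (2 * M) * M + p % M)) +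
      (-1) ^ (p / M % 2) * cval Q (f (p / (2 * M) * M + p % M + N / 2))
        (g (p / (2 * M) * M + p % M + N / 2)) := by
  unfold combV
  rcases Nat.mod_two_eq_zero_or_one (p / M) with h | h <;> rw [h] <;>
    apply Complex.ext <;> simp [cval] <;> ring

theorem abs_mul_add_mul_le {x y u v X U : ℤ} (hx : |x| ≤ X) (hy : |y| ≤ X) (hu : |u| ≤ U)
    (hv : |v| ≤ U) : |x * u - y * v| ≤ 2 * (X * U) ∧ |x * v + y * u| ≤ 2 * (X * U) := by
  have hX : 0 ≤ X := (abs_nonneg _).trans hx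
  have k {x u : ℤ} (hx : |x| ≤ X) (hu : |u| ≤ U) : |x * u| ≤ X * U := by
    rw [abs_mul]; gcongr
  have h1 := abs_sub (x * u) (y * v)
  have h2 := abs_add_le (x * v) (y * u)
  have := k hx hu
  have := k hy hv
  have := k hx hv
  have := k hy hu
  constructor <;> linarith

theorem FftRegs.congr {N k Q : ℕ} {a' : Abs} (h : FftRegs N k Q a)
    (e : ∀ r, 2 ≤ r → r ≤ 6 → a'.reg r = a.reg r) : FftRegs N k Q a' :=
  ⟨by rw [e 2 (by norm_num) (by norm_num), h.r2], by rw [e 3 (by norm_num) (by norm_num), h.r3],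
    by rw [e 4 (by norm_num) (by norm_num), h.r4], by rw [e 5 (by norm_num) (by norm_num), h.r5],
    by rw [e 6 (by norm_num) (by norm_num), h.r6]⟩

/-- Both coordinates of all results are written to the arrays `3` and `4` before being copied back,
because every entry of the arrays `1` and `2` is read for two targets. -/
theorem fftStage_runs {N k Q M Z : ℕ} (hr : FftRegs N k Q a) (h10 : a.reg 10 = M) (hd : 2 * M ∣ N)
    (hM : 0 < M) (hW : n + m + 16 * N < 2 ^ w) (hQ : 0 < Q) (hQW : 2 * Q ^ 3 < 2 ^ w)
    (hz : ∀ x < N, |a.arr 1 x| ≤ Z * Q ∧ |a.arr 2 x| ≤ Z * Q)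
    (ht : ∀ x < N / 2, |a.arr 5 x| ≤ 2 * Q ∧ |a.arr 6 x| ≤ 2 * Q) (hZ : 8 * Z ≤ Q) :
    Runs w I tape fftStage a (8 * N + 5) (fun a' => a'.reg 10 = (2 * M : ℕ) ∧ ∀ p < N,
      ‖dat Q a' p - (dat Q a (p / (2 * M) * M + p % M) +
        (-1) ^ (p / M % 2) * dat Q a (p / (2 * M) * M + p % M + N / 2)) *
        twid Q a (p / M % 2 * (p / (2 * M)) * M)‖ ≤ 2 / Q) := by
  have hN : N < 2 ^ w := by omega
  have hbd : ∀ p < N, |combV N M (a.arr 1) p * a.arr 5 (p / M % 2 * (p / (2 * M)) * M) -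
        combV N M (a.arr 2) p * a.arr 6 (p / M % 2 * (p / (2 * M)) * M)| ≤ (Q : ℤ) ^ 3 ∧
      |combV N M (a.arr 1) p * a.arr 6 (p / M % 2 * (p / (2 * M)) * M) +
        combV N M (a.arr 2) p * a.arr 5 (p / M % 2 * (p / (2 * M)) * M)| ≤ (Q : ℤ) ^ 3 := by
    intro p hp
    obtain ⟨b1, b2⟩ := srcE_bounds hd hM hp
    have h := abs_mul_add_mul_le (abs_combV_le hd hM hp fun x hx => (hz x hx).1)
      (abs_combV_le hd hM hp fun x hx => (hz x hx).2) (ht _ b2).1 (ht _ b2).2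
    -- Combining two entries doubles the bound `Z * Q`, a root has coordinates at most `2 * Q`, and
    -- two products are added: `8 * Z * Q ^ 2`, which must not exceed the `Q ^ 3` allowed by
    -- `fdivE_ok`.
    have e : 2 * (2 * ((Z : ℤ) * Q) * (2 * Q)) ≤ Q ^ 3 := by
      have h1 : (8 * Z : ℤ) * (Q * Q) ≤ Q * (Q * Q) :=
        mul_le_mul_of_nonneg_right (by exact_mod_cast hZ) (by positivity)
      nlinarith
    exact ⟨h.1.trans e, h.2.trans e⟩
  refine Runs.mono (Runs.seq' (Runs.map (i := 26) N (fun p =>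
      (combV N M (a.arr 1) p * a.arr 5 (p / M % 2 * (p / (2 * M)) * M) -
        combV N M (a.arr 2) p * a.arr 6 (p / M % 2 * (p / (2 * M)) * M)) / Q) trivial hr.r2 hN
      (fun p hp => addrOk_of_lt (by norm_num) (by norm_num) hp hW)
      fun p hp a' h1 h2 h3 h4 => ?_)
    fun a1 f1 q1 => Runs.seq' (Runs.map (i := 26) N (fun p =>
      (combV N M (a.arr 1) p * a.arr 6 (p / M % 2 * (p / (2 * M)) * M) +
        combV N M (a.arr 2) p * a.arr 5 (p / M % 2 * (p / (2 * M)) * M)) / Q) (Ex.ok_var _ _ _ _)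
      ((f1.reg 2 rfl).trans hr.r2) hN
      (fun p hp => addrOk_of_lt (by norm_num) (by norm_num) hp hW)
      fun p hp a' h1 h2 h3 h4 => ?_)
    fun a2 f2 q2 => Runs.seq' (copyBack_runs (N := N) (k := k) (Q := Q) ?_ hW)
    fun a3 f3 q3 => Runs.asg ?_ ?_)
    (show (1 + N * 2) + ((1 + N * 2) + ((2 + N * 4) + 1)) ≤ _ by omega) fun _ h => h
  · have hr' : FftRegs N k Q a' := hr.congr fun r _ _ => h2 r (by omega)
    obtain ⟨c1, c2⟩ := stageE_ok (I := I) hr' ((h2 10 (by norm_num)).trans h10) h1 hd hM hp hW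
    have k1 := c1 1 (by norm_num) (by norm_num)
    have k2 := c1 2 (by norm_num) (by norm_num)
    have k5 := c2 5 (by norm_num) (by norm_num)
    have k6 := c2 6 (by norm_num) (by norm_num)
    have ev : (combE 1 * .rd 5 expE - combE 2 * .rd 6 expE).ev I a' =
        combV N M (a.arr 1) p * a.arr 5 (p / M % 2 * (p / (2 * M)) * M) -
        combV N M (a.arr 2) p * a.arr 6 (p / M % 2 * (p / (2 * M)) * M) := by
      rw [Ex.ev_sub, Ex.ev_mul, Ex.ev_mul, k1.2, k2.2, k5.2, k6.2, h3 1 (by norm_num),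
        h3 2 (by norm_num), h3 5 (by norm_num), h3 6 (by norm_num)]
    have := fdivE_ok (I := I) (e := combE 1 * .rd 5 expE - combE 2 * .rd 6 expE) hr' hQ hQW
      (by simp only [Ex.ok_sub, Ex.ok_mul]; tauto) (by rw [ev]; exact (hbd p hp).1)
    rwa [ev] at this
  · have hr' : FftRegs N k Q a' := hr.congr fun r _ _ => (h2 r (by omega)).trans
      (f1.reg r (by simp [Cmd.wr]; omega))
    obtain ⟨c1, c2⟩ := stageE_ok (I := I) hr'
      ((h2 10 (by norm_num)).trans ((f1.reg 10 rfl).trans h10)) h1 hd hM hp hW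
    have k1 := c1 1 (by norm_num) (by norm_num)
    have k2 := c1 2 (by norm_num) (by norm_num)
    have k5 := c2 5 (by norm_num) (by norm_num)
    have k6 := c2 6 (by norm_num) (by norm_num)
    have ev : (combE 1 * .rd 6 expE + combE 2 * .rd 5 expE).ev I a' =
        combV N M (a.arr 1) p * a.arr 6 (p / M % 2 * (p / (2 * M)) * M) +
        combV N M (a.arr 2) p * a.arr 5 (p / M % 2 * (p / (2 * M)) * M) := by
      rw [Ex.ev_add, Ex.ev_mul, Ex.ev_mul, k1.2, k2.2, k5.2, k6.2, h3 1 (by norm_num),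
        h3 2 (by norm_num), h3 5 (by norm_num), h3 6 (by norm_num), f1.arr 1 rfl, f1.arr 2 rfl,
        f1.arr 5 rfl, f1.arr 6 rfl]
    have := fdivE_ok (I := I) (e := combE 1 * .rd 6 expE + combE 2 * .rd 5 expE) hr' hQ hQW
      (by simp only [Ex.ok_add, Ex.ok_mul]; tauto) (by rw [ev]; exact (hbd p hp).2)
    rwa [ev] at this
  · exact hr.congr fun r _ _ => (f2.reg r (by simp [Cmd.wr]; omega)).trans
      (f1.reg r (by simp [Cmd.wr]; omega))
  · simp
  · refine ⟨?_, fun p hp => ?_⟩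
    · simp [f3.reg 10 rfl, f2.reg 10 rfl, f1.reg 10 rfl, h10]
    · simp only [dat, twid, Abs.set_arr]
      rw [(q3 p hp).1, (q3 p hp).2, f2.arr 3 rfl, q1.1 p hp, q2.1 p hp, ← cval_combV]
      have := norm_cval_mul_sub_le (Q := Q) (by exact_mod_cast hQ) (combV N M (a.arr 1) p)
        (combV N M (a.arr 2) p) (a.arr 5 (p / M % 2 * (p / (2 * M)) * M))
        (a.arr 6 (p / M % 2 * (p / (2 * M)) * M))
      rwa [Int.cast_natCast] at this

/-- The recursion `e ↦ 3 e + γ` of `butterfly_error` is dominated by `3 ^ s * (e + γ) - γ` after `s`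
stages, and `3 ^ k ≤ 4 ^ k = N ^ 2`. The number `Z` bounds all intermediate values together with
their errors, which rules out overflow. -/
theorem fft_runs {N k Q Z : ℕ} {ω : ℂ} {δ e B : ℝ} {f : ℕ → ℂ} (hr : FftRegs N k Q a)
    (hN : N = 2 ^ k) (hk : 0 < k) (hW : n + m + 16 * N < 2 ^ w) (hQ : 0 < Q)
    (hQW : 2 * Q ^ 3 < 2 ^ w) (hω : ω ^ (N / 2) = -1) (hωn : ‖ω‖ = 1)
    (ht : ∀ x < N / 2, ‖twid Q a x - ω ^ x‖ ≤ δ) (hδ : δ ≤ 1 / 2)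
    (hf : ∀ x, ‖f x‖ ≤ B) (ha : ∀ p < N, ‖dat Q a p - f p‖ ≤ e) (he : 0 ≤ e)
    (hZ : N * B + N ^ 2 * (e + (2 * (N * B) * δ + 2 / Q)) ≤ Z) (hZQ : 8 * Z ≤ Q) :
    Runs w I tape fft a (2 + k * (8 * N + 6)) (fun a' => ∀ p < N,
      ‖dat Q a' p - dft ω N f p‖ ≤ N ^ 2 * (e + (2 * (N * B) * δ + 2 / Q))) := by
  set γ : ℝ := 2 * (N * B) * δ + 2 / Q with hγ
  have hB0 : 0 ≤ B := (norm_nonneg _).trans (hf 0)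
  have hN2 : 2 ≤ N := by rw [hN]; exact Nat.le_self_pow hk.ne' 2
  have hδ0 : 0 ≤ δ := (norm_nonneg _).trans (ht 0 (by omega))
  have hQ' : (0 : ℝ) < Q := by exact_mod_cast hQ
  have hγ0 : 0 ≤ γ := by positivity
  have hkw : k < 2 ^ w := by
    have := Nat.lt_two_pow_self (n := k)
    omega
  have h3 : ∀ s ≤ k, (3 : ℝ) ^ s * (e + γ) - γ ≤ N ^ 2 * (e + γ) := by
    intro s hs
    have : (3 : ℝ) ^ s ≤ N ^ 2 := by
      rw [hN]; push_cast
      calc (3 : ℝ) ^ s ≤ 4 ^ s := by gcongr; norm_num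
        _ ≤ 4 ^ k := by gcongr; norm_num
        _ = (2 ^ k) ^ 2 := by rw [← pow_mul, mul_comm, pow_mul]; norm_num
    have : (3 : ℝ) ^ s * (e + γ) ≤ N ^ 2 * (e + γ) := by gcongr
    linarith
  have hMN : ∀ s ≤ k, ((2 ^ s : ℕ) : ℝ) * B ≤ N * B := by
    intro s hs
    have : (2 ^ s : ℕ) ≤ N := by rw [hN]; exact Nat.pow_le_pow_right (by norm_num) hs
    have : ((2 ^ s : ℕ) : ℝ) ≤ N := by exact_mod_cast this
    gcongr
  refine Runs.mono (Runs.asg_seq trivial (Runs.imp (Runs.loop (T := 8 * N + 5) k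
    (fun s a' => a'.reg 10 = (2 ^ s : ℕ) ∧ ∀ p < N,
      ‖dat Q a' p - stageVal ω f (N / 2 ^ s) (2 ^ s) p‖ ≤ 3 ^ s * (e + γ) - γ) trivial
    (by simpa using hr.r3) hkw rfl ⟨by simp, fun p hp => ?_⟩ fun s hs a' h25 f1 hJ => ?_)
    fun a' _ hJ p hp => ?_)) (le_of_eq (by ring)) fun _ h => h
  · simp only [pow_zero, one_mul, stageVal_one]
    have := ha p hp
    simp only [dat, Abs.set_arr] at this ⊢
    linarith
  · have hd : 2 * 2 ^ s ∣ N := by rw [hN, ← pow_succ']; exact pow_dvd_pow 2 hs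
    have hlen : N / 2 ^ (s + 1) * 2 ^ s = N / 2 := by
      rw [hN, Nat.pow_div hs (by norm_num), ← pow_add, show k - (s + 1) + s = k - 1 by omega]
      conv_rhs => rw [show k = (k - 1) + 1 by omega, pow_succ]
      omega
    have hlen2 : N / 2 ^ s = 2 * (N / 2 ^ (s + 1)) := by
      rw [hN, Nat.pow_div hs (by norm_num), Nat.pow_div hs.le (by norm_num), ← pow_succ',
        show k - (s + 1) + 1 = k - s by omega]
    have hr' : FftRegs N k Q a' := hr.congr fun r h h' => by
      rw [f1.reg r (by simp [Cmd.wr, fftStage, copyBack]; omega)]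
      simp; omega
    have htw : ∀ x, twid Q a' x = twid Q a x := fun x => by
      simp only [twid]; rw [f1.arr 5 rfl, f1.arr 6 rfl]; rfl
    have hsn : ∀ p, ‖stageVal ω f (N / 2 ^ s) (2 ^ s) p‖ ≤ N * B := fun p =>
      (norm_stageVal_le hωn hf _ _ _).trans (hMN s hs.le)
    have hz : ∀ x < N, |a'.arr 1 x| ≤ Z * Q ∧ |a'.arr 2 x| ≤ Z * Q := fun x hx => by
      refine abs_le_of_norm_cval (Q := Q) (B := Z) (by exact_mod_cast hQ) ?_
      have h1 := hJ.2 x hx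
      have h2 := norm_le_norm_add_norm_sub' (dat Q a' x) (stageVal ω f (N / 2 ^ s) (2 ^ s) x)
      have h4 := hsn x
      have h5 := h3 s hs.le
      simp only [dat] at *
      push_cast
      linarith
    have htz : ∀ x < N / 2, |a'.arr 5 x| ≤ 2 * Q ∧ |a'.arr 6 x| ≤ 2 * Q := fun x hx => by
      refine abs_le_of_norm_cval (Q := Q) (B := 2) (by exact_mod_cast hQ) ?_
      have h1 := ht x hx
      have h2 := norm_le_norm_add_norm_sub' (twid Q a x) (ω ^ x)
      have h4 : ‖ω ^ x‖ = 1 := by rw [norm_pow, hωn, one_pow]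
      rw [show cval Q (a'.arr 5 x) (a'.arr 6 x) = twid Q a' x from rfl, htw]
      push_cast
      linarith
    refine (fftStage_runs hr' hJ.1 hd (by positivity) hW hQ hQW hz htz hZQ).imp
      fun a2 f2 q2 => ⟨?_, fun p hp => ?_⟩
    · rw [Abs.set_reg, if_neg (by norm_num), q2.1, pow_succ']
    · have hpos : 0 < 2 ^ s := by positivity
      obtain ⟨b1, b2⟩ := srcE_bounds hd hpos hp
      have hst := stageVal_step (len := N / 2 ^ (s + 1)) hpos (by rw [hlen, hω]) f p
      rw [hlen] at hst
      have hst' := (congrArg (fun x => stageVal ω f (N / 2 ^ (s + 1)) x p) (pow_succ' 2 s)).trans hst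
      rw [hst', ← hlen2]
      have := butterfly_error (σ := (-1) ^ (p / 2 ^ s % 2)) (B := N * B)
        (τ := ω ^ (p / 2 ^ s % 2 * (p / (2 * 2 ^ s)) * 2 ^ s)) (by rw [norm_pow, hωn, one_pow])
        (by simp) (by have := ht _ b2; rw [← htw] at this; exact this) hδ (hJ.2 _ (by omega))
        (hJ.2 _ (by omega)) (hsn _) (hsn _) (q2.2 p hp)
      refine this.trans ?_
      rw [← hγ, pow_succ]; linarith
  · have := hJ.2 p hp
    rw [← hN, Nat.div_self (by omega), stageVal_last ω f hp] at this
    exact this.trans (h3 k le_rfl)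

end

/-! ### Powers of two, square roots and roots of unity -/

section
variable {n m σT σP : ℕ} {w : ℕ} {I : Input n m σT σP} {tape : ℕ → ℕ} {a : Abs}

/-- Double `x`, starting from `x0 = 2 ^ e0`, until it reaches `tgt`; `e` holds the exponent. -/
def growLoop (x e x0 e0 : ℕ) (lim tgt : Ex) : Cmd :=
  .asg x (.lit x0) ;; .asg e (.lit e0) ;;
  .loop 23 lim (.ite ((Ex.var x).lt tgt) (.asg x (.lit 2 * .var x) ;; .asg e (.var e + .lit 1)) .skip)

/-- The loop has a fixed number of iterations and is idle once the target is reached; `t ≤ 2 ^ (e0 +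
L)` guarantees that it is reached. The last alternative says that no doubling was superfluous. -/
theorem growLoop_runs {x e x0 e0 L t : ℕ} {lim tgt : Ex} (hxe : x ≠ e) (hx : x ≠ 23) (he : e ≠ 23)
    (h0 : x0 = 2 ^ e0)
    (hl : ∀ a', (∀ r, r ≠ x → r ≠ e → r ≠ 23 → a'.reg r = a.reg r) → a'.arr = a.arr →
      lim.ok w I a' ∧ lim.ev I a' = L)
    (htg : ∀ a', (∀ r, r ≠ x → r ≠ e → r ≠ 23 → a'.reg r = a.reg r) → a'.arr = a.arr →
      tgt.ok w I a' ∧ tgt.ev I a' = t)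
    (hL : L < 2 ^ w) (ht : 2 * t < 2 ^ w) (h0w : x0 < 2 ^ w) (htL : t ≤ 2 ^ (e0 + L)) :
    Runs w I tape (growLoop x e x0 e0 lim tgt) a (3 + L * 4) (fun a' => ∃ k : ℕ, e0 ≤ k ∧
      a'.reg x = (2 ^ k : ℕ) ∧ a'.reg e = k ∧ t ≤ 2 ^ k ∧ (k = e0 ∨ 2 ^ k < 2 * t)) := by
  set a1 := (a.set x x0).set e e0 with ha1
  have hreg1 : ∀ r, r ≠ x → r ≠ e → r ≠ 23 → a1.reg r = a.reg r := fun r h1 h2 _ => by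
    simp [ha1, h1, h2]
  have harr1 : a1.arr = a.arr := rfl
  refine Runs.mono (Runs.asg_seq trivial (Runs.asg_seq trivial
    -- Either the target has been reached or every iteration so far has doubled, so that `k = e0 +
    -- i`.
    (Runs.imp (Runs.loop (T := 3) L (fun i a' => ∃ k : ℕ, e0 ≤ k ∧
      a'.reg x = (2 ^ k : ℕ) ∧ a'.reg e = k ∧ (t ≤ 2 ^ k ∨ k = e0 + i) ∧ (k = e0 ∨ 2 ^ k < 2 * t))
    (hl a1 hreg1 harr1).1 (hl a1 hreg1 harr1).2 hL
    (by simp [Cmd.wr, hx, he]) ⟨e0, le_rfl, by simp [hxe, hx, h0], by simp [he], by simp, by simp⟩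
    fun i hi a' h23 f1 hJ => ?_) fun a' _ hJ => ?_))) (by omega) fun _ h => h
  · obtain ⟨k, hk1, hk2, hk3, hk4, hk5⟩ := hJ
    have hreg : ∀ r, r ≠ x → r ≠ e → r ≠ 23 → a'.reg r = a.reg r := fun r h1 h2 h3 => by
      rw [f1.reg r (by simp [Cmd.wr, h1.symm, h2.symm, h3.symm])]
      exact hreg1 r h1 h2 h3
    have harr : a'.arr = a.arr := by
      funext id; rw [f1.arr id rfl]; rfl
    obtain ⟨t1, t2⟩ := htg a' hreg harr
    have hkw : 2 ^ k < 2 ^ w := by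
      rcases hk5 with rfl | h
      · rwa [← h0]
      · omega
    have hev : ((Ex.var x).lt tgt).ev I a' = if 2 ^ k < t then 1 else 0 := by
      rw [Ex.ev_lt, t2, Ex.ev_var, hk2]; norm_cast
    have h1w : 1 < 2 ^ w := lt_of_le_of_lt Nat.one_le_two_pow hkw
    refine Runs.ite (T := 2) ?_ ?_ (fun h => ?_) (fun h => ?_)
    · rw [Ex.ok_lt, t2, Ex.ev_var, hk2]
      exact ⟨trivial, t1, inR_natCast hkw, inR_natCast (by omega)⟩
    · rw [hev]
      split_ifs
      · exact_mod_cast inR_natCast h1w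
      · exact ⟨le_rfl, by positivity⟩
    · have hlt : 2 ^ k < t := by
        by_contra hc
        rw [hev, if_neg hc] at h; exact h rfl
      refine Runs.asg_seq (by simp) (Runs.asg (by simp) ⟨k + 1, by omega, ?_, ?_, ?_, ?_⟩)
      · simp [hxe, hx, hk2, pow_succ']
      · simp [he, hk3, hxe.symm]
      · right; omega
      · right; rw [pow_succ']; omega
    · have hlt : ¬ 2 ^ k < t := by
        intro hc
        rw [hev, if_pos hc] at h; exact one_ne_zero h
      refine (Runs.skip (Q := fun a'' => _) ⟨k, hk1, ?_, ?_, ?_, hk5⟩).mono (by norm_num)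
        fun _ h => h
      · simp [hx, hk2]
      · simp [he, hk3]
      · left; omega
  · obtain ⟨k, hk1, hk2, hk3, hk4, hk5⟩ := hJ
    refine ⟨k, hk1, hk2, hk3, ?_, hk5⟩
    rcases hk4 with h | rfl
    · exact h
    · exact htL

/-- The integer square root `12` of `11`. -/
def sqrtCmd : Cmd :=
  .asg 12 (.lit 0) ;; .asg 13 (.lit 2 * .var 5) ;;
  .loop 23 (.lit 24 * .var 3 + .lit 1) (.asg 13 (.var 13 / .lit 2) ;;
    .ite ((Ex.var 11).lt ((.var 12 + .var 13) * (.var 12 + .var 13))) .skip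
      (.asg 12 (.var 12 + .var 13)))

/-- The root is found bit by bit, with invariant `r ^ 2 ≤ y < (r + b) ^ 2` for a power of two `b`.
Initially `b = 2 * Q` exceeds the root since `y ≤ Q ^ 2`, and `24 * k + 1` halvings bring `b` down
to 1. -/
theorem sqrtCmd_runs {N k Q : ℕ} (hr : FftRegs N k Q a) (hQ : Q = 2 ^ (24 * k)) (hk : 0 < k)
    (hQW : 2 * Q ^ 3 < 2 ^ w) (h0 : 0 ≤ a.reg 11) (h1 : a.reg 11 ≤ (Q : ℤ) * Q) :
    Runs w I tape sqrtCmd a (96 * k + 7) (fun a' => 0 ≤ a'.reg 12 ∧ a'.reg 12 ^ 2 ≤ a.reg 11 ∧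
      a.reg 11 < (a'.reg 12 + 1) ^ 2) := by
  have hQ24 : 2 ^ 24 ≤ Q := by rw [hQ]; exact Nat.pow_le_pow_right (by norm_num) (by omega)
  have hQ9 : 9 * (Q * Q) ≤ 2 * Q ^ 3 := by
    rw [show 2 * Q ^ 3 = (2 * Q) * (Q * Q) by ring]
    exact Nat.mul_le_mul_right _ (by omega)
  have hQQ : Q ≤ Q * Q := Nat.le_mul_self Q
  have hkQ : 24 * k + 1 ≤ Q := by rw [hQ]; exact Nat.lt_two_pow_self
  have hQ9' : 9 * ((Q : ℤ) * Q) ≤ 2 * Q ^ 3 := by exact_mod_cast hQ9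
  have hQW' : 2 * (Q : ℤ) ^ 3 < 2 ^ w := by exact_mod_cast hQW
  refine Runs.mono (Runs.asg_seq trivial (Runs.asg_seq (by simp)
    (Runs.imp (Runs.loop (T := 3) (24 * k + 1) (fun i a' => 0 ≤ a'.reg 12 ∧
      a'.reg 13 = (2 ^ (24 * k + 1 - i) : ℕ) ∧ a'.reg 12 ^ 2 ≤ a.reg 11 ∧
      a.reg 11 < (a'.reg 12 + a'.reg 13) ^ 2)
    (by simp) (by simp [hr.r3]) (by omega) rfl ?_
    fun i hi a' h23 f1 hJ => ?_) fun a' _ hJ => ?_))) (by omega) fun _ h => h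
  · refine ⟨by simp, ?_, by simpa using h0, ?_⟩
    · simp [hr.r5, hQ, pow_succ']
    · simp [hr.r5]
      have : (0 : ℤ) < Q * Q := by
        have : (0 : ℤ) < Q := by exact_mod_cast (show 0 < Q by omega)
        positivity
      nlinarith
  · obtain ⟨j0, j1, j2, j3⟩ := hJ
    have h11 : a'.reg 11 = a.reg 11 := by rw [f1.reg 11 rfl]; simp
    set b : ℕ := 2 ^ (24 * k + 1 - (i + 1)) with hb
    have hb2 : (2 ^ (24 * k + 1 - i) : ℕ) = 2 * b := by
      rw [hb, ← pow_succ', show 24 * k + 1 - (i + 1) + 1 = 24 * k + 1 - i by omega]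
    have hbQ : b ≤ Q := by
      rw [hb, hQ]; exact Nat.pow_le_pow_right (by norm_num) (by omega)
    have hbQ' : (b : ℤ) ≤ Q := by exact_mod_cast hbQ
    have hb0 : (0 : ℤ) ≤ b := by positivity
    rw [hb2] at j1
    have hdiv : a'.reg 13 / 2 = b := by rw [j1]; push_cast; omega
    have hrQ : a'.reg 12 ≤ Q := by
      by_contra hc
      push Not at hc
      have : (0 : ℤ) ≤ Q := by positivity
      nlinarith
    have hev : ((Ex.var 11).lt ((.var 12 + .var 13) * (.var 12 + .var 13))).ev I (a'.set 13 b) =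
        if a.reg 11 < (a'.reg 12 + b) * (a'.reg 12 + b) then 1 else 0 := by
      simp [h11]
    refine Runs.asg_seq (T := 2) ?_ ?_
    · simp only [Ex.ok_div, Ex.ok_var, Ex.ok_lit, Ex.ev_var, Ex.ev_lit, j1, true_and]
      exact ⟨inR_natCast (by omega), inR_natCast (by omega)⟩
    · simp only [Ex.ev_div, Ex.ev_var, Ex.ev_lit, Nat.cast_ofNat, hdiv]
      refine Runs.ite (T := 1) ?_ ?_ (fun h => ?_) (fun h => ?_)
      · simp only [Ex.ok_lt, Ex.ok_var, Ex.ok_mul, Ex.ok_add, Ex.ev_var, Ex.ev_mul, Ex.ev_add,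
          Abs.set_reg, true_and, and_true]
        norm_num
        rw [h11]
        refine ⟨⟨h0, by nlinarith⟩, by positivity, by nlinarith⟩
      · rw [hev]
        split_ifs
        · exact_mod_cast inR_natCast (w := w) (x := 1) (by omega)
        · exact ⟨le_rfl, by positivity⟩
      · have hlt : a.reg 11 < (a'.reg 12 + b) * (a'.reg 12 + b) := by
          by_contra hc
          rw [hev, if_neg hc] at h; exact h rfl
        refine Runs.skip ⟨by simpa using j0, by simp [hb], by simpa using j2, ?_⟩
        simp; rw [sq]; exact hlt
      · have hlt : ¬ a.reg 11 < (a'.reg 12 + b) * (a'.reg 12 + b) := by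
          intro hc
          rw [hev, if_pos hc] at h; exact one_ne_zero h
        refine Runs.asg (by simp) ⟨?_, by simp [hb], ?_, ?_⟩
        · simp; linarith
        · simp; rw [sq]; omega
        · simp; rw [j1] at j3; push_cast at j3
          rwa [show a'.reg 12 + b + b = a'.reg 12 + 2 * b by ring]
  · obtain ⟨j0, j1, j2, j3⟩ := hJ
    rw [j1] at j3
    simp only [Nat.sub_self, pow_zero, Nat.cast_one] at j3
    exact ⟨j0, j2, j3⟩

/-- Approximate `Q * cos (2 π / N)` in `17` and `Q * sin (2 π / N)` in `18`. -/
def rootCmd : Cmd :=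
  .asg 17 (.lit 0) ;;
  .loop 24 (.var 3 - .lit 2)
    (.asg 11 (.var 5 * (.var 5 + .var 17) / .lit 2) ;; sqrtCmd ;; .asg 17 (.var 12)) ;;
  .asg 11 (.var 5 * .var 5 - .var 17 * .var 17) ;; sqrtCmd ;; .asg 18 (.var 12)

/-- The start `cos (π / 2) = 0` is exact, and `k - 2` halvings of the angle lead to `2 π / N`.
Cosine and sine each contribute at most `4 / G`. -/
theorem rootCmd_runs {N k Q G : ℕ} (hr : FftRegs N k Q a) (hQ : Q = 2 ^ (24 * k)) (hk : 2 ≤ k)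
    (hN : N = 2 ^ k) (hG : Q = G ^ 2) (hQW : 2 * Q ^ 3 < 2 ^ w) :
    Runs w I tape rootCmd a (96 * (k * k) + 106 * k + 11) (fun a' =>
      ‖cval Q (a'.reg 17) (a'.reg 18) - Complex.exp (2 * Real.pi * Complex.I / N)‖ ≤ 8 / G) := by
  have hQ0 : 0 < Q := by rw [hQ]; positivity
  have hQ0' : (0 : ℤ) < Q := by exact_mod_cast hQ0
  have hQW' : 2 * (Q : ℤ) ^ 3 < 2 ^ w := by exact_mod_cast hQW
  have hQ3 : (Q : ℤ) * Q ≤ Q ^ 3 := by nlinarith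
  have hkQ : 24 * k + 1 ≤ Q := by rw [hQ]; exact Nat.lt_two_pow_self
  have hQ1 : Q ≤ Q ^ 3 := Nat.le_self_pow (by norm_num) Q
  have hcos : ∀ i, 0 ≤ Real.cos (Real.pi / 2 / 2 ^ i) := fun i => by
    apply Real.cos_nonneg_of_neg_pi_div_two_le_of_le
    · have : 0 ≤ Real.pi / 2 / 2 ^ i := by positivity
      linarith [Real.pi_pos]
    · apply div_le_self (by positivity)
      exact one_le_pow₀ (by norm_num)
  refine Runs.mono (Runs.asg_seq trivial (Runs.seq' (Runs.loop (T := 96 * k + 9) (k - 2)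
    (fun i a' => 0 ≤ a'.reg 17 ∧ a'.reg 17 ≤ Q ∧
      |(a'.reg 17 : ℝ) / (Q : ℤ) - Real.cos (Real.pi / 2 / 2 ^ i)| ≤ 4 / (Q : ℤ))
    (by simp) (by simp [hr.r3]; omega) (by omega) rfl ?_
    fun i hi a' h23 f1 hJ => ?_) fun a1 f1 hJ => Runs.asg_seq (by simp)
      (Runs.seq' (sqrtCmd_runs (N := N) (k := k) (Q := Q) ?_ hQ (by omega) hQW ?_ ?_)
      fun a2 f2 q2 => Runs.asg trivial ?_)))
    (show 1 + (1 + (k - 2) * (96 * k + 9 + 1) + (1 + (96 * k + 7 + 1))) ≤ _ by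
      obtain ⟨l, rfl⟩ := Nat.exists_eq_add_of_le hk
      simp only [Nat.add_sub_cancel_left]
      nlinarith) fun _ h => h
  · simp; positivity
  · obtain ⟨j0, j1, j2⟩ := hJ
    have hr' : FftRegs N k Q a' := hr.congr fun r h h' => by
      rw [f1.reg r (by simp [Cmd.wr, sqrtCmd]; omega)]
      simp; omega
    have hx0 : 0 ≤ (Q : ℤ) * (Q + a'.reg 17) := by positivity
    have hx1 : (Q : ℤ) * (Q + a'.reg 17) ≤ 2 * (Q * Q) := by nlinarith
    refine Runs.mono (Runs.asg_seq ?_ (Runs.seq' (sqrtCmd_runs (N := N) (k := k) (Q := Q)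
      (hr'.congr fun r _ _ => by simp; omega) hQ (by omega) hQW ?_ ?_)
      fun a2 f2 q2 => Runs.asg trivial ?_)) (show 1 + (96 * k + 7 + 1) ≤ _ by omega) fun _ h => h
    · simp only [Ex.ok_div, Ex.ok_mul, Ex.ok_add, Ex.ok_var, Ex.ok_lit, Ex.ev_mul, Ex.ev_add,
        Ex.ev_var, hr'.r5, true_and, and_true]
      exact ⟨⟨hx0, by linarith⟩, inR_natCast (by
        show 2 < 2 ^ w
        omega)⟩
    · simp [hr'.r5]; omega
    · simp [hr'.r5]; omega
    · obtain ⟨s0, s1, s2⟩ := q2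
      simp [hr'.r5] at s1 s2
      simp only [Ex.ev_var, Abs.set_reg]
      norm_num
      have s3 : a2.reg 12 ^ 2 ≤ (Q : ℤ) ^ 2 := by rw [sq (Q : ℤ)]; omega
      refine ⟨s0, (sq_le_sq₀ s0 hQ0'.le).1 s3, ?_⟩
      have h2 : Real.pi / 2 / 2 ^ (i + 1) = Real.pi / 2 / 2 ^ i / 2 := by
        rw [pow_succ]; field_simp
      have := half_angle_error hQ0' j0 s0 (hcos i) (by rw [← h2]; exact hcos _) j2 s1 s2
      rw [h2]
      simpa using this
  · exact hr.congr fun r h h' => by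
      rw [Abs.set_reg, if_neg (by omega), f1.reg r (by simp [Cmd.wr, sqrtCmd]; omega)]
      simp; omega
  · have h5 : a1.reg 5 = Q := by rw [f1.reg 5 rfl]; simpa using hr.r5
    simp [h5]; nlinarith
  · have h5 : a1.reg 5 = Q := by rw [f1.reg 5 rfl]; simpa using hr.r5
    simp [h5]; nlinarith
  · obtain ⟨j0, j1, j2⟩ := hJ
    obtain ⟨s0, s1, s2⟩ := q2
    have h5 : a1.reg 5 = Q := by rw [f1.reg 5 rfl]; simpa using hr.r5
    have h17 : a2.reg 17 = a1.reg 17 := by rw [f2.reg 17 rfl]; simp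
    simp [h5] at s1 s2
    have hG0 : 0 < G := by
      rcases Nat.eq_zero_or_pos G with rfl | h
      · simp at hG; omega
      · exact h
    set θ := Real.pi / 2 / 2 ^ (k - 2) with hθ
    have hθN : θ = 2 * Real.pi / N := by
      rw [hθ, hN]; push_cast
      conv_rhs => rw [show k = k - 2 + 2 by omega, pow_add]
      field_simp
    have hQG : ((Q : ℕ) : ℤ) = (G : ℤ) ^ 2 := by rw [hG]; push_cast; rfl
    have hsin : 0 ≤ Real.sin θ := by
      apply Real.sin_nonneg_of_nonneg_of_le_pi
      · positivity
      · calc θ ≤ Real.pi / 2 := div_le_self (by positivity) (one_le_pow₀ (by norm_num))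
          _ ≤ Real.pi := by linarith [Real.pi_pos]
    have hs := sin_error (G := G) (by exact_mod_cast hG0) j0 (by rw [← hQG]; exact j1) s0 hsin
      (by rw [← hQG]; exact j2) (by rw [← hQG]; exact s1) (by rw [← hQG]; exact s2)
    rw [← hQG] at hs
    simp only [Ex.ev_var, Abs.set_reg]
    norm_num
    rw [h17]
    have hexp : Complex.exp (2 * Real.pi * Complex.I / N) = ⟨Real.cos θ, Real.sin θ⟩ := by
      rw [show (2 * Real.pi * Complex.I / N : ℂ) = (θ : ℂ) * Complex.I by
        rw [hθN]; push_cast; ring, Complex.exp_mul_I]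
      apply Complex.ext <;> simp [Complex.cos_ofReal_re, Complex.sin_ofReal_re]
    rw [hexp]
    refine (Complex.norm_le_abs_re_add_abs_im _).trans ?_
    simp only [cval, Complex.sub_re, Complex.sub_im]
    have hG1 : (1 : ℝ) ≤ G := by exact_mod_cast hG0
    have h4 : (4 : ℝ) / (Q : ℤ) ≤ 4 / G := by
      rw [hQG]; push_cast; gcongr; nlinarith
    have h8 : (4 : ℝ) / G + 4 / G = 8 / G := by ring
    have hs' : |((a2.reg 12 : ℤ) : ℝ) / ((Q : ℤ) : ℝ) - Real.sin θ| ≤ 4 / G := by simpa using hs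
    linarith

end

/-! ### Setup of the Fourier transform, and correlations -/

section
variable {n m σT σP : ℕ} {w : ℕ} {I : Input n m σT σP} {tape : ℕ → ℕ} {a : Abs}

/-- The table of roots of unity. -/
def twidCmd : Cmd :=
  .sto 5 (.lit 0) (.var 5) ;; .sto 6 (.lit 0) (.lit 0) ;;
  .loop 23 (.var 4 - .lit 1)
    (.sto 5 (.var 23 + .lit 1) (fdivE (.rd 5 (.var 23) * .var 17 - .rd 6 (.var 23) * .var 18)) ;;
      .sto 6 (.var 23 + .lit 1) (fdivE (.rd 5 (.var 23) * .var 18 + .rd 6 (.var 23) * .var 17)))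

theorem twidCmd_runs {N k Q : ℕ} {ω : ℂ} {δ : ℝ} (hr : FftRegs N k Q a) (hN : 2 ≤ N)
    (hW : n + m + 16 * N < 2 ^ w) (hQ : 8 ≤ Q) (hQW : 2 * Q ^ 3 < 2 ^ w) (hω : ‖ω‖ = 1)
    (h1 : ‖cval Q (a.reg 17) (a.reg 18) - ω‖ ≤ δ) (hδ : (N / 2 : ℕ) * (2 * δ + 2 / Q) ≤ 1) :
    Runs w I tape twidCmd a (3 + N * 3) (fun a' => ∀ x < N / 2,
      ‖twid Q a' x - ω ^ x‖ ≤ (N / 2 : ℕ) * (2 * δ + 2 / Q)) := by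
  have hQ0 : 0 < Q := by omega
  have hQ' : (0 : ℤ) < Q := by exact_mod_cast hQ0
  have hQR : (0 : ℝ) < Q := by exact_mod_cast hQ0
  have hδ0 : 0 ≤ δ := (norm_nonneg _).trans h1
  have hε0 : 0 ≤ 2 * δ + 2 / (Q : ℝ) := by positivity
  have hδ1 : 2 * δ + 2 / Q ≤ 1 := by
    have : (1 : ℝ) ≤ (N / 2 : ℕ) := by exact_mod_cast (show 1 ≤ N / 2 by omega)
    nlinarith
  have had : ∀ id, id ≠ 0 → id < 16 → ∀ x < N, AddrOk (n + m) w id x := fun id h h' x hx =>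
    addrOk_of_lt h h' hx hW
  have hpow : ∀ x, ‖ω ^ x‖ = 1 := fun x => by rw [norm_pow, hω, one_pow]
  have had5 : AddrOk (n + m) w 5 ((0 : ℕ) : ℤ) := had 5 (by norm_num) (by norm_num) 0 (by omega)
  have had6 : AddrOk (n + m) w 6 ((0 : ℕ) : ℤ) := had 6 (by norm_num) (by norm_num) 0 (by omega)
  refine Runs.mono (Runs.sto_seq (Ex.ok_lit _ _ _ _) (Ex.ok_var _ _ _ _) had5
    (Runs.sto_seq (Ex.ok_lit _ _ _ _) (Ex.ok_lit _ _ _ _) had6 (Runs.imp (Runs.loop (T := 2) (N / 2 - 1) (fun i a' => twid Q a' 0 = 1 ∧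
      ∀ x < i, ‖twid Q a' (x + 1) - twid Q a' x * cval Q (a.reg 17) (a.reg 18)‖ ≤ 2 / Q)
      (by simp) (by simp [hr.r4]; omega) (by omega) rfl ?_
      fun i hi a' h23 f1 hJ => ?_) fun a' _ hJ x hx => ?_)))
    (show 1 + (1 + (1 + (N / 2 - 1) * (2 + 1))) ≤ _ by omega) fun _ h => h
  · refine ⟨?_, fun x hx => absurd hx (Nat.not_lt_zero x)⟩
    simp only [twid, Abs.set_arr, Abs.put_arr, Ex.ev_lit, Ex.ev_var, hr.r5]
    apply Complex.ext <;> simp [cval, hQR.ne']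
  · obtain ⟨j0, j1⟩ := hJ
    have hr' : FftRegs N k Q a' := hr.congr fun r h h' => by
      rw [f1.reg r (by simp [Cmd.wr]; omega)]; rfl
    have h17 : a'.reg 17 = a.reg 17 := by rw [f1.reg 17 rfl]; rfl
    have h18 : a'.reg 18 = a.reg 18 := by rw [f1.reg 18 rfl]; rfl
    have hsmall : ∀ L : ℕ, L ≤ N / 2 → (L : ℝ) * (2 * δ + 2 / Q) ≤ 1 := fun L hL => by
      refine le_trans ?_ hδ
      gcongr
    have hti := twiddle_error hω j0 h1 j1 (hsmall i (by omega)) i le_rfl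
    have hb1 : |a'.arr 5 i| ≤ 2 * Q ∧ |a'.arr 6 i| ≤ 2 * Q := by
      refine abs_le_of_norm_cval (Q := Q) (B := 2) hQ' ?_
      have h2 := norm_le_norm_add_norm_sub' (twid Q a' i) (ω ^ i)
      have h3 := hsmall i (by omega)
      have h4 := hpow i
      rw [show cval Q (a'.arr 5 i) (a'.arr 6 i) = twid Q a' i from rfl]
      push_cast
      linarith
    have hb2 : |a.reg 17| ≤ 2 * Q ∧ |a.reg 18| ≤ 2 * Q := by
      refine abs_le_of_norm_cval (Q := Q) (B := 2) hQ' ?_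
      have h2 := norm_le_norm_add_norm_sub' (cval Q (a.reg 17) (a.reg 18)) ω
      push_cast
      have : 0 ≤ 2 / (Q : ℝ) := by positivity
      linarith
    have hb := abs_mul_add_mul_le hb1.1 hb1.2 hb2.1 hb2.2
    -- All coordinates are at most `2 * Q`, so the numerators are at most `8 * Q ^ 2`; here `8 ≤ Q`
    -- is needed.
    have hb3 : 2 * (2 * (Q : ℤ) * (2 * Q)) ≤ Q ^ 3 := by
      have : (8 : ℤ) ≤ Q := by exact_mod_cast hQ
      nlinarith [mul_nonneg hQ'.le hQ'.le]
    have hi1 : ((a'.reg 23) + 1).toNat = i + 1 := by rw [h23]; omega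
    have ha5 := had 5 (by norm_num) (by norm_num) i (by omega)
    have ha6 := had 6 (by norm_num) (by norm_num) i (by omega)
    have ha5' := had 5 (by norm_num) (by norm_num) (i + 1) (by omega)
    have ha6' := had 6 (by norm_num) (by norm_num) (i + 1) (by omega)
    push_cast at ha5' ha6'
    have k1 := fdivE_ok (I := I) (e := .rd 5 (.var 23) * .var 17 - .rd 6 (.var 23) * .var 18) hr'
      hQ0 hQW (by simp [h23, ha5, ha6]) (by simpa [h23, h17, h18] using hb.1.trans hb3)
    simp only [Ex.ev_sub, Ex.ev_mul, Ex.ev_rd, Ex.ev_var, h23, h17, h18, Int.toNat_natCast] at k1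
    -- The imaginary part is computed after the real part has been stored, but the store was at `i +
    -- 1`, so the entry at `i` is still the old one.
    set a2 := a'.put 5 (i + 1) ((a'.arr 5 i * a.reg 17 - a'.arr 6 i * a.reg 18) / Q) with ha2
    have hr2 : FftRegs N k Q a2 := hr'.congr fun r _ _ => rfl
    have k2 := fdivE_ok (I := I) (e := .rd 5 (.var 23) * .var 18 + .rd 6 (.var 23) * .var 17) hr2
      hQ0 hQW (by simp [ha2, h23, ha5, ha6])
      (by simpa [ha2, h23, h17, h18] using hb.2.trans hb3)
    simp only [Ex.ev_add, Ex.ev_mul, Ex.ev_rd, Ex.ev_var, ha2, Abs.put_reg, h23, h17, h18,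
      Int.toNat_natCast, Abs.put_arr] at k2
    norm_num at k2
    refine Runs.sto_seq (T := 1) (by simp) k1.1 (by simpa [h23] using ha5') ?_
    simp only [Ex.ev_add, Ex.ev_var, Ex.ev_lit, Nat.cast_one, hi1, k1.2]
    refine Runs.sto (by simp) k2.1 (by simpa [h23] using ha6') ?_
    simp only [Ex.ev_add, Ex.ev_var, Ex.ev_lit, Nat.cast_one, hi1, k2.2, Abs.put_reg]
    have htw : ∀ x ≤ i, twid Q (((a2.put 6 (i + 1)
        ((a'.arr 5 i * a.reg 18 + a'.arr 6 i * a.reg 17) / Q))).set 23 ((i + 1 : ℕ) : ℤ)) x =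
        twid Q a' x := fun x hx => by
      simp only [twid, Abs.set_arr, Abs.put_arr, ha2]
      norm_num
      rw [if_neg (by omega), if_neg (by omega)]
    refine ⟨by rw [htw 0 (by omega)]; exact j0, fun x hx => ?_⟩
    rw [htw x (by omega)]
    rcases Nat.lt_succ_iff_lt_or_eq.1 hx with h | rfl
    · rw [htw (x + 1) (by omega)]; exact j1 x h
    · have := norm_cval_mul_sub_le hQ' (a'.arr 5 x) (a'.arr 6 x) (a.reg 17) (a.reg 18)
      simp only [twid, Abs.set_arr, Abs.put_arr]
      norm_num
      simpa using this
  · have hL : ((N / 2 - 1 : ℕ) : ℝ) * (2 * δ + 2 / Q) ≤ 1 := by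
      refine le_trans ?_ hδ
      gcongr; omega
    have := twiddle_error hω hJ.1 h1 hJ.2 hL x (by omega)
    refine this.trans ?_
    gcongr

/-- Choose the length `N ≥ 2 m` of the transform and compute the constants it needs. -/
def fftSetup : Cmd :=
  growLoop 2 3 4 2 (.var 1) (.lit 2 * .var 1) ;;
  .asg 4 (.var 2 / .lit 2) ;; .asg 14 (.var 2 * .var 2) ;; .asg 14 (.var 14 * .var 14) ;;
  .asg 14 (.var 14 * .var 14 * .var 14) ;; .asg 5 (.var 14 * .var 14) ;; .asg 6 (.var 5 * .var 5) ;;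
  rootCmd ;; twidCmd

/-- The standard primitive root of unity. -/
noncomputable def rootU (N : ℕ) : ℂ := Complex.exp (2 * Real.pi * Complex.I / N)

theorem norm_rootU {N : ℕ} (hN : N ≠ 0) : ‖rootU N‖ = 1 :=
  (Complex.isPrimitiveRoot_exp N hN).norm'_eq_one hN

theorem rootU_pow_half {N : ℕ} (hN : 2 ≤ N) (h2 : 2 ∣ N) : rootU N ^ (N / 2) = -1 := by
  have h := Complex.isPrimitiveRoot_exp N (by omega)
  have h1 := (h.pow (by omega) (show N = N / 2 * 2 by omega)).eq_neg_one_of_two_right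
  exact h1

/-- The state after the setup. -/
structure FftReady (N k : ℕ) (a : Abs) : Prop where
  regs : FftRegs N k (N ^ 24) a
  two_le : 2 ≤ k
  eq : N = 2 ^ k
  tw : ∀ x < N / 2, ‖twid (N ^ 24) a x - rootU N ^ x‖ ≤ 9 / (N : ℝ) ^ 11

theorem sq_le_four_mul_two_pow (k : ℕ) : k * k ≤ 4 * 2 ^ k := by
  induction k with
  | zero => simp
  | succ k ih =>
    rcases Nat.lt_or_ge k 4 with h | h
    · interval_cases k <;> norm_num
    · rw [pow_succ]; nlinarith

/-- With `Q = N ^ 24` the root has error `8 / N ^ 12`, and its powers `9 / N ^ 11`. About `k` square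
roots of `O(k)` steps each are taken; by `sq_le_four_mul_two_pow` this is linear in `m`. -/
theorem fftSetup_runs (h1 : a.reg 1 = m) (hm : 1 ≤ m) (hW : n + m + 16 * (4 * m) < 2 ^ w)
    (hQW : 2 * ((4 * m) ^ 24) ^ 3 < 2 ^ w) :
    Runs w I tape fftSetup a (2500 * m) (fun a' => ∃ N k, FftReady N k a' ∧ 2 * m ≤ N ∧
      N ≤ 4 * m) := by
  refine Runs.mono (Runs.seq' (growLoop_runs (L := m) (t := 2 * m) (by norm_num) (by norm_num)
    (by norm_num) (by norm_num) (fun a' h _ => ?_) (fun a' h _ => ?_) (by omega) (by omega)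
    (by omega) ?_) (T' := 2300 * m) fun a1 f1 q1 => ?_) (by omega) fun _ h => h
  · exact ⟨trivial, by simpa using (h 1 (by norm_num) (by norm_num) (by norm_num)).trans h1⟩
  · refine ⟨by simp, ?_⟩
    simp [h 1 (by norm_num) (by norm_num) (by norm_num), h1]
  · have := Nat.lt_two_pow_self (n := m)
    rw [pow_add]; omega
  · obtain ⟨k, hk, k1, k2, k3, k4⟩ := q1
    set N := 2 ^ k with hN
    have hN4m : N ≤ 4 * m := by
      rcases k4 with h | h
      · rw [hN, h]; omega
      · omega
    have hN4 : 4 ≤ N := by rw [hN]; exact Nat.pow_le_pow_right (n := 2) (by norm_num) hk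
    have hk0 : N ^ 24 = 2 ^ (24 * k) := by rw [hN, ← pow_mul, mul_comm]
    have hQN : N ≤ N ^ 24 := Nat.le_self_pow (by norm_num) N
    have hQ8 : 8 ≤ N ^ 24 := by
      calc 8 ≤ 4 ^ 24 := by norm_num
        _ ≤ N ^ 24 := Nat.pow_le_pow_left hN4 24
    have hQW' : 2 * (N ^ 24) ^ 3 < 2 ^ w := lt_of_le_of_lt
      (Nat.mul_le_mul_left 2 (Nat.pow_le_pow_left (Nat.pow_le_pow_left hN4m 24) 3)) hQW
    have hkN : k ≤ N := Nat.lt_two_pow_self.le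
    have hkk := sq_le_four_mul_two_pow k
    have hG : (0 : ℝ) < (N ^ 12 : ℕ) := by positivity
    have hNR : (0 : ℝ) < N := by positivity
    have hN4R : (4 : ℝ) ≤ N := by exact_mod_cast hN4
    have hQG : (2 : ℝ) / (N ^ 24 : ℕ) ≤ 2 / (N ^ 12 : ℕ) := by
      gcongr
      · omega
      · norm_num
    -- There are at most `N / 2` multiplications, each with loss at most `18 / N ^ 12`.
    have hδ : ((N / 2 : ℕ) : ℝ) * (2 * (8 / (N ^ 12 : ℕ)) + 2 / (N ^ 24 : ℕ)) ≤
        9 / (N : ℝ) ^ 11 := by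
      have h2 : ((N / 2 : ℕ) : ℝ) ≤ N / 2 := Nat.cast_div_le
      calc ((N / 2 : ℕ) : ℝ) * (2 * (8 / (N ^ 12 : ℕ)) + 2 / (N ^ 24 : ℕ))
          ≤ N / 2 * (2 * (8 / (N ^ 12 : ℕ)) + 2 / (N ^ 12 : ℕ)) := by gcongr
        _ = 9 / (N : ℝ) ^ 11 := by push_cast; field_simp; norm_num
    have hδ1 : 9 / (N : ℝ) ^ 11 ≤ 1 := by
      rw [div_le_one (by positivity)]
      calc (9 : ℝ) ≤ 4 ^ 11 := by norm_num
        _ ≤ N ^ 11 := by gcongr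
    have i2 : InR w (N : ℤ) := inR_natCast (by omega)
    have i3 : InR w (2 : ℤ) := inR_natCast (w := w) (x := 2) (by omega)
    refine Runs.mono (Runs.asg_seq (by simp [k1, i2, i3]) (Runs.asg_seq (by simp) (Runs.asg_seq (by simp)
      (Runs.asg_seq (by simp) (Runs.asg_seq (by simp) (Runs.asg_seq (by simp) (Runs.seq'
      (rootCmd_runs (N := N) (k := k) (Q := N ^ 24) (G := N ^ 12) ?_ hk0 hk hN (by ring) hQW')
      fun a2 f2 q2 => (twidCmd_runs (N := N) (k := k) (Q := N ^ 24) ?_ (by omega) (by omega) hQ8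
        hQW' (norm_rootU (by omega)) q2 (hδ.trans hδ1)).imp fun a3 f3 q3 => ?_)))))))
      (show 1 + (1 + (1 + (1 + (1 + (1 + (96 * (k * k) + 106 * k + 11 + (3 + N * 3))))))) ≤ _ by
        omega) fun _ h => h
    · constructor <;> simp [k1, k2] <;> ring
    · have hr2 : ∀ r, r ≤ 6 → a2.reg r = _ := fun r hr => f2.reg r (by
        simp [Cmd.wr, rootCmd, sqrtCmd]; omega)
      constructor <;> rw [hr2 _ (by norm_num)] <;> simp [k1, k2] <;> ring
    · refine ⟨N, k, ⟨?_, hk, hN, fun x hx => (q3 x hx).trans hδ⟩, k3, hN4m⟩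
      have hr2 : ∀ r, r ≤ 6 → a3.reg r = _ := fun r hr => (f3.reg r (by
        simp [Cmd.wr, twidCmd]; omega)).trans (f2.reg r (by
        simp [Cmd.wr, rootCmd, sqrtCmd]; omega))
      constructor <;> rw [hr2 _ (by norm_num)] <;> simp [k1, k2] <;> ring

/-- Multiply the transform in `1, 2` by the one in `11, 12`. -/
def mulCmd : Cmd :=
  .loop 26 (.var 2) (.sto 3 (.var 26) (fdivE (.rd 1 (.var 26) * .rd 11 (.var 26) -
    .rd 2 (.var 26) * .rd 12 (.var 26)))) ;;
  .loop 26 (.var 2) (.sto 4 (.var 26) (fdivE (.rd 1 (.var 26) * .rd 12 (.var 26) +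
    .rd 2 (.var 26) * .rd 11 (.var 26)))) ;;
  copyBack

theorem mulCmd_runs {N k Q Z : ℕ} (hr : FftRegs N k Q a) (hW : n + m + 16 * N < 2 ^ w)
    (hQ : 0 < Q) (hQW : 2 * Q ^ 3 < 2 ^ w)
    (hz : ∀ x < N, |a.arr 1 x| ≤ Z * Q ∧ |a.arr 2 x| ≤ Z * Q)
    (hz' : ∀ x < N, |a.arr 11 x| ≤ Z * Q ∧ |a.arr 12 x| ≤ Z * Q) (hZ : 2 * Z ^ 2 ≤ Q) :
    Runs w I tape mulCmd a (4 + 8 * N) (fun a' => ∀ p < N,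
      ‖dat Q a' p - dat Q a p * cval Q (a.arr 11 p) (a.arr 12 p)‖ ≤ 2 / Q) := by
  have hN : N < 2 ^ w := by omega
  have hbd : ∀ p < N, |a.arr 1 p * a.arr 11 p - a.arr 2 p * a.arr 12 p| ≤ (Q : ℤ) ^ 3 ∧
      |a.arr 1 p * a.arr 12 p + a.arr 2 p * a.arr 11 p| ≤ (Q : ℤ) ^ 3 := by
    intro p hp
    have h := abs_mul_add_mul_le (hz p hp).1 (hz p hp).2 (hz' p hp).1 (hz' p hp).2
    have e : 2 * ((Z : ℤ) * Q * (Z * Q)) ≤ Q ^ 3 := by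
      have h1 : (2 * Z ^ 2 : ℤ) * (Q * Q) ≤ Q * (Q * Q) :=
        mul_le_mul_of_nonneg_right (by exact_mod_cast hZ) (by positivity)
      nlinarith
    exact ⟨h.1.trans e, h.2.trans e⟩
  have had : ∀ id, id ≠ 0 → id < 16 → ∀ x < N, AddrOk (n + m) w id x := fun id h h' x hx =>
    addrOk_of_lt h h' hx hW
  refine Runs.mono (Runs.seq' (Runs.map (i := 26) N (fun p =>
      (a.arr 1 p * a.arr 11 p - a.arr 2 p * a.arr 12 p) / Q) trivial hr.r2 hN
      (had 3 (by norm_num) (by norm_num)) fun p hp a' h1 h2 h3 h4 => ?_)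
    fun a1 f1 q1 => Runs.seq' (Runs.map (i := 26) N (fun p =>
      (a.arr 1 p * a.arr 12 p + a.arr 2 p * a.arr 11 p) / Q) (Ex.ok_var _ _ _ _)
      ((f1.reg 2 rfl).trans hr.r2) hN
      (had 4 (by norm_num) (by norm_num)) fun p hp a' h1 h2 h3 h4 => ?_)
    fun a2 f2 q2 => (copyBack_runs (N := N) (k := k) (Q := Q) ?_ hW).imp
    fun a3 f3 q3 p hp => ?_)
    (show (1 + N * 2) + ((1 + N * 2) + (2 + N * 4)) ≤ _ by omega) fun _ h => h
  · have hr' : FftRegs N k Q a' := hr.congr fun r _ _ => h2 r (by omega)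
    have ev : (Ex.rd 1 (.var 26) * .rd 11 (.var 26) - .rd 2 (.var 26) * .rd 12 (.var 26)).ev I a' =
        a.arr 1 p * a.arr 11 p - a.arr 2 p * a.arr 12 p := by
      simp [h1, h3 1 (by norm_num), h3 11 (by norm_num), h3 2 (by norm_num), h3 12 (by norm_num)]
    have := fdivE_ok (I := I) (e := .rd 1 (.var 26) * .rd 11 (.var 26) -
      .rd 2 (.var 26) * .rd 12 (.var 26)) hr' hQ hQW
      (by simp [h1, had _ _ _ p hp]) (by rw [ev]; exact (hbd p hp).1)
    rwa [ev] at this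
  · have hr' : FftRegs N k Q a' := hr.congr fun r _ _ => (h2 r (by omega)).trans
      (f1.reg r (by simp [Cmd.wr]; omega))
    have ev : (Ex.rd 1 (.var 26) * .rd 12 (.var 26) + .rd 2 (.var 26) * .rd 11 (.var 26)).ev I a' =
        a.arr 1 p * a.arr 12 p + a.arr 2 p * a.arr 11 p := by
      simp [h1, h3 1 (by norm_num), h3 11 (by norm_num), h3 2 (by norm_num), h3 12 (by norm_num),
        f1.arr 1 rfl, f1.arr 2 rfl, f1.arr 11 rfl, f1.arr 12 rfl]
    have := fdivE_ok (I := I) (e := .rd 1 (.var 26) * .rd 12 (.var 26) +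
      .rd 2 (.var 26) * .rd 11 (.var 26)) hr' hQ hQW
      (by simp [h1, had _ _ _ p hp]) (by rw [ev]; exact (hbd p hp).2)
    rwa [ev] at this
  · exact hr.congr fun r _ _ => (f2.reg r (by simp [Cmd.wr]; omega)).trans
      (f1.reg r (by simp [Cmd.wr]; omega))
  · simp only [dat]
    rw [(q3 p hp).1, (q3 p hp).2, f2.arr 3 rfl, q1.1 p hp, q2.1 p hp]
    have := norm_cval_mul_sub_le (Q := Q) (by exact_mod_cast hQ) (a.arr 1 p) (a.arr 2 p)
      (a.arr 11 p) (a.arr 12 p)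
    rwa [Int.cast_natCast] at this

end

/-! ### Counting matches by correlations -/

section
variable {n m σT σP : ℕ} {w : ℕ} {I : Input n m σT σP} {tape : ℕ → ℕ} {a : Abs}

/-- A loop that computes consecutive entries of an array, beginning with the one at `off`. -/
theorem Runs.mapAt {i dst : ℕ} {e ix v : Ex} (L off : ℕ) (g : ℕ → ℤ) (hok : e.ok w I a)
    (hL : e.ev I a = L) (hlt : L < 2 ^ w) (haddr : ∀ p < L, AddrOk (n + m) w dst (off + p : ℕ))
    (hv : ∀ p < L, ∀ a', a'.reg i = (p : ℤ) → (∀ r, r ≠ i → a'.reg r = a.reg r) →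
      (∀ id, id ≠ dst → a'.arr id = a.arr id) →
      (∀ x, off + p ≤ x → a'.arr dst x = a.arr dst x) →
      ix.ok w I a' ∧ ix.ev I a' = (off + p : ℕ) ∧ v.ok w I a' ∧ v.ev I a' = g p) :
    Runs w I tape (.loop i e (.sto dst ix v)) a (1 + L * 2) (fun a' =>
      (∀ p < L, a'.arr dst (off + p) = g p) ∧
      (∀ x, x < off ∨ off + L ≤ x → a'.arr dst x = a.arr dst x)) := by
  refine Runs.loop (T := 1) L (fun k a' => (∀ p < k, a'.arr dst (off + p) = g p) ∧
    (∀ x, x < off ∨ off + k ≤ x → a'.arr dst x = a.arr dst x)) hok hL hlt rfl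
    ⟨fun p hp => absurd hp (Nat.not_lt_zero p), fun _ _ => rfl⟩ fun k hk a' hi hf hJ => ?_
  obtain ⟨h1, h2, h3, h4⟩ := hv k hk a' hi
    (fun r hr => hf.reg r (by simp [Cmd.wr, Ne.symm hr]))
    (fun id hid => hf.arr id (by simp [Cmd.wa, Ne.symm hid])) (fun x hx => hJ.2 x (Or.inr hx))
  refine Runs.sto h1 h3 (by rw [h2]; exact haddr k hk) ?_
  simp only [h2, h4, Int.toNat_natCast, Abs.set_arr, Abs.put_arr, true_and]
  refine ⟨fun p hp => ?_, fun x hx => ?_⟩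
  · split_ifs with h
    · rw [show p = k by omega]
    · exact hJ.1 p (by omega)
  · rw [if_neg (by omega)]
    exact hJ.2 x (by omega)

theorem isPrimitiveRoot_rootU {N : ℕ} (hN : N ≠ 0) : IsPrimitiveRoot (rootU N) N :=
  Complex.isPrimitiveRoot_exp N hN

/-- Multiply by the transform in `11, 12` and transform again. -/
def corrCmd : Cmd := fft ;; mulCmd ;; fft

/-- The error of a transform of exact data bounded by 1, with roots accurate to `9 / N ^ 11`. -/
theorem pat_error {N : ℝ} (hN : 4 ≤ N) :
    N ^ 2 * (0 + (2 * (N * 1) * (9 / N ^ 11) + 2 / N ^ 24)) ≤ 20 / N ^ 8 := by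
  have h0 : 0 < N := by linarith
  have h1 : N ^ 2 * (2 / N ^ 24) ≤ 2 / N ^ 8 := by
    rw [mul_div_assoc', div_le_div_iff₀ (by positivity) (by positivity)]
    have : N ^ 10 ≤ N ^ 24 := pow_le_pow_right₀ (by linarith) (by norm_num)
    nlinarith
  have h2 : N ^ 2 * (2 * (N * 1) * (9 / N ^ 11)) = 18 / N ^ 8 := by field_simp; norm_num
  have h3 : (18 : ℝ) / N ^ 8 + 2 / N ^ 8 = 20 / N ^ 8 := by ring
  rw [zero_add, mul_add, h2]
  linarith

/-- The error of the product of two transforms bounded by `N`, each accurate to `20 / N ^ 8`,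
including the rounding of the multiplication. -/
theorem prod_error {N : ℝ} (hN : 4 ≤ N) :
    20 / N ^ 8 * (2 * N + 20 / N ^ 8) + 2 / N ^ 24 ≤ 62 / N ^ 7 := by
  have h0 : 0 < N := by linarith
  have h1 : (20 : ℝ) / N ^ 8 ≤ N := by
    rw [div_le_iff₀ (by positivity)]
    calc (20 : ℝ) ≤ 4 * 4 ^ 8 := by norm_num
      _ ≤ N * N ^ 8 := by gcongr
  have h2 : (2 : ℝ) / N ^ 24 ≤ 2 / N ^ 7 := by
    gcongr
    · linarith
    · norm_num
  have h3 : (20 : ℝ) / N ^ 8 * (2 * N + N) = 60 / N ^ 7 := by field_simp; norm_num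
  have h4 : (20 : ℝ) / N ^ 8 * (2 * N + 20 / N ^ 8) ≤ 20 / N ^ 8 * (2 * N + N) := by gcongr
  have h5 : (60 : ℝ) / N ^ 7 + 2 / N ^ 7 = 62 / N ^ 7 := by ring
  linarith

/-- The error after transforming the product, which is bounded by `N * N`. The total is at most `82
/ N ^ 5`, and `N ≥ 4` brings it below `1 / 4`. -/
theorem corr_error {N : ℝ} (hN : 4 ≤ N) :
    N ^ 2 * (62 / N ^ 7 + (2 * (N * (N * N)) * (9 / N ^ 11) + 2 / N ^ 24)) ≤ 1 / 4 := by
  have h0 : 0 < N := by linarith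
  have h1 : N ^ 2 * (2 / N ^ 24) ≤ 2 / N ^ 5 := by
    rw [mul_div_assoc', div_le_div_iff₀ (by positivity) (by positivity)]
    have : N ^ 7 ≤ N ^ 24 := pow_le_pow_right₀ (by linarith) (by norm_num)
    nlinarith
  have h2 : N ^ 2 * (2 * (N * (N * N)) * (9 / N ^ 11)) ≤ 18 / N ^ 5 := by
    rw [show N ^ 2 * (2 * (N * (N * N)) * (9 / N ^ 11)) = 18 / N ^ 6 by field_simp; norm_num]
    gcongr
    · linarith
    · norm_num
  have h3 : N ^ 2 * (62 / N ^ 7) = 62 / N ^ 5 := by field_simp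
  have h4 : (62 : ℝ) / N ^ 5 + (18 / N ^ 5 + 2 / N ^ 5) = 82 / N ^ 5 := by ring
  have h5 : (82 : ℝ) / N ^ 5 ≤ 82 / 4 ^ 5 := by gcongr
  rw [mul_add, mul_add, h3]
  norm_num at h5
  linarith

theorem FftReady.congr {N k : ℕ} {a' : Abs} (h : FftReady N k a)
    (e : ∀ r, 2 ≤ r → r ≤ 6 → a'.reg r = a.reg r) (e5 : a'.arr 5 = a.arr 5)
    (e6 : a'.arr 6 = a.arr 6) : FftReady N k a' :=
  ⟨h.regs.congr e, h.two_le, h.eq, fun x hx => by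
    have := h.tw x hx
    simpa only [twid, e5, e6] using this⟩

theorem FftReady.four_le {N k : ℕ} (h : FftReady N k a) : 4 ≤ N := by
  rw [h.eq]; exact Nat.pow_le_pow_right (n := 2) (by norm_num) h.two_le

theorem FftReady.two_dvd {N k : ℕ} (h : FftReady N k a) : 2 ∣ N := by
  rw [h.eq]; exact dvd_pow_self 2 (by have := h.two_le; omega)

/-- The Fourier transform with the chosen precision. -/
theorem FftReady.fft_runs {N k : ℕ} (h : FftReady N k a) (hW : n + m + 16 * N < 2 ^ w)
    (hQW : 2 * (N ^ 24) ^ 3 < 2 ^ w) {f : ℕ → ℂ} {e B e' : ℝ}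
    (hf : ∀ x, ‖f x‖ ≤ B) (ha : ∀ p < N, ‖dat (N ^ 24) a p - f p‖ ≤ e) (he : 0 ≤ e)
    (hB : B ≤ N * N)
    (he' : (N : ℝ) ^ 2 * (e + (2 * (N * B) * (9 / (N : ℝ) ^ 11) + 2 / (N : ℝ) ^ 24)) ≤ e')
    (he1 : e' ≤ 1) :
    Runs w I tape fft a (2 + k * (8 * N + 6)) (fun a' => ∀ p < N,
      ‖dat (N ^ 24) a' p - dft (rootU N) N f p‖ ≤ e') := by
  have hN4 := h.four_le
  have hN4R : (4 : ℝ) ≤ N := by exact_mod_cast hN4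
  have hZ : 8 * N ^ 4 ≤ N ^ 24 := by
    calc 8 * N ^ 4 ≤ 4 ^ 20 * N ^ 4 := Nat.mul_le_mul_right _ (by norm_num)
      _ ≤ N ^ 20 * N ^ 4 := Nat.mul_le_mul_right _ (Nat.pow_le_pow_left hN4 20)
      _ = N ^ 24 := by ring
  have hδ : 9 / (N : ℝ) ^ 11 ≤ 1 / 2 := by
    rw [div_le_div_iff₀ (by positivity) (by norm_num)]
    calc (9 : ℝ) * 2 ≤ 1 * 4 ^ 11 := by norm_num
      _ ≤ 1 * N ^ 11 := by gcongr
  refine (GPM.fft_runs (Z := N ^ 4) h.regs h.eq (by have := h.two_le; omega) hW (by positivity) hQW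
    (rootU_pow_half (by omega) h.two_dvd) (norm_rootU (by omega)) h.tw hδ hf ha he ?_ hZ).mono
    le_rfl fun a' h' p hp => (h' p hp).trans ?_
  · push_cast
    have h1 : (N : ℝ) * B ≤ N * (N * N) := by gcongr
    have h2 : (N : ℝ) * (N * N) + 1 ≤ N ^ 4 := by nlinarith [pow_pos (by linarith : (0 : ℝ) < N) 3]
    linarith
  · push_cast; exact he'

/-- By `dft_dft_mul` the result is `N` times the cross-correlation. The factor `N` is not divided
out, so the target values are `N` apart and an error of `1 / 4` is harmless. -/
theorem corrCmd_runs {N k : ℕ} (h : FftReady N k a) (hW : n + m + 16 * N < 2 ^ w)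
    (hQW : 2 * (N ^ 24) ^ 3 < 2 ^ w) {u v : ℕ → ℂ} (hu : ∀ x, ‖u x‖ ≤ 1) (hv : ∀ x, ‖v x‖ ≤ 1)
    (hp : ∀ p < N, ‖cval (N ^ 24 : ℕ) (a.arr 11 p) (a.arr 12 p) - dft (rootU N) N u p‖ ≤
      20 / (N : ℝ) ^ 8)
    (hd : ∀ p < N, dat (N ^ 24) a p = v ((N - p) % N)) :
    Runs w I tape corrCmd a (8 + 8 * N + 2 * (k * (8 * N + 6))) (fun a' => ∀ x < N,
      ‖dat (N ^ 24) a' x - N * ∑ j ∈ Finset.range N, u j * v ((x + j) % N)‖ ≤ 1 / 4) := by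
  have hN4 := h.four_le
  have hN4R : (4 : ℝ) ≤ N := by exact_mod_cast hN4
  have hω := norm_rootU (N := N) (by omega)
  have hu' : ∀ x, ‖dft (rootU N) N u x‖ ≤ N := fun x => by
    simpa using norm_dft_le hω hu N x
  have hv' : ∀ x, ‖dft (rootU N) N (fun z => v ((N - z) % N)) x‖ ≤ N := fun x => by
    simpa using norm_dft_le hω (B := 1) (f := fun z => v ((N - z) % N)) (fun z => hv _) N x
  have h20 : 20 / (N : ℝ) ^ 8 ≤ 1 := by
    rw [div_le_one (by positivity)]
    calc (20 : ℝ) ≤ 4 ^ 8 := by norm_num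
      _ ≤ N ^ 8 := by gcongr
  have hZ : 2 * (N + 1) ^ 2 ≤ N ^ 24 := by
    have h1 : 2 * (N + 1) ^ 2 ≤ N ^ 2 * N ^ 2 :=
      (show 2 * (N + 1) ^ 2 ≤ 8 * N ^ 2 by nlinarith).trans
        (Nat.mul_le_mul_right _ (by nlinarith))
    calc _ ≤ N ^ 2 * N ^ 2 := h1
      _ = N ^ 4 := by ring
      _ ≤ N ^ 24 := Nat.pow_le_pow_right (by omega) (by norm_num)
  have hbound : ∀ x y : ℤ, ∀ f : ℂ, ‖cval (N ^ 24 : ℕ) x y - f‖ ≤ 20 / (N : ℝ) ^ 8 → ‖f‖ ≤ N →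
      |x| ≤ (N + 1 : ℕ) * (N ^ 24 : ℕ) ∧ |y| ≤ (N + 1 : ℕ) * (N ^ 24 : ℕ) := fun x y f h1 h2 => by
    have h3 := norm_le_norm_add_norm_sub' (cval (N ^ 24 : ℕ) x y) f
    refine abs_le_of_norm_cval (Q := (N ^ 24 : ℕ)) (B := (N + 1 : ℕ))
      (by exact_mod_cast (show 0 < N ^ 24 by positivity)) ?_
    push_cast at *
    linarith
  refine Runs.mono (Runs.seq' (h.fft_runs hW hQW (e := 0) (B := 1) (e' := 20 / (N : ℝ) ^ 8)
    (f := fun z => v ((N - z) % N)) (fun z => hv _) (fun p hp => by rw [hd p hp]; simp) le_rfl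
    (by nlinarith) (pat_error hN4R) h20) fun a1 f1 q1 =>
    Runs.seq' (mulCmd_runs (N := N) (k := k) (Q := N ^ 24) (Z := N + 1) ?_ hW (by positivity) hQW
      (fun x hx => hbound _ _ _ (q1 x hx) (hv' x)) (fun x hx => ?_) hZ) fun a2 f2 q2 =>
    (FftReady.fft_runs (N := N) (k := k) (e := 62 / (N : ℝ) ^ 7) (B := N * N) (e' := 1 / 4)
      (f := fun y => dft (rootU N) N u y * dft (rootU N) N (fun z => v ((N - z) % N)) y)
      ?_ hW hQW ?_ ?_ (by positivity) le_rfl (corr_error hN4R) (by norm_num)).imp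
      fun a3 f3 q3 x hx => ?_)
    (show 2 + k * (8 * N + 6) + (4 + 8 * N + (2 + k * (8 * N + 6))) ≤ _ by omega) fun _ h => h
  · exact h.regs.congr fun r h h' => f1.reg r (by
      simp [Cmd.wr, fft, fftStage, copyBack]; omega)
  · rw [f1.arr 11 rfl, f1.arr 12 rfl]
    exact hbound _ _ _ (hp x hx) (hu' x)
  · exact h.congr (fun r h h' => (f2.reg r (by simp [Cmd.wr, mulCmd, copyBack]; omega)).trans
      (f1.reg r (by simp [Cmd.wr, fft, fftStage, copyBack]; omega)))
      ((f2.arr 5 rfl).trans (f1.arr 5 rfl)) ((f2.arr 6 rfl).trans (f1.arr 6 rfl))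
  · intro x
    rw [norm_mul]
    exact mul_le_mul (hu' x) (hv' x) (norm_nonneg _) (by positivity)
  · intro p hpN
    have e1 := q2 p hpN
    rw [f1.arr 11 rfl, f1.arr 12 rfl] at e1
    have e2 := mul_error (q1 p hpN) (hp p hpN) (hv' p) (hu' p)
    have e3 := prod_error hN4R
    have e4 := norm_add_le (dat (N ^ 24) a2 p -
      dat (N ^ 24) a1 p * cval (N ^ 24 : ℕ) (a.arr 11 p) (a.arr 12 p))
      (dat (N ^ 24) a1 p * cval (N ^ 24 : ℕ) (a.arr 11 p) (a.arr 12 p) -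
        dft (rootU N) N (fun z => v ((N - z) % N)) p * dft (rootU N) N u p)
    rw [sub_add_sub_cancel] at e4
    rw [mul_comm (dft (rootU N) N u p)]
    push_cast at *
    linarith
  · have := q3 x hx
    rwa [dft_dft_mul (isPrimitiveRoot_rootU (by omega))] at this

/-- Adding half of the divisor `N * Q` before rounding down yields the nearest integer; the
deviation `Q / 4` is well below that half. -/
theorem round_eq {N Q : ℕ} {c re : ℤ} (h2 : 2 ∣ N) (hN : 4 ≤ N) (hQ : 0 < Q)
    (h : |(re : ℝ) / (Q : ℕ) - N * c| ≤ 1 / 4) :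
    (re + (N / 2 : ℕ) * Q) / (N * Q) = c ∧ 4 * |re - N * c * Q| ≤ Q := by
  obtain ⟨l, rfl⟩ := h2
  have hQ' : (0 : ℝ) < Q := by exact_mod_cast hQ
  have hQZ : (0 : ℤ) < Q := by exact_mod_cast hQ
  have h4 : 4 * |re - (2 * l : ℕ) * c * Q| ≤ Q := by
    have h3 : |(re : ℝ) - (2 * l : ℕ) * c * Q| ≤ 1 / 4 * Q := by
      rw [show (re : ℝ) - (2 * l : ℕ) * c * Q = (re / Q - (2 * l : ℕ) * c) * Q by field_simp,
        abs_mul, abs_of_pos hQ']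
      exact mul_le_mul_of_nonneg_right h hQ'.le
    have h5 : 4 * |(re : ℝ) - (2 * l : ℕ) * c * Q| ≤ Q := by linarith
    exact_mod_cast h5
  refine ⟨?_, h4⟩
  rw [Nat.mul_div_cancel_left _ (by norm_num)]
  push_cast at *
  have h6 := abs_le.1 (show |re - 2 * (l : ℤ) * c * Q| ≤ Q / 4 by omega)
  have hl : (2 : ℤ) ≤ l := by omega
  have hlQ : 2 * (Q : ℤ) ≤ l * Q := mul_le_mul_of_nonneg_right hl hQZ.le
  rw [show re + (l : ℤ) * Q = (re - 2 * l * c * Q + l * Q) + c * (2 * l * Q) by ring,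
    Int.add_mul_ediv_right _ _ (by positivity),
    Int.ediv_eq_zero_of_lt (by omega) (by rw [show 2 * (l : ℤ) * Q = l * Q + l * Q by ring]; omega),
    zero_add]

end

/-! ### Match counts for a single hash value -/

section
variable {n m σT σP : ℕ} {w : ℕ} {I : Input n m σT σP} {tape : ℕ → ℕ} {a : Abs}

/-- The number of positions `j` of the pattern with hash value `β` such that the set of the hash
values of the neighbours of the text character at `i + j` contains `β`; the hash values of the
pattern are given by `hp`, the sets by `χ`. -/
def cntAt (m : ℕ) (hp : ℕ → ℕ) (χ : ℕ → ℕ → ℕ) (β i : ℕ) : ℕ :=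
  ∑ j ∈ Finset.range m, if hp j = β then χ (i + j) β else 0

/-- The indicator function of the positions of the pattern with the hash value in the variable `21`. -/
def loadPat : Cmd :=
  .loop 26 (.var 2) (.sto 1 (.var 26) (.var 5 * ((Ex.var 26).lt (.var 1) *
    (Ex.rd 7 (.rd 0 (.var 0 + .var 26 % .var 1))).eq (.var 21)))) ;;
  .loop 26 (.var 2) (.sto 2 (.var 26) (.lit 0))

/-- The transform of the indicator function, in `11, 12`. -/
def patCmd : Cmd :=
  loadPat ;; fft ;; .loop 26 (.var 2) (.sto 11 (.var 26) (.rd 1 (.var 26))) ;;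
  .loop 26 (.var 2) (.sto 12 (.var 26) (.rd 2 (.var 26)))

/-- The state in the main loop: `0`, `1` hold the lengths of the text and of the pattern, `8` holds
the number `B` of hash values; the array `7` holds the hash function. -/
structure MainCtx (n m N k B w : ℕ) (hp : ℕ → ℕ) (a : Abs) : Prop where
  ready : FftReady N k a
  r0 : a.reg 0 = n
  r1 : a.reg 1 = m
  r8 : a.reg 8 = B
  m_pos : 1 ≤ m
  B_pos : 1 ≤ B
  le : 2 * m ≤ N
  hash : ∀ j < m, AddrOk (n + m) w 7 (a.arr 0 (n + j)) ∧
    a.arr 7 (a.arr 0 (n + j)).toNat = hp j ∧ hp j < B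
  hW : n + m + 16 * ((n + 2 * N) * B) < 2 ^ w
  hQW : 2 * (N ^ 24) ^ 3 < 2 ^ w

theorem MainCtx.congr {N k B : ℕ} {hp : ℕ → ℕ} {a' : Abs} (h : MainCtx n m N k B w hp a)
    (e : ∀ r, r ≤ 8 → a'.reg r = a.reg r) (e0 : a'.arr 0 = a.arr 0) (e7 : a'.arr 7 = a.arr 7)
    (e5 : a'.arr 5 = a.arr 5) (e6 : a'.arr 6 = a.arr 6) : MainCtx n m N k B w hp a' :=
  ⟨h.ready.congr (fun r _ h => e r (by omega)) e5 e6, by rw [e 0 (by norm_num), h.r0],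
    by rw [e 1 (by norm_num), h.r1], by rw [e 8 (by norm_num), h.r8], h.m_pos, h.B_pos, h.le,
    by rw [e0, e7]; exact h.hash, h.hW, h.hQW⟩

theorem MainCtx.bounds {N k B : ℕ} {hp : ℕ → ℕ} (h : MainCtx n m N k B w hp a) :
    n + m + 16 * N < 2 ^ w ∧ N < 2 ^ w ∧ B < 2 ^ w ∧ 16 * (n + 2 * N) < 2 ^ w := by
  have h1 := h.hW
  have h2 := h.B_pos
  have h3 := h.ready.four_le
  have h4 : (n + 2 * N) * 1 ≤ (n + 2 * N) * B := Nat.mul_le_mul_left _ h2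
  have h5 : 1 * B ≤ (n + 2 * N) * B := Nat.mul_le_mul_right _ (by omega)
  omega

/-- The transform of the pattern depends only on `β`; it is computed once and kept in the arrays
`11` and `12` for all blocks of the text. -/
theorem patCmd_runs {N k B β : ℕ} {hp : ℕ → ℕ} (h : MainCtx n m N k B w hp a)
    (h21 : a.reg 21 = β) (hβ : β < B) :
    Runs w I tape patCmd a (6 + 8 * N + k * (8 * N + 6)) (fun a' => ∀ p < N,
      ‖cval (N ^ 24 : ℕ) (a'.arr 11 p) (a'.arr 12 p) -
        dft (rootU N) N (fun j => if j < m ∧ hp j = β then 1 else 0) p‖ ≤ 20 / (N : ℝ) ^ 8) := by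
  obtain ⟨hW, hN, hB, -⟩ := h.bounds
  have hN4 := h.ready.four_le
  have hN4R : (4 : ℝ) ≤ N := by exact_mod_cast hN4
  have had : ∀ id, id ≠ 0 → id < 16 → ∀ x < N, AddrOk (n + m) w id x := fun id h h' x hx =>
    addrOk_of_lt h h' hx hW
  have hm1 := h.m_pos
  have h20 : 20 / (N : ℝ) ^ 8 ≤ 1 := by
    rw [div_le_one (by positivity)]
    calc (20 : ℝ) ≤ 4 ^ 8 := by norm_num
      _ ≤ N ^ 8 := by gcongr
  refine Runs.mono (Runs.seq' (Q' := fun a1 => (∀ p < N, a1.arr 1 p =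
      if p < m ∧ hp p = β then ((N ^ 24 : ℕ) : ℤ) else 0) ∧ ∀ p < N, a1.arr 2 p = 0)
      (T := 2 + 4 * N) ?_ fun a1 f1 q1 => Runs.seq' (FftReady.fft_runs (N := N) (k := k) (e := 0)
      (B := 1) (e' := 20 / (N : ℝ) ^ 8) (f := fun j => if j < m ∧ hp j = β then 1 else 0)
      ?_ hW h.hQW (fun x => by split_ifs <;> simp) (fun p hpN => ?_) le_rfl (by nlinarith)
      (pat_error hN4R) h20) fun a2 f2 q2 =>
    Runs.seq' (Runs.map (i := 26) N (a2.arr 1) (Ex.ok_var _ _ _ _) ?_ hN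
      (had 11 (by norm_num) (by norm_num)) fun p hp a' h1 h2 h3 h4 => ?_) fun a3 f3 q3 =>
    (Runs.map (i := 26) N (a2.arr 2) (Ex.ok_var _ _ _ _) ?_ hN
      (had 12 (by norm_num) (by norm_num)) fun p hp a' h1 h2 h3 h4 => ?_).imp fun a4 f4 q4 p hpN => ?_)
    (show 2 + 4 * N + (2 + k * (8 * N + 6) + (1 + N * 2 + (1 + N * 2))) ≤ _ by omega)
    fun _ h => h
  · refine Runs.mono (Runs.seq' (Runs.map (i := 26) N
      (fun p => if p < m ∧ hp p = β then ((N ^ 24 : ℕ) : ℤ) else 0) trivial h.ready.regs.r2 hN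
      (had 1 (by norm_num) (by norm_num)) fun p hpN a' h1 h2 h3 h4 => ?_) fun a1 f1 q1 =>
      (Runs.map (i := 26) N (fun _ => 0) (Ex.ok_var _ _ _ _) ((f1.reg 2 rfl).trans h.ready.regs.r2)
      hN (had 2 (by norm_num) (by norm_num)) fun p hp a' h1 h2 h3 h4 => ⟨Ex.ok_lit _ _ _ _, rfl⟩).imp
      fun a2 f2 q2 => ⟨fun p hp => by rw [f2.arr 1 rfl]; exact q1.1 p hp, q2.1⟩)
      (by omega) fun _ h => h
    -- Reducing the index modulo `m` keeps the access inside the pattern also for `p ≥ m`, where the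
    -- factor testing `p < m` discards the value.
    have hpm : p % m < m := Nat.mod_lt _ (by omega)
    obtain ⟨k1, k2, k3⟩ := h.hash (p % m) hpm
    have e0 : (a'.reg 0 + a'.reg 26 % a'.reg 1) = (n + p % m : ℕ) := by
      rw [h1, h2 0 (by norm_num), h2 1 (by norm_num), h.r0, h.r1]; push_cast; rfl
    have i1 : InR w (p : ℤ) := inR_natCast (by omega)
    have i2 : InR w (m : ℤ) := inR_natCast (by omega)
    have i3 : InR w (hp (p % m) : ℤ) := inR_natCast (by omega)
    have i4 : InR w (β : ℤ) := inR_natCast (by omega)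
    have e1 : (Ex.rd 0 (.var 0 + .var 26 % .var 1)).ev I a' = a.arr 0 (n + p % m) := by
      simp only [Ex.ev_rd, Ex.ev_add, Ex.ev_mod, Ex.ev_var, e0, h3 0 (by norm_num),
        Int.toNat_natCast]
    have e2 : (Ex.rd 7 (Ex.rd 0 (.var 0 + .var 26 % .var 1))).ev I a' = hp (p % m) := by
      rw [Ex.ev_rd, e1, h3 7 (by norm_num), k2]
    have e3 : a'.reg 21 = β := (h2 21 (by norm_num)).trans h21
    have e4 : a'.reg 1 = m := (h2 1 (by norm_num)).trans h.r1
    have e5 : a'.reg 5 = (N ^ 24 : ℕ) := (h2 5 (by norm_num)).trans h.ready.regs.r5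
    constructor
    · have hadr : AddrOk (n + m) w 0 ((.var 0 + .var 26 % .var 1 : Ex).ev I a') := by
        rw [Ex.ev_add, Ex.ev_mod, Ex.ev_var, Ex.ev_var, Ex.ev_var, e0]
        exact addrOk_zero (by omega)
      simp only [Ex.ok_mul, Ex.ok_lt, Ex.ok_eq, Ex.ok_var, Ex.ok_rd, Ex.ok_add, Ex.ok_mod, e1, e2,
        hadr, Ex.ev_var, h1, e3, e4, i1, i2, i3, i4, and_true, k1]
    · simp only [Ex.ev_mul, Ex.ev_lt, Ex.ev_eq, e2, Ex.ev_var, e3, h1, e4, e5]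
      norm_cast
      by_cases hlt : p < m
      · rw [Nat.mod_eq_of_lt hlt]
        by_cases hb : hp p = β <;> simp [hlt, hb]
      · simp [hlt]
  · exact h.ready.congr (fun r h h' => f1.reg r (by simp [Cmd.wr, loadPat]; omega))
      (f1.arr 5 rfl) (f1.arr 6 rfl)
  · rw [dat, q1.1 p hpN, q1.2 p hpN]
    have hQ : ((N ^ 24 : ℕ) : ℝ) ≠ 0 := by positivity
    split_ifs
    · rw [show cval (N ^ 24 : ℕ) ((N ^ 24 : ℕ) : ℤ) 0 = 1 by
        apply Complex.ext
        · simp only [cval, Int.cast_natCast, Complex.one_re]; exact div_self hQ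
        · simp [cval]]
      simp
    · rw [show cval (N ^ 24 : ℕ) 0 0 = 0 by apply Complex.ext <;> simp [cval]]
      simp
  · exact ((f2.reg 2 rfl).trans (f1.reg 2 rfl)).trans h.ready.regs.r2
  · rw [Ex.ok_rd, Ex.ev_rd, Ex.ev_var, h1, h3 1 (by norm_num)]
    exact ⟨⟨trivial, had 1 (by norm_num) (by norm_num) p hp⟩, rfl⟩
  · exact ((f3.reg 2 rfl).trans ((f2.reg 2 rfl).trans (f1.reg 2 rfl))).trans h.ready.regs.r2
  · rw [Ex.ok_rd, Ex.ev_rd, Ex.ev_var, h1, h3 2 (by norm_num), f3.arr 2 rfl]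
    exact ⟨⟨trivial, had 2 (by norm_num) (by norm_num) p hp⟩, rfl⟩
  · rw [f4.arr 11 rfl, q3.1 p hpN, q4.1 p hpN]
    exact q2 p hpN

/-- Add the numbers of matches with the hash value in the variable `21` of the positions in the
block whose number is in `22`. -/
def blockCmd : Cmd :=
  .loop 26 (.var 2) (.sto 1 (.var 26) (.var 5 *
    .rd 8 ((.var 22 * .var 4 + (.var 2 - .var 26) % .var 2) * .var 8 + .var 21))) ;;
  .loop 26 (.var 2) (.sto 2 (.var 26) (.lit 0)) ;;
  corrCmd ;;
  .loop 23 (.var 4) (.sto 9 (.var 22 * .var 4 + .var 23) (.rd 9 (.var 22 * .var 4 + .var 23) +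
    (.rd 1 (.var 23) + .var 4 * .var 5) / (.var 2 * .var 5)))

/-- For `x < N / 2` and `j < m ≤ N / 2` the index `x + j` does not wrap around, so the first half of
a cyclic correlation consists of true counts. This is why consecutive windows of length `N` are
shifted by `N / 2` only. -/
theorem sum_window {N s x β : ℕ} {hp : ℕ → ℕ} {χ : ℕ → ℕ → ℕ} (hm : 2 * m ≤ N) (hx : x < N / 2) :
    ∑ j ∈ Finset.range N, (if j < m ∧ hp j = β then (1 : ℂ) else 0) *
      (χ (s * (N / 2) + (x + j) % N) β : ℂ) = cntAt m hp χ β (s * (N / 2) + x) := by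
  rw [cntAt, Nat.cast_sum]
  symm
  refine Finset.sum_subset_zero_on_sdiff (Finset.range_subset_range.2 (by omega)) ?_ ?_
  · intro j hj
    simp only [Finset.mem_sdiff, Finset.mem_range] at hj
    rw [if_neg (by tauto), zero_mul]
  · intro j hj
    have hj := Finset.mem_range.1 hj
    rw [Nat.mod_eq_of_lt (by omega), add_assoc]
    by_cases hb : hp j = β <;> simp [hb, hj]

theorem cntAt_le {hp : ℕ → ℕ} {χ : ℕ → ℕ → ℕ} (hχ : ∀ i β, χ i β ≤ 1) (β i : ℕ) :
    cntAt m hp χ β i ≤ m := by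
  refine (Finset.sum_le_card_nsmul _ _ 1 fun j _ => ?_).trans (by simp)
  split_ifs
  · exact hχ _ _
  · exact Nat.zero_le _

/-- The approximation of a count of 0 may be slightly negative. The summand that serves for rounding
also makes the numerator non-negative, as the unsigned division requires. -/
theorem round_inR {N c : ℕ} {re : ℤ} (hN4 : 4 ≤ N) (hc : c ≤ N) (hQW : 2 * (N ^ 24) ^ 3 < 2 ^ w)
    (hr : |re - N * c * (N ^ 24 : ℕ)| ≤ (N ^ 24 : ℕ) / 4) :
    InR w (re + (N / 2 : ℕ) * (N ^ 24 : ℕ)) ∧ InR w ((N * N ^ 24 : ℕ) : ℤ) := by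
  have hQ0 : 0 < N ^ 24 := by positivity
  have hQN : N ^ 3 ≤ N ^ 24 := Nat.pow_le_pow_right (by omega) (by norm_num)
  generalize N ^ 24 = Q at *
  have hN3 : N * N + 2 * N ≤ N ^ 3 := by nlinarith [Nat.mul_le_mul_left N hN4]
  have hQ3 : Q * Q ≤ Q ^ 3 := by
    rw [pow_succ Q 2, sq]
    exact Nat.le_mul_of_pos_right _ hQ0
  have hbig : (N * N + 2 * N) * Q < 2 ^ w :=
    lt_of_le_of_lt ((Nat.mul_le_mul_right _ (hN3.trans hQN)).trans hQ3) (by omega)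
  have r3 := abs_le.1 hr
  have t0 : N * c * Q ≤ N * N * Q := by gcongr
  have t1 : 1 * Q ≤ N / 2 * Q := Nat.mul_le_mul_right _ (by omega)
  have t2 : N / 2 * Q ≤ N * Q := Nat.mul_le_mul_right _ (by omega)
  have t3 : 1 * Q ≤ N * Q := Nat.mul_le_mul_right _ (by omega)
  have t4 : (N * N + 2 * N) * Q = N * N * Q + 2 * (N * Q) := by ring
  have e1 : (N : ℤ) * c * Q = (N * c * Q : ℕ) := by push_cast; rfl
  have e2 : ((N / 2 : ℕ) : ℤ) * Q = (N / 2 * Q : ℕ) := by push_cast; rfl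
  rw [e1] at r3
  rw [e2]
  refine ⟨⟨by omega, ?_⟩, inR_natCast (by omega)⟩
  have : ((2 ^ w : ℕ) : ℤ) = 2 ^ w := by push_cast; rfl
  rw [← this]
  omega

/-- The last window may reach beyond the end of the text, so `χ` and the array `8` are considered at
all positions, and the word size leaves room for `2 * N` extra ones. The data are loaded in the
reflected order that `corrCmd_runs` expects. -/
theorem blockCmd_runs {N k B β s : ℕ} {hp : ℕ → ℕ} {χ : ℕ → ℕ → ℕ}
    (h : MainCtx n m N k B w hp a) (h21 : a.reg 21 = β) (hβ : β < B) (h22 : a.reg 22 = s)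
    (hs : s * (N / 2) ≤ n)
    (hpat : ∀ p < N, ‖cval (N ^ 24 : ℕ) (a.arr 11 p) (a.arr 12 p) -
        dft (rootU N) N (fun j => if j < m ∧ hp j = β then 1 else 0) p‖ ≤ 20 / (N : ℝ) ^ 8)
    (hχ : ∀ i β, χ i β ≤ 1) (h8 : ∀ i, a.arr 8 (i * B + β) = χ i β) :
    Runs w I tape blockCmd a (11 + 13 * N + 2 * (k * (8 * N + 6))) (fun a' =>
      (∀ p < N / 2, a'.arr 9 (s * (N / 2) + p) =
        a.arr 9 (s * (N / 2) + p) + cntAt m hp χ β (s * (N / 2) + p)) ∧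
      (∀ x, x < s * (N / 2) ∨ s * (N / 2) + N / 2 ≤ x → a'.arr 9 x = a.arr 9 x)) := by
  obtain ⟨hW, hN, hB, hW2⟩ := h.bounds
  have hN4 := h.ready.four_le
  have h2m := h.le
  have hr := h.ready.regs
  have had : ∀ id, id ≠ 0 → id < 16 → ∀ x < N, AddrOk (n + m) w id x := fun id h h' x hx =>
    addrOk_of_lt h h' hx hW
  have had9 : ∀ p < N / 2, AddrOk (n + m) w 9 (s * (N / 2) + p : ℕ) := fun p hp =>
    addrOk_of_lt (L := (n + 2 * N) * B) (by norm_num) (by norm_num) (by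
      have : (n + 2 * N) * 1 ≤ (n + 2 * N) * B := Nat.mul_le_mul_left _ h.B_pos
      omega) h.hW
  refine Runs.mono (Runs.seq' (Runs.map (i := 26) N (fun p => ((N ^ 24 : ℕ) : ℤ) *
      χ (s * (N / 2) + (N - p) % N) β) trivial hr.r2 hN (had 1 (by norm_num) (by norm_num))
      fun p hpN a' h1 h2 h3 h4 => ?_) fun a1 f1 q1 =>
    Runs.seq' (Runs.map (i := 26) N (fun _ => 0) (Ex.ok_var _ _ _ _) ((f1.reg 2 rfl).trans hr.r2)
      hN (had 2 (by norm_num) (by norm_num)) fun p hp a' h1 h2 h3 h4 => ⟨Ex.ok_lit _ _ _ _, rfl⟩)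
      fun a2 f2 q2 => Runs.seq' (corrCmd_runs (N := N) (k := k)
        (u := fun j => if j < m ∧ hp j = β then 1 else 0)
        (v := fun z => (χ (s * (N / 2) + z) β : ℂ)) ?_ hW h.hQW
        (fun x => by split_ifs <;> simp) (fun x => ?_) ?_ ?_) fun a3 f3 q3 =>
      (Runs.mapAt (i := 23) (N / 2) (s * (N / 2)) (fun p => a.arr 9 (s * (N / 2) + p) +
        cntAt m hp χ β (s * (N / 2) + p)) (Ex.ok_var _ _ _ _) ?_ (by omega) had9
        fun p hpN a' h1 h2 h3 h4 => ?_).imp fun a4 f4 q4 =>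
          ⟨q4.1, fun x hx => (q4.2 x hx).trans ?_⟩)
    (show 1 + N * 2 + (1 + N * 2 + (8 + 8 * N + 2 * (k * (8 * N + 6)) + (1 + N / 2 * 2))) ≤ _ by
      omega) fun _ h => h
  · have e22 : a'.reg 22 = s := (h2 22 (by norm_num)).trans h22
    have e4 : a'.reg 4 = (N / 2 : ℕ) := (h2 4 (by norm_num)).trans hr.r4
    have e2 : a'.reg 2 = N := (h2 2 (by norm_num)).trans hr.r2
    have e8 : a'.reg 8 = B := (h2 8 (by norm_num)).trans h.r8
    have e21 : a'.reg 21 = β := (h2 21 (by norm_num)).trans h21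
    have e5 : a'.reg 5 = (N ^ 24 : ℕ) := (h2 5 (by norm_num)).trans hr.r5
    have hmod : (N - p) % N < N := Nat.mod_lt _ (by omega)
    have es : (N : ℤ) - p = (N - p : ℕ) := by rw [Nat.cast_sub hpN.le]
    have e : ((.var 22 * .var 4 + (.var 2 - .var 26) % .var 2) * .var 8 + .var 21 : Ex).ev I a' =
        ((s * (N / 2) + (N - p) % N) * B + β : ℕ) := by
      simp only [Ex.ev_add, Ex.ev_mul, Ex.ev_sub, Ex.ev_mod, Ex.ev_var, e22, e4, e2, e8, e21, h1, es]
      push_cast; rfl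
    constructor
    · rw [Ex.ok_mul, Ex.ok_rd, e]
      refine ⟨trivial, ?_, addrOk_of_lt (L := (n + 2 * N) * B) (by norm_num) (by norm_num) ?_ h.hW⟩
      · simp only [Ex.ok_add, Ex.ok_mul, Ex.ok_mod, Ex.ok_sub, Ex.ok_var, Ex.ev_sub, Ex.ev_var, e2,
          h1, es, true_and, and_true]
        exact ⟨inR_natCast (by omega), inR_natCast hN⟩
      · have : (s * (N / 2) + (N - p) % N + 1) * B ≤ (n + 2 * N) * B :=
          Nat.mul_le_mul_right _ (by omega)
        rw [add_mul, one_mul] at this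
        omega
    · rw [Ex.ev_mul, Ex.ev_rd, e, Ex.ev_var, e5, Int.toNat_natCast, h3 8 (by norm_num), h8]
  · exact h.ready.congr (fun r _ _ => (f2.reg r (by simp [Cmd.wr]; omega)).trans
      (f1.reg r (by simp [Cmd.wr]; omega))) ((f2.arr 5 rfl).trans (f1.arr 5 rfl))
      ((f2.arr 6 rfl).trans (f1.arr 6 rfl))
  · rw [Complex.norm_natCast]; exact_mod_cast hχ _ _
  · rw [f2.arr 11 rfl, f1.arr 11 rfl, f2.arr 12 rfl, f1.arr 12 rfl]
    exact hpat
  · intro p hpN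
    have hQ : ((N ^ 24 : ℕ) : ℝ) ≠ 0 := by positivity
    rw [dat, f2.arr 1 rfl, q1.1 p hpN, q2.1 p hpN]
    apply Complex.ext
    · simp only [cval, Complex.natCast_re, Int.cast_mul, Int.cast_natCast]
      field_simp
    · simp [cval]
  · exact ((f3.reg 4 rfl).trans ((f2.reg 4 rfl).trans (f1.reg 4 rfl))).trans hr.r4
  · have hreg : ∀ r, r ≤ 22 → 21 ≤ r ∨ r ≤ 8 → a'.reg r = a.reg r := fun r hr1 hr2 =>
      (h2 r (by omega)).trans ((f3.reg r (by
        simp [Cmd.wr, corrCmd, mulCmd, fft, fftStage, copyBack]; omega)).trans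
        ((f2.reg r (by simp [Cmd.wr]; omega)).trans (f1.reg r (by simp [Cmd.wr]; omega))))
    have e22 : a'.reg 22 = s := (hreg 22 (by norm_num) (by norm_num)).trans h22
    have e4 : a'.reg 4 = (N / 2 : ℕ) := (hreg 4 (by norm_num) (by norm_num)).trans hr.r4
    have e2 : a'.reg 2 = N := (hreg 2 (by norm_num) (by norm_num)).trans hr.r2
    have e5 : a'.reg 5 = (N ^ 24 : ℕ) := (hreg 5 (by norm_num) (by norm_num)).trans hr.r5
    have e9 : a'.arr 9 (s * (N / 2) + p) = a.arr 9 (s * (N / 2) + p) := by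
      rw [h4 _ le_rfl, f3.arr 9 rfl, f2.arr 9 rfl, f1.arr 9 rfl]
    have ex : (.var 22 * .var 4 + .var 23 : Ex).ev I a' = (s * (N / 2) + p : ℕ) := by
      simp only [Ex.ev_add, Ex.ev_mul, Ex.ev_var, e22, e4, h1]; push_cast; rfl
    have q := q3 p (by omega)
    rw [sum_window h2m hpN] at q
    set c := cntAt m hp χ β (s * (N / 2) + p) with hc
    have hcm : c ≤ m := cntAt_le hχ _ _
    have q' := (Complex.abs_re_le_norm _).trans q
    have hre : (dat (N ^ 24) a3 p - (N : ℂ) * (c : ℂ)).re =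
        (a3.arr 1 p : ℝ) / (N ^ 24 : ℕ) - N * ((c : ℕ) : ℤ) := by
      have : ((N : ℂ) * (c : ℂ)).re = N * c := by
        rw [← Nat.cast_mul, Complex.natCast_re]; push_cast; rfl
      rw [Complex.sub_re, this, dat, cval]
      simp
    rw [hre] at q'
    obtain ⟨r1, r2⟩ := round_eq h.ready.two_dvd hN4 (by positivity) q'
    have e1 : a'.arr 1 p = a3.arr 1 p := by rw [h3 1 (by norm_num)]
    have hnum : (.rd 1 (.var 23) + .var 4 * .var 5 : Ex).ev I a' =
        a3.arr 1 p + (N / 2 : ℕ) * (N ^ 24 : ℕ) := by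
      simp only [Ex.ev_add, Ex.ev_rd, Ex.ev_mul, Ex.ev_var, h1, e4, e5, Int.toNat_natCast, e1]
    have hden : (.var 2 * .var 5 : Ex).ev I a' = (N * N ^ 24 : ℕ) := by
      simp only [Ex.ev_mul, Ex.ev_var, e2, e5]; push_cast; rfl
    refine ⟨by simp, ex, ?_, ?_⟩
    · rw [Ex.ok_add, Ex.ok_rd, Ex.ok_div, ex, hnum, hden]
      obtain ⟨i1, i2⟩ := round_inR hN4 (show c ≤ N by omega) h.hQW
        (show |a3.arr 1 p - N * c * (N ^ 24 : ℕ)| ≤ (N ^ 24 : ℕ) / 4 by omega)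
      have ha1 : AddrOk (n + m) w 1 ((Ex.var 23).ev I a') := by
        rw [Ex.ev_var, h1]; exact had 1 (by norm_num) (by norm_num) p (by omega)
      exact ⟨⟨by simp, had9 p hpN⟩, ⟨⟨trivial, ha1⟩, ⟨trivial, trivial, trivial⟩, trivial⟩, ⟨trivial, trivial, trivial⟩, i1, i2⟩
    · rw [Ex.ev_add, Ex.ev_rd, Ex.ev_div, ex, hnum, hden, Int.toNat_natCast, e9, ← r1]
      push_cast; rfl
  · rw [f3.arr 9 rfl, f2.arr 9 rfl, f1.arr 9 rfl]

end

/-! ### Summation over all blocks and all hash values -/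

section
variable {n m σT σP : ℕ} {w : ℕ} {I : Input n m σT σP} {tape : ℕ → ℕ} {a : Abs}

/-- Add the numbers of matches with the hash value in the variable `21` to the array `9`. -/
def blocksCmd : Cmd := .loop 22 (.var 0 / .var 4 + .lit 1) blockCmd

/-- Add the numbers of matches to the array `9`. -/
def countCmd : Cmd := .loop 21 (.var 8) (patCmd ;; blocksCmd)

theorem blocksCmd_runs {N k B β : ℕ} {hp : ℕ → ℕ} {χ : ℕ → ℕ → ℕ}
    (h : MainCtx n m N k B w hp a) (h21 : a.reg 21 = β) (hβ : β < B)
    (hpat : ∀ p < N, ‖cval (N ^ 24 : ℕ) (a.arr 11 p) (a.arr 12 p) -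
        dft (rootU N) N (fun j => if j < m ∧ hp j = β then 1 else 0) p‖ ≤ 20 / (N : ℝ) ^ 8)
    (hχ : ∀ i β, χ i β ≤ 1) (h8 : ∀ i, a.arr 8 (i * B + β) = χ i β) :
    Runs w I tape blocksCmd a (1 + (n / (N / 2) + 1) * (12 + 13 * N + 2 * (k * (8 * N + 6))))
      (fun a' => ∀ x ≤ n, a'.arr 9 x = a.arr 9 x + cntAt m hp χ β x) := by
  obtain ⟨hW, hN, -, -⟩ := h.bounds
  have hN4 := h.ready.four_le
  have hr := h.ready.regs
  have hdiv : n / (N / 2) ≤ n := Nat.div_le_self _ _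
  refine Runs.mono (Runs.loop (T := 11 + 13 * N + 2 * (k * (8 * N + 6))) (n / (N / 2) + 1)
    (fun s a' => ∀ x, a'.arr 9 x = a.arr 9 x + if x < s * (N / 2) then cntAt m hp χ β x else 0)
    ?_ ?_ (by omega) rfl (by simp) fun s hs a' h22 f hJ => ?_) (by gcongr 1 + _ * ?_; omega)
    fun a' hJ x hx => ?_
  · rw [Ex.ok_add, Ex.ok_div, Ex.ev_var, Ex.ev_var, h.r0, hr.r4]
    exact ⟨⟨trivial, trivial, inR_natCast (by omega), inR_natCast (by omega)⟩, trivial⟩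
  · rw [Ex.ev_add, Ex.ev_div, Ex.ev_var, Ex.ev_var, Ex.ev_lit, h.r0, hr.r4]
    push_cast; rfl
  · have hctx : MainCtx n m N k B w hp a' := h.congr (fun r hr => f.reg r (by
      interval_cases r <;> rfl)) (f.arr 0 rfl) (f.arr 7 rfl) (f.arr 5 rfl) (f.arr 6 rfl)
    have hsn : s * (N / 2) ≤ n := (Nat.mul_le_mul_right _ (show s ≤ n / (N / 2) by omega)).trans
      (Nat.div_mul_le_self _ _)
    refine (blockCmd_runs hctx ((f.reg 21 rfl).trans h21) hβ h22 hsn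
      (by rw [f.arr 11 rfl, f.arr 12 rfl]; exact hpat) hχ (by rw [f.arr 8 rfl]; exact h8)).imp
      fun a'' _ q x => ?_
    rw [Abs.set_arr, add_mul, one_mul]
    rcases Nat.lt_or_ge x (s * (N / 2)) with hx | hx
    · rw [q.2 x (Or.inl hx), hJ x, if_pos hx, if_pos (by omega)]
    · rcases Nat.lt_or_ge x (s * (N / 2) + N / 2) with hx' | hx'
      · obtain ⟨p, rfl⟩ := Nat.exists_eq_add_of_le hx
        rw [q.1 p (by omega), hJ, if_neg (by omega), if_pos hx', Nat.cast_zero, add_zero]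
      · rw [q.2 x (Or.inr hx'), hJ x, if_neg (by omega), if_neg (by omega)]
  · rw [hJ x, if_pos]
    have := Nat.lt_div_mul_add (show 0 < N / 2 by omega) (a := n)
    rw [add_mul, one_mul]
    omega

/-- A position `j` of the pattern contributes only for `β = hp j`. -/
theorem sum_cntAt {hp : ℕ → ℕ} {χ : ℕ → ℕ → ℕ} {B i : ℕ} (hB : ∀ j < m, hp j < B) :
    ∑ β ∈ Finset.range B, cntAt m hp χ β i = ∑ j ∈ Finset.range m, χ (i + j) (hp j) := by
  simp only [cntAt]
  rw [Finset.sum_comm]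
  refine Finset.sum_congr rfl fun j hj => ?_
  rw [Finset.sum_ite_eq, if_pos (Finset.mem_range.2 (hB j (Finset.mem_range.1 hj)))]

/-- This turns the number of agreeing positions into a decision whether all of them agree. -/
theorem sum_eq_iff {f : ℕ → ℕ} (hf : ∀ j, f j ≤ 1) :
    ∑ j ∈ Finset.range m, f j = m ↔ ∀ j < m, f j = 1 := by
  have := Finset.sum_eq_sum_iff_of_le (s := Finset.range m) (f := f) (g := fun _ => 1)
    fun j _ => hf j
  simpa using this

/-- The time bound for `countCmd`. -/
def countTime (n N k B : ℕ) : ℕ :=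
  1 + B * (8 + 8 * N + k * (8 * N + 6) +
    (n / (N / 2) + 1) * (12 + 13 * N + 2 * (k * (8 * N + 6))))

theorem countCmd_runs {N k B : ℕ} {hp : ℕ → ℕ} {χ : ℕ → ℕ → ℕ}
    (h : MainCtx n m N k B w hp a)
    (hχ : ∀ i β, χ i β ≤ 1) (h8 : ∀ i, ∀ β < B, a.arr 8 (i * B + β) = χ i β)
    (h9 : ∀ x ≤ n, a.arr 9 x = 0) :
    Runs w I tape countCmd a (countTime n N k B)
      (fun a' => ∀ x ≤ n, a'.arr 9 x = (∑ j ∈ Finset.range m, χ (x + j) (hp j) : ℕ)) := by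
  obtain ⟨hW, hN, hB, -⟩ := h.bounds
  refine Runs.mono (Runs.loop (T := 7 + 8 * N + k * (8 * N + 6) +
    (n / (N / 2) + 1) * (12 + 13 * N + 2 * (k * (8 * N + 6)))) B
    (fun b a' => ∀ x ≤ n, a'.arr 9 x = (∑ β ∈ Finset.range b, cntAt m hp χ β x : ℕ))
    (Ex.ok_var _ _ _ _) h.r8 hB rfl (by simpa using h9) fun β hβ a' h21 f hJ => ?_)
    (by rw [countTime]; gcongr 1 + B * ?_; omega)
    fun a' hJ x hx => ?_
  · have hctx : MainCtx n m N k B w hp a' := h.congr (fun r hr => f.reg r (by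
      interval_cases r <;> rfl)) (f.arr 0 rfl) (f.arr 7 rfl) (f.arr 5 rfl) (f.arr 6 rfl)
    refine Runs.mono (Runs.seq' (patCmd_runs hctx h21 hβ) fun a1 f1 q1 =>
      (blocksCmd_runs (N := N) (k := k) (β := β) (χ := χ) ?_ ((f1.reg 21 rfl).trans h21) hβ q1 hχ ?_).imp
      fun a2 f2 q2 x hx => ?_) (by omega) fun _ h => h
    · exact hctx.congr (fun r hr => f1.reg r (by
        interval_cases r <;> rfl)) (f1.arr 0 rfl) (f1.arr 7 rfl) (f1.arr 5 rfl) (f1.arr 6 rfl)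
    · intro i
      rw [f1.arr 8 rfl, f.arr 8 rfl, h8 i β hβ]
    · rw [Abs.set_arr, q2 x hx, f1.arr 9 rfl, hJ x hx, Finset.sum_range_succ]
      push_cast; rfl
  · rw [hJ x hx, sum_cntAt fun j hj => (h.hash j hj).2.2]

end

/-! ### Random hash functions and one round of the test -/

section
variable {n m σT σP : ℕ} {w : ℕ} {I : Input n m σT σP} {tape : ℕ → ℕ} {a : Abs}

/-- The `i`-th character of the text, as a number. -/
def Input.tx (I : Input n m σT σP) (i : ℕ) : ℕ := if h : i < n then I.T ⟨i, h⟩ else 0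

/-- The `j`-th character of the pattern, as a number. -/
def Input.pt (I : Input n m σT σP) (j : ℕ) : ℕ := if h : j < m then I.P ⟨j, h⟩ else 0

/-- The value of a character `b` that is written last, if `u j` is written for the character `p j`
for all `j` in increasing order. -/
def hashVal (p u : ℕ → ℕ) : ℕ → ℕ → ℕ
  | 0, _ => 0
  | j + 1, b => if p j = b then u j else hashVal p u j b

theorem hashVal_lt {p u : ℕ → ℕ} {B : ℕ} (hB : 0 < B) (hu : ∀ j, u j < B) (j b : ℕ) :
    hashVal p u j b < B := by
  induction j with
  | zero => exact hB
  | succ j ih =>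
    rw [hashVal]
    split_ifs
    exacts [hu j, ih]

/-- Characters outside the pattern keep the initial value 0 of the array. This is harmless: the
error bound only needs the hash value of a mismatched pattern character to be independent of those
of the other characters. -/
theorem hashVal_of_notMem {p u : ℕ → ℕ} {j b : ℕ} (h : ∀ l < j, p l ≠ b) : hashVal p u j b = 0 := by
  induction j with
  | zero => rfl
  | succ j ih => rw [hashVal, if_neg (h j (by omega)), ih fun l hl => h l (by omega)]

open Classical in
/-- The indicator function of the set of the hash values of the neighbours of the `i`-th character
of the text. -/
def hashBit (I : Input n m σT σP) (H : ℕ → ℕ) (i β : ℕ) : ℕ :=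
  if ∃ h : i < n, ∃ b : Fin σP, I.M (I.T ⟨i, h⟩) b = true ∧ H b = β then 1 else 0

theorem hashBit_le (H : ℕ → ℕ) (i β : ℕ) : hashBit I H i β ≤ 1 := by
  rw [hashBit]; split_ifs <;> norm_num

theorem hashBit_eq_one {H : ℕ → ℕ} {i β : ℕ} : hashBit I H i β = 1 ↔
    ∃ h : i < n, ∃ b : Fin σP, I.M (I.T ⟨i, h⟩) b = true ∧ H b = β := by
  rw [hashBit]; split_ifs with h <;> simp [h]

theorem Input.tx_lt (I : Input n m σT σP) {i : ℕ} (h : i < n) : I.tx i < σT := by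
  rw [Input.tx, dif_pos h]; exact Fin.is_lt _

theorem Input.pt_lt (I : Input n m σT σP) {j : ℕ} (h : j < m) : I.pt j < σP := by
  rw [Input.pt, dif_pos h]; exact Fin.is_lt _

theorem degTOracle_tx (I : Input n m σT σP) {i : ℕ} (h : i < n) :
    degTOracle I (I.tx i) = degT I.M (I.T ⟨i, h⟩) := by
  rw [degTOracle, dif_pos (I.tx_lt h)]
  simp [Input.tx, h]

theorem nbrOracle_tx (I : Input n m σT σP) {i k : ℕ} (h : i < n)
    (hk : k < degT I.M (I.T ⟨i, h⟩)) :
    nbrOracle I (I.tx i) k = (I.nbr (I.T ⟨i, h⟩) ⟨k, hk⟩).1 := by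
  have e : I.tx i = (I.T ⟨i, h⟩ : ℕ) := by simp [Input.tx, h]
  rw [nbrOracle, e, dif_pos (Fin.is_lt _), dif_pos]

theorem exists_nbrOracle {I : Input n m σT σP} {H : ℕ → ℕ} {i β : ℕ} (h : i < n) :
    (∃ k < degTOracle I (I.tx i), H (nbrOracle I (I.tx i) k) = β) ↔ hashBit I H i β = 1 := by
  rw [degTOracle_tx I h, hashBit_eq_one]
  constructor
  · rintro ⟨k, hk, e⟩
    rw [nbrOracle_tx I h hk] at e
    exact ⟨h, _, (I.nbr (I.T ⟨i, h⟩) ⟨k, hk⟩).2, e⟩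
  · rintro ⟨_, b, hb, e⟩
    obtain ⟨⟨k, hk⟩, he⟩ := (I.nbr (I.T ⟨i, h⟩)).surjective ⟨b, hb⟩
    refine ⟨k, hk, ?_⟩
    rw [nbrOracle_tx I h hk, he]
    exact e

/-- The state between two rounds. -/
structure RoundCtx (N k B w : ℕ) (I : Input n m σT σP) (a : Abs) : Prop where
  ready : FftReady N k a
  r0 : a.reg 0 = n
  r1 : a.reg 1 = m
  r8 : a.reg 8 = B
  m_pos : 1 ≤ m
  m_le : m ≤ n
  B_pos : 1 ≤ B
  le : 2 * m ≤ N
  text : ∀ i < n, a.arr 0 i = I.tx i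
  pat : ∀ j < m, a.arr 0 (n + j) = I.pt j
  hash : ∀ b, (∀ j < m, I.pt j ≠ b) → a.arr 7 b = 0
  bits : ∀ x, n * B ≤ x → a.arr 8 x = 0
  hW : n + m + 16 * ((n + 2 * N) * B) < 2 ^ w
  hQW : 2 * (N ^ 24) ^ 3 < 2 ^ w
  hσP : n + m + 16 * σP < 2 ^ w
  hσT : σT < 2 ^ w

theorem RoundCtx.bounds {N k B : ℕ} (h : RoundCtx N k B w I a) :
    n + m + 16 * (n + 2 * N) < 2 ^ w ∧ B < 2 ^ w ∧ n + m + 16 * (n * B) < 2 ^ w := by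
  have h1 := h.hW
  have h2 := h.B_pos
  have h3 := h.ready.four_le
  have h4 : (n + 2 * N) * 1 ≤ (n + 2 * N) * B := Nat.mul_le_mul_left _ h2
  have h5 : 1 * B ≤ (n + 2 * N) * B := Nat.mul_le_mul_right _ (by omega)
  have h6 : n * B ≤ (n + 2 * N) * B := Nat.mul_le_mul_right _ (by omega)
  omega

/-- Choose the hash values of the characters of the pattern. -/
def hashCmd : Cmd :=
  .loop 23 (.var 1) (.rnd 11 8 ;; .sto 7 (.rd 0 (.var 0 + .var 23)) (.var 11))

/-- A character that occurs repeatedly is overwritten, and its last value counts. The invariant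
speaks only about the characters met so far; the others still carry values from the previous round
until they are reached. -/
theorem hashCmd_runs {N k B : ℕ} (h : RoundCtx N k B w I a) :
    Runs w I tape hashCmd a (1 + m * 3) (fun a' => a'.used = a.used + m ∧ ∀ b,
      a'.arr 7 b = hashVal I.pt (fun j => tape (a.used + j) % B) m b) := by
  obtain ⟨hW, hB, -⟩ := h.bounds
  refine Runs.mono (Runs.loop (T := 2) m (fun j a' => a'.used = a.used + j ∧ ∀ b,
    a'.arr 7 b = if ∃ l < j, I.pt l = b then
      (hashVal I.pt (fun j => tape (a.used + j) % B) j b : ℤ) else a.arr 7 b)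
    (Ex.ok_var _ _ _ _) h.r1 (by omega) rfl ⟨rfl, by simp⟩
    fun j hj a' h23 f hJ => ?_) le_rfl fun a' hJ => ⟨hJ.1, fun b => ?_⟩
  · have e8 : a'.reg 8 = B := (f.reg 8 rfl).trans h.r8
    have e0 : a'.reg 0 = n := (f.reg 0 rfl).trans h.r0
    have hBp := h.B_pos
    refine Runs.seq (T := 1) (T' := 1) (Runs.rnd (by omega) (by rw [e8]; exact_mod_cast hB) ?_)
    have ea : ∀ (b : Abs), b.reg 0 = n → b.reg 23 = j → b.arr = a'.arr →
        (Ex.var 0 + .var 23 : Ex).ev I b = (n + j : ℕ) ∧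
        (Ex.rd 0 (.var 0 + .var 23)).ev I b = I.pt j := by
      intro b h0 h1 h2
      have e : (Ex.var 0 + .var 23 : Ex).ev I b = (n + j : ℕ) := by
        rw [Ex.ev_add, Ex.ev_var, Ex.ev_var, h0, h1]; push_cast; rfl
      refine ⟨e, ?_⟩
      rw [Ex.ev_rd, e, Int.toNat_natCast, h2, f.arr 0 rfl, h.pat j hj]
    obtain ⟨e1, e2⟩ := ea { a'.set 11 ((tape a'.used % (a'.reg 8).toNat : ℕ) : ℤ) with
      used := a'.used + 1 } e0 h23 rfl
    refine Runs.sto ⟨⟨trivial, trivial, trivial⟩, ?_⟩ (Ex.ok_var _ _ _ _) ?_ ⟨?_, fun b => ?_⟩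
    · rw [e1]; exact addrOk_zero (by omega)
    · rw [e2]
      exact addrOk_of_lt (by norm_num) (by norm_num) (I.pt_lt hj) h.hσP
    · simp [hJ.1, add_assoc]
    · rw [Abs.set_arr, Abs.put_arr, e2, e8, hJ.1]
      simp only [Int.toNat_natCast, true_and]
      rw [hashVal]
      by_cases hb : I.pt j = b
      · rw [if_pos hb.symm, if_pos ⟨j, by omega, hb⟩, if_pos hb]
        simp
      · have : (∃ l < j + 1, I.pt l = b) ↔ ∃ l < j, I.pt l = b :=
          ⟨fun ⟨l, hl, e⟩ => ⟨l, by
            rcases Nat.lt_succ_iff_lt_or_eq.1 hl with h | rfl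
            exacts [h, absurd e hb], e⟩, fun ⟨l, hl, e⟩ => ⟨l, by omega, e⟩⟩
        rw [if_neg (Ne.symm hb), if_neg hb]
        simp only [this]
        exact hJ.2 b
  · rw [hJ.2 b]
    split_ifs with hb
    · rfl
    · push Not at hb
      rw [h.hash b hb, hashVal_of_notMem hb]; rfl

/-- Mark the hash values of the neighbours of each character of the text. -/
def fillCmd : Cmd :=
  .loop 26 (.var 0 * .var 8) (.sto 8 (.var 26) (.lit 0)) ;;
  .loop 23 (.var 0) (.loop 24 (.degT (.rd 0 (.var 23)))
    (.sto 8 (.var 23 * .var 8 + .rd 7 (.nbr (.rd 0 (.var 23)) (.var 24))) (.lit 1)))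

theorem fillCmd_runs {N k B D : ℕ} {H : ℕ → ℕ} (h : RoundCtx N k B w I a)
    (hH : ∀ b, a.arr 7 b = H b) (hHB : ∀ b, H b < B)
    (hD : ∀ i : Fin n, degT I.M (I.T i) ≤ D) :
    Runs w I tape fillCmd a (2 + n * B * 2 + n * (2 + D * 2)) (fun a' =>
      ∀ i, ∀ β < B, a'.arr 8 (i * B + β) = hashBit I H i β) := by
  obtain ⟨hW, hB, hW8⟩ := h.bounds
  have hBp := h.B_pos
  have hDσ : ∀ c : Fin σT, degT I.M c ≤ σP := fun c =>
    (Finset.card_filter_le _ _).trans (by simp)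
  have hidx : ∀ i < n, ∀ β < B, i * B + β < n * B := fun i hi β hβ => by
    have := Nat.mul_le_mul_right B (show i + 1 ≤ n by omega)
    rw [add_mul, one_mul] at this
    omega
  refine Runs.mono (Runs.seq' (Runs.map (i := 26) (n * B) (fun _ => 0)
    ⟨trivial, trivial, trivial⟩ (by rw [Ex.ev_mul, Ex.ev_var, Ex.ev_var, h.r0, h.r8]; push_cast; rfl)
    (by omega) (fun p hp => addrOk_of_lt (by norm_num) (by norm_num) hp hW8)
    fun p hp a' h1 h2 h3 h4 => ⟨Ex.ok_lit _ _ _ _, rfl⟩) fun a1 f1 q1 =>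
    (Runs.loop (T := 1 + D * 2) n (fun i a' => ∀ i' β, β < B → a'.arr 8 (i' * B + β) =
      if i' < i then (hashBit I H i' β : ℤ) else 0) (Ex.ok_var _ _ _ _)
      ((f1.reg 0 rfl).trans h.r0) (by omega) rfl ?_ fun i hi a' h23 f hJ => ?_).imp
    fun a2 f2 q2 i β hβ => ?_)
    (show 1 + n * B * 2 + (1 + n * (1 + D * 2 + 1)) ≤ _ by
      rw [show 1 + D * 2 + 1 = 2 + D * 2 by ring]; omega) fun _ h => h
  · intro i' β hβ
    rw [if_neg (by omega), Abs.set_arr]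
    rcases Nat.lt_or_ge (i' * B + β) (n * B) with hx | hx
    · exact q1.1 _ hx
    · rw [q1.2 _ hx, h.bits _ hx]
  · have e8 : ∀ b : Abs, Frame (.loop 24 (.degT (.rd 0 (.var 23)))
        (.sto 8 (.var 23 * .var 8 + .rd 7 (.nbr (.rd 0 (.var 23)) (.var 24))) (.lit 1))) a' b →
        b.reg 8 = B ∧ b.reg 23 = i ∧ b.arr 0 i = I.tx i ∧ ∀ x, b.arr 7 x = H x := fun b f2 =>
      ⟨(f2.reg 8 rfl).trans ((f.reg 8 rfl).trans ((f1.reg 8 rfl).trans h.r8)),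
        (f2.reg 23 rfl).trans h23,
        by rw [f2.arr 0 rfl, f.arr 0 rfl, f1.arr 0 rfl, h.text i hi],
        fun x => by rw [f2.arr 7 rfl, f.arr 7 rfl, f1.arr 7 rfl, hH]⟩
    have e0 : a'.arr 0 i = I.tx i := by rw [f.arr 0 rfl, f1.arr 0 rfl, h.text i hi]
    have ht : InR w (I.tx i : ℤ) := inR_natCast ((I.tx_lt hi).trans h.hσT)
    have hrd : ∀ b : Abs, b.reg 23 = i → b.arr 0 i = I.tx i → (Ex.rd 0 (.var 23)).ev I b = I.tx i :=
      fun b h1 h2 => by rw [Ex.ev_rd, Ex.ev_var, h1, Int.toNat_natCast, h2]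
    have hd := degTOracle_tx I hi
    have hdD := hD ⟨i, hi⟩
    have hdσ := hDσ (I.T ⟨i, hi⟩)
    have hσ := h.hσP
    refine Runs.mono (Runs.loop (T := 1) (degTOracle I (I.tx i)) (fun k a'' => ∀ i' β, β < B →
      a''.arr 8 (i' * B + β) = if i' < i then (hashBit I H i' β : ℤ) else
        if i' = i ∧ ∃ k' < k, H (nbrOracle I (I.tx i) k') = β then 1 else 0)
      ⟨⟨trivial, by rw [Ex.ev_var, h23]; exact addrOk_zero (by omega)⟩, by
        rw [hrd a' h23 e0]; exact ht⟩
      (by rw [Ex.ev_degT, hrd a' h23 e0, Int.toNat_natCast]) (by omega) rfl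
      (fun i' β hβ => ?_) fun k hk b h24 fb hJ' => ?_) ?_ fun b q i' β hβ => ?_
    · rw [Abs.set_arr, hJ i' β hβ]
      simp
    · obtain ⟨b8, b23, b0, b7⟩ := e8 b fb
      have hk' : k < degT I.M (I.T ⟨i, hi⟩) := by rwa [hd] at hk
      set y := nbrOracle I (I.tx i) k with hy
      have hyσ : y < σP := by rw [hy, nbrOracle_tx I hi hk']; exact Fin.is_lt _
      have en : (Ex.nbr (.rd 0 (.var 23)) (.var 24)).ev I b = y := by
        rw [Ex.ev_nbr, hrd b b23 b0, Ex.ev_var, h24, Int.toNat_natCast, Int.toNat_natCast]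
      have ex : (.var 23 * .var 8 + .rd 7 (.nbr (.rd 0 (.var 23)) (.var 24)) : Ex).ev I b =
          (i * B + H y : ℕ) := by
        rw [Ex.ev_add, Ex.ev_mul, Ex.ev_rd, en, Ex.ev_var, Ex.ev_var, b23, b8, Int.toNat_natCast, b7]
        push_cast; rfl
      refine Runs.sto ?_ (Ex.ok_lit _ _ _ _) ?_ fun i' β hβ => ?_
      · rw [Ex.ok_add, Ex.ok_rd, en, Ex.ok_nbr, hrd b b23 b0]
        refine ⟨⟨trivial, trivial, trivial⟩, ⟨⟨trivial, by rw [Ex.ev_var, b23]; exact addrOk_zero (by omega)⟩,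
          trivial, ht, ?_⟩, addrOk_of_lt (by norm_num) (by norm_num) hyσ h.hσP⟩
        rw [Ex.ev_var, h24]
        exact inR_natCast (by omega)
      · rw [ex]
        exact addrOk_of_lt (by norm_num) (by norm_num) (hidx i hi _ (hHB y)) hW8
      · rw [Abs.set_arr, Abs.put_arr, ex, Int.toNat_natCast]
        -- Uniqueness of division with remainder: rows of length `B` do not overlap.
        have hiff : i' * B + β = i * B + H y ↔ i' = i ∧ H y = β := by
          constructor
          · intro e
            have e1 := congrArg (· / B) e
            have e2 := congrArg (· % B) e
            simp only [mul_comm _ B, Nat.mul_add_div hBp, Nat.mul_add_mod, Nat.mod_eq_of_lt hβ,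
              Nat.mod_eq_of_lt (hHB y), Nat.div_eq_of_lt hβ, Nat.div_eq_of_lt (hHB y)] at e1 e2
            exact ⟨e1, e2.symm⟩
          · rintro ⟨rfl, rfl⟩; rfl
        simp only [true_and, hiff]
        by_cases hc : i' = i ∧ H y = β
        · rw [if_pos hc, if_neg (by omega), if_pos ⟨hc.1, k, by omega, hc.2⟩]; rfl
        · rw [if_neg hc, hJ' i' β hβ]
          have : (i' = i ∧ ∃ k' < k + 1, H (nbrOracle I (I.tx i) k') = β) ↔
              (i' = i ∧ ∃ k' < k, H (nbrOracle I (I.tx i) k') = β) := by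
            refine and_congr_right fun hii => ⟨fun ⟨l, hl, e⟩ => ⟨l, ?_, e⟩,
              fun ⟨l, hl, e⟩ => ⟨l, by omega, e⟩⟩
            rcases Nat.lt_succ_iff_lt_or_eq.1 hl with h | rfl
            exacts [h, absurd ⟨hii, e⟩ hc]
          simp only [this]
    · rw [hd]
      have := Nat.mul_le_mul_right 2 hdD
      omega
    · rw [Abs.set_arr, q i' β hβ]
      rcases Nat.lt_trichotomy i' i with hlt | rfl | hgt
      · rw [if_pos hlt, if_pos (by omega)]
      · rw [if_neg (lt_irrefl i'), if_pos (Nat.lt_succ_self i')]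
        simp only [true_and, exists_nbrOracle hi]
        have := hashBit_le (I := I) H i' β
        split_ifs with hc
        · rw [hc]; rfl
        · rw [show hashBit I H i' β = 0 by omega]; rfl
      · rw [if_neg (by omega), if_neg (by omega), if_neg (by omega)]
  · rw [q2 i β hβ]
    split_ifs with hi
    · rfl
    · rw [hashBit, if_neg fun h => hi h.1]; rfl

/-- One round: the array `10` holds `1` for the positions that have been ruled out. -/
def roundCmd : Cmd :=
  hashCmd ;; fillCmd ;; .loop 26 (.var 0 + .lit 1) (.sto 9 (.var 26) (.lit 0)) ;; countCmd ;;
  .loop 26 (.var 0 - .var 1 + .lit 1) (.sto 10 (.var 26)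
    (.lit 1 - (.lit 1 - .rd 10 (.var 26)) * (Ex.rd 9 (.var 26)).eq (.var 1)))

/-- The time bound for `roundCmd`. -/
def roundTime (n m D N k B : ℕ) : ℕ :=
  8 + m * 3 + n * B * 2 + n * (2 + D * 2) + 4 * n + countTime n N k B

/-- The position `i` passes the test with the hash function given by `u`. -/
def Passes (I : Input n m σT σP) (u : ℕ → ℕ) (i : ℕ) : Prop :=
  ∀ j < m, hashBit I (hashVal I.pt u m) (i + j) (hashVal I.pt u m (I.pt j)) = 1

-- The update `1 - (1 - old) * [count = m]` keeps a position ruled out once it has failed in some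
-- round. The context is re-established so that rounds can be iterated.
open Classical in
theorem roundCmd_runs {N k B D : ℕ} (h : RoundCtx N k B w I a)
    (hD : ∀ i : Fin n, degT I.M (I.T i) ≤ D) :
    Runs w I tape roundCmd a (roundTime n m D N k B) (fun a' =>
      RoundCtx N k B w I a' ∧ a'.used = a.used + m ∧ ∀ i ≤ n - m, a'.arr 10 i =
        1 - (1 - a.arr 10 i) * if Passes I (fun j => tape (a.used + j) % B) i then 1 else 0) := by
  obtain ⟨hW, hB, hW8⟩ := h.bounds
  have hBp := h.B_pos
  have hmn := h.m_le
  have hm := h.m_pos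
  set u : ℕ → ℕ := fun j => tape (a.used + j) % B with hu
  set H : ℕ → ℕ := hashVal I.pt u m with hH
  have hHB : ∀ b, H b < B := hashVal_lt hBp (fun j => Nat.mod_lt _ hBp) m
  have hadr : ∀ id, id ≠ 0 → id < 16 → ∀ x < n + 1, AddrOk (n + m) w id x := fun id h0 h1 x hx =>
    addrOk_of_lt (L := n + 2 * N) h0 h1 (by have := h.ready.four_le; omega) hW
  refine Runs.mono (Runs.seq' (hashCmd_runs h) fun a1 f1 q1 =>
    have h1 : RoundCtx N k B w I a1 := ?_
    Runs.seq' (fillCmd_runs h1 q1.2 hHB hD) fun a2 f2 q2 =>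
    Runs.seq' (Runs.map (i := 26) (n + 1) (fun _ => 0) (by simp)
      ?_ (by omega) (hadr 9 (by norm_num) (by norm_num))
      fun p hp a' h1 h2 h3 h4 => ⟨Ex.ok_lit _ _ _ _, rfl⟩) fun a3 f3 q3 =>
    Runs.seq' (countCmd_runs (N := N) (k := k) (B := B) (hp := fun j => H (I.pt j))
      (χ := hashBit I H) ?_ (hashBit_le H) ?_ ?_) fun a4 f4 q4 =>
    (Runs.map (i := 26) (n - m + 1) (fun i => 1 - (1 - a.arr 10 i) * if Passes I u i then 1 else 0)
      (by simp) ?_ (by omega)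
      (fun p hp => hadr 10 (by norm_num) (by norm_num) p (by omega))
      fun p hp a' h1 h2 h3 h4 => ?_).imp fun a5 f5 q5 => ⟨?_, ?_, fun i hi => q5.1 i (by omega)⟩)
    (show 1 + m * 3 + (2 + n * B * 2 + n * (2 + D * 2) + (1 + (n + 1) * 2 + (countTime n N k B +
      (1 + (n - m + 1) * 2)))) ≤ _ by rw [roundTime]; omega) fun _ h => h
  · exact ⟨h.ready.congr (fun r hr hr' => f1.reg r (by interval_cases r <;> rfl)) (f1.arr 5 rfl)
      (f1.arr 6 rfl), (f1.reg 0 rfl).trans h.r0, (f1.reg 1 rfl).trans h.r1,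
      (f1.reg 8 rfl).trans h.r8, h.m_pos, h.m_le, h.B_pos, h.le, by rw [f1.arr 0 rfl]; exact h.text,
      by rw [f1.arr 0 rfl]; exact h.pat, fun b hb => by rw [q1.2, hashVal_of_notMem hb]; rfl,
      by rw [f1.arr 8 rfl]; exact h.bits, h.hW, h.hQW, h.hσP, h.hσT⟩
  · rw [Ex.ev_add, Ex.ev_var, f2.reg 0 rfl, h1.r0]; rfl
  · refine ⟨h1.ready.congr (fun r hr hr' => (f3.reg r (by interval_cases r <;> rfl)).trans
      (f2.reg r (by interval_cases r <;> rfl))) ((f3.arr 5 rfl).trans (f2.arr 5 rfl))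
      ((f3.arr 6 rfl).trans (f2.arr 6 rfl)), ?_, ?_, ?_, hm, hBp, h.le, fun j hj => ?_, h.hW, h.hQW⟩
    · rw [f3.reg 0 rfl, f2.reg 0 rfl, h1.r0]
    · rw [f3.reg 1 rfl, f2.reg 1 rfl, h1.r1]
    · rw [f3.reg 8 rfl, f2.reg 8 rfl, h1.r8]
    · rw [f3.arr 0 rfl, f2.arr 0 rfl, h1.pat j hj, f3.arr 7 rfl, f2.arr 7 rfl]
      exact ⟨addrOk_of_lt (by norm_num) (by norm_num) (I.pt_lt hj) h.hσP, q1.2 _, hHB _⟩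
  · rw [f3.arr 8 rfl]; exact q2
  · exact fun x hx => q3.1 x (by omega)
  · rw [Ex.ev_add, Ex.ev_sub, Ex.ev_var, Ex.ev_var, f4.reg 0 rfl, f3.reg 0 rfl, f2.reg 0 rfl, h1.r0,
      f4.reg 1 rfl, f3.reg 1 rfl, f2.reg 1 rfl, h1.r1, Ex.ev_lit, Nat.cast_add, Nat.cast_sub hmn]
  · have e9 : (Ex.rd 9 (.var 26)).ev I a' = (∑ j ∈ Finset.range m, hashBit I H (p + j) (H (I.pt j)) : ℕ) := by
      rw [Ex.ev_rd, Ex.ev_var, h1, Int.toNat_natCast, h3 9 (by norm_num), q4 p (by omega)]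
    have e10 : (Ex.rd 10 (.var 26)).ev I a' = a.arr 10 p := by
      rw [Ex.ev_rd, Ex.ev_var, h1, Int.toNat_natCast, h4 p le_rfl, f4.arr 10 rfl, f3.arr 10 rfl,
        f2.arr 10 rfl, f1.arr 10 rfl]
    have em : a'.reg 1 = m := by
      rw [h2 1 (by norm_num), f4.reg 1 rfl, f3.reg 1 rfl, f2.reg 1 rfl, f1.reg 1 rfl, h.r1]
    have hle : ∑ j ∈ Finset.range m, hashBit I H (p + j) (H (I.pt j)) ≤ m := by
      refine (Finset.sum_le_card_nsmul _ _ 1 fun j _ => hashBit_le _ _ _).trans (by simp)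
    have ha : ∀ id, id ≠ 0 → id < 16 → AddrOk (n + m) w id (a'.reg 26) :=
      fun id h0 h' => by rw [h1]; exact hadr id h0 h' p (by omega)
    constructor
    · simp only [Ex.ok_sub, Ex.ok_lit, Ex.ok_mul, Ex.ok_rd, Ex.ok_var, Ex.ok_eq, true_and, e9, em,
        ha 9 (by norm_num) (by norm_num), ha 10 (by norm_num) (by norm_num), Ex.ev_var]
      exact ⟨inR_natCast (by omega), inR_natCast (by omega)⟩
    · have := sum_eq_iff (m := m) fun j => hashBit_le (I := I) H (p + j) (H (I.pt j))
      have hp : Passes I u p ↔ ∀ j < m, hashBit I H (p + j) (H (I.pt j)) = 1 := Iff.rfl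
      simp only [Ex.ev_sub, Ex.ev_lit, Ex.ev_mul, Ex.ev_eq, e9, e10, Ex.ev_var, em, Nat.cast_inj,
        this, hp, Nat.cast_one]
  · refine ⟨h1.ready.congr (fun r hr hr' => ?_) ?_ ?_, ?_, ?_, ?_, hm, hmn, hBp, h.le, ?_, ?_, ?_,
      fun x hx => ?_, h.hW, h.hQW, h.hσP, h.hσT⟩
    · rw [f5.reg r (by interval_cases r <;> rfl), f4.reg r (by interval_cases r <;> rfl),
        f3.reg r (by interval_cases r <;> rfl), f2.reg r (by interval_cases r <;> rfl)]
    · rw [f5.arr 5 rfl, f4.arr 5 rfl, f3.arr 5 rfl, f2.arr 5 rfl]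
    · rw [f5.arr 6 rfl, f4.arr 6 rfl, f3.arr 6 rfl, f2.arr 6 rfl]
    · rw [f5.reg 0 rfl, f4.reg 0 rfl, f3.reg 0 rfl, f2.reg 0 rfl, h1.r0]
    · rw [f5.reg 1 rfl, f4.reg 1 rfl, f3.reg 1 rfl, f2.reg 1 rfl, h1.r1]
    · rw [f5.reg 8 rfl, f4.reg 8 rfl, f3.reg 8 rfl, f2.reg 8 rfl, h1.r8]
    · rw [f5.arr 0 rfl, f4.arr 0 rfl, f3.arr 0 rfl, f2.arr 0 rfl]; exact h1.text
    · rw [f5.arr 0 rfl, f4.arr 0 rfl, f3.arr 0 rfl, f2.arr 0 rfl]; exact h1.pat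
    · rw [f5.arr 7 rfl, f4.arr 7 rfl, f3.arr 7 rfl, f2.arr 7 rfl]; exact h1.hash
    -- An index from `n * B` on belongs to a row `x / B ≥ n` beyond the text, where no bit is set.
    · rw [f5.arr 8 rfl, f4.arr 8 rfl, f3.arr 8 rfl, ← Nat.div_add_mod' x B,
        q2 _ _ (Nat.mod_lt _ hBp), hashBit, if_neg, Nat.cast_zero]
      rintro ⟨hlt, -⟩
      exact absurd ((Nat.le_div_iff_mul_le hBp).2 hx) (by omega)
  · rw [f5.used rfl, f4.used rfl, f3.used rfl, f2.used rfl, q1.1]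

end

/-! ### The main program: parameters, iteration of the rounds, output -/

section
variable {n m σT σP : ℕ} {w : ℕ} {I : Input n m σT σP} {tape : ℕ → ℕ} {a : Abs}

/-- The maximum `7` of the degrees of the characters of the text. -/
def degCmd : Cmd :=
  .asg 7 (.lit 0) ;; .loop 23 (.var 0) (.ite ((Ex.var 7).lt (.degT (.rd 0 (.var 23))))
    (.asg 7 (.degT (.rd 0 (.var 23)))) .skip)

/-- The maximum degree of a character that occurs in the text. -/
def Input.deg (I : Input n m σT σP) : ℕ := Finset.univ.sup fun i : Fin n => degT I.M (I.T i)

theorem degT_le (I : Input n m σT σP) (c : Fin σT) : degT I.M c ≤ σP :=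
  (Finset.card_filter_le _ _).trans (by simp)

theorem Input.deg_le (I : Input n m σT σP) : I.deg ≤ σP := Finset.sup_le fun _ _ => degT_le I _

/-- The program works with this smaller maximum: it is found by one scan of the text, whereas a scan
of the alphabets, which may have size `(n + 1) ^ d`, could exceed the time bound. -/
theorem Input.deg_le_maxDeg (I : Input n m σT σP) : I.deg ≤ maxDeg I.M :=
  Finset.sup_le fun i _ => (Finset.le_sup (f := degT I.M) (Finset.mem_univ (I.T i))).trans
    (le_max_left _ _)

theorem degCmd_runs (r0 : a.reg 0 = n) (text : ∀ i < n, a.arr 0 i = I.tx i)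
    (hσP : n + m + 16 * σP < 2 ^ w) (hσT : σT < 2 ^ w) :
    Runs w I tape degCmd a (2 + n * 3) (fun a' => a'.reg 7 = I.deg) := by
  refine Runs.mono (Runs.asg_seq (Ex.ok_lit _ _ _ _) ((Runs.loop (T := 2) n (fun i a' =>
    a'.reg 7 = ((Finset.range i).sup fun i => degTOracle I (I.tx i) : ℕ)) (Ex.ok_var _ _ _ _)
    (by simp [r0]) (by omega) rfl (by simp) fun i hi a' h23 f hJ => ?_).imp fun a' _ hJ => ?_))
    (by omega) fun _ h => h
  · have e0 : a'.arr 0 = a.arr 0 := f.arr 0 rfl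
    have e : (Ex.rd 0 (.var 23)).ev I a' = I.tx i := by
      rw [Ex.ev_rd, Ex.ev_var, h23, Int.toNat_natCast, e0, text i hi]
    have ok : (Ex.rd 0 (.var 23)).degT.ok w I a' := by
      refine ⟨⟨trivial, ?_⟩, ?_⟩
      · rw [Ex.ev_var, h23]; exact addrOk_zero (by omega)
      · rw [e]; exact inR_natCast ((I.tx_lt hi).trans hσT)
    have ed : (Ex.rd 0 (.var 23)).degT.ev I a' = degTOracle I (I.tx i) := by
      rw [Ex.ev_degT, e, Int.toNat_natCast]
    have hle : ∀ i, i < n → degTOracle I (I.tx i) ≤ σP := fun i hi => by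
      rw [degTOracle_tx I hi]; exact degT_le I _
    have hle' : ((Finset.range i).sup fun i => degTOracle I (I.tx i)) ≤ σP :=
      Finset.sup_le fun j hj => hle j ((Finset.mem_range.1 hj).trans hi)
    have hd := hle i hi
    have ev : ((Ex.var 7).lt (.degT (.rd 0 (.var 23)))).ev I a' =
        if ((Finset.range i).sup fun i => degTOracle I (I.tx i)) < degTOracle I (I.tx i)
        then 1 else 0 := by
      rw [Ex.ev_lt, ed, Ex.ev_var, hJ]; norm_cast
    refine Runs.ite (T := 1) ⟨trivial, ok, ?_, ?_⟩ ?_ (fun h => Runs.asg ok ?_)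
      fun h => Runs.skip ?_
    · rw [Ex.ev_var, hJ]; exact inR_natCast (by omega)
    · rw [ed]; exact inR_natCast (by omega)
    · rw [ev]
      have h1w : 1 < 2 ^ w := by omega
      split_ifs
      · exact_mod_cast inR_natCast h1w
      · exact ⟨le_rfl, by positivity⟩
    · have hlt : ((Finset.range i).sup fun i => degTOracle I (I.tx i)) < degTOracle I (I.tx i) := by
        by_contra hc
        rw [ev, if_neg hc] at h; exact h rfl
      rw [ed, Finset.range_add_one, Finset.sup_insert, sup_eq_left.2 hlt.le]
      rfl
    · have hlt : ¬ ((Finset.range i).sup fun i => degTOracle I (I.tx i)) < degTOracle I (I.tx i) := by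
        intro hc
        rw [ev, if_pos hc] at h; exact one_ne_zero h
      rw [Finset.range_add_one, Finset.sup_insert, sup_eq_right.2 (not_lt.1 hlt), ← hJ]
      rfl
  · rw [hJ, Input.deg]
    congr 1
    apply le_antisymm
    · refine Finset.sup_le fun i hi => ?_
      have hi := Finset.mem_range.1 hi
      rw [degTOracle_tx I hi]
      exact Finset.le_sup (f := fun i : Fin n => degT I.M (I.T i)) (Finset.mem_univ _)
    · refine Finset.sup_le fun i _ => ?_
      have := Finset.le_sup (f := fun i => degTOracle I (I.tx i)) (Finset.mem_range.2 i.2)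
      rwa [degTOracle_tx I i.2] at this

/-- Collect the positions that have not been ruled out. -/
def outCmd : Cmd :=
  .asg 11 (.lit 0) ;; .loop 26 (.var 0 - .var 1 + .lit 1) (.ite (.rd 10 (.var 26)) .skip
    (.sto 0 (.var 11) (.var 26) ;; .asg 11 (.var 11 + .lit 1)))

/-- The output overwrites the text in array `0`, the only array with consecutive addresses, as
`Reports` demands. It fits, as there are at most `n - m + 1 ≤ n` positions. -/
theorem outCmd_runs {p : ℕ → Prop} [DecidablePred p] (r0 : a.reg 0 = n) (r1 : a.reg 1 = m)
    (hm : 1 ≤ m) (hmn : m ≤ n) (hW : n + m + 16 * (n + 1) < 2 ^ w)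
    (hp : ∀ i ≤ n - m, a.arr 10 i = if p i then 0 else 1) :
    Runs w I tape outCmd a (2 + (n - m + 1) * 4) (fun a' => ∃ f : ℕ → ℕ,
      a'.reg 11 = ((Finset.range (n - m + 1)).filter p).card ∧
      (∀ k < ((Finset.range (n - m + 1)).filter p).card, a'.arr 0 k = f k) ∧
      (Finset.range ((Finset.range (n - m + 1)).filter p).card).image f =
        (Finset.range (n - m + 1)).filter p) := by
  refine Runs.mono (Runs.asg_seq (Ex.ok_lit _ _ _ _) (Runs.loop (T := 3) (n - m + 1)
    (fun i a' => ∃ f : ℕ → ℕ, a'.reg 11 = ((Finset.range i).filter p).card ∧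
      (∀ k < ((Finset.range i).filter p).card, a'.arr 0 k = f k) ∧
      (Finset.range ((Finset.range i).filter p).card).image f = (Finset.range i).filter p)
    (by simp) ?_ (by omega) rfl ⟨id, by simp⟩ fun i hi a' h26 f hJ => ?_))
    (by omega) fun _ h => h
  · simp only [Ex.ev_add, Ex.ev_sub, Ex.ev_var, Abs.set_reg, Ex.ev_lit, r0, r1]
    rw [Nat.cast_add, Nat.cast_sub hmn]; simp
  · obtain ⟨g, j1, j2, j3⟩ := hJ
    have e10 : (Ex.rd 10 (.var 26)).ev I a' = if p i then 0 else 1 := by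
      rw [Ex.ev_rd, Ex.ev_var, h26, Int.toNat_natCast, f.arr 10 rfl]
      exact hp i (by omega)
    have hcard : ((Finset.range i).filter p).card ≤ i := (Finset.card_filter_le _ _).trans (by simp)
    refine Runs.ite (T := 2) ⟨trivial, ?_⟩ ?_ (fun h => ?_) fun h => ?_
    · rw [Ex.ev_var, h26]
      exact addrOk_of_lt (L := n + 1) (by norm_num) (by norm_num) (by omega) hW
    · rw [e10]
      have h1w : 1 < 2 ^ w := by omega
      split_ifs
      · exact ⟨le_rfl, by positivity⟩
      · exact_mod_cast inR_natCast h1w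
    · have hpi : ¬ p i := fun hc => h (by rw [e10, if_pos hc])
      refine (Runs.skip (Q := fun a'' => _) ⟨g, ?_⟩).mono (by norm_num) fun _ h => h
      rw [Finset.range_add_one, Finset.filter_insert, if_neg hpi]
      exact ⟨by simpa using j1, by simpa using j2, j3⟩
    · have hpi : p i := by
        by_contra hc
        rw [e10, if_neg hc] at h; exact one_ne_zero h
      have hS : (Finset.range (i + 1)).filter p = insert i ((Finset.range i).filter p) := by
        rw [Finset.range_add_one, Finset.filter_insert, if_pos hpi]
      have hc : ((Finset.range (i + 1)).filter p).card = ((Finset.range i).filter p).card + 1 := by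
        rw [hS, Finset.card_insert_of_notMem (by simp)]
      set q := ((Finset.range i).filter p).card with hq
      have ha : AddrOk (n + m) w 0 ((Ex.var 11).ev I a') := by
        rw [Ex.ev_var, j1]; exact addrOk_zero (by omega)
      refine Runs.sto_seq (T := 1) (Ex.ok_var _ _ _ _) (Ex.ok_var _ _ _ _) ha (Runs.asg (by simp)
        ⟨Function.update g q i, ?_, fun k hk => ?_, ?_⟩)
      · simp [j1, hc]
      · rw [hc] at hk
        simp only [Abs.set_arr, Abs.put_arr, Ex.ev_var, j1, Int.toNat_natCast, true_and, h26]
        by_cases hkq : k = q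
        · simp [hkq]
        · rw [if_neg (by tauto), Function.update_of_ne hkq, j2 k (by omega)]
      · rw [hc, Finset.range_add_one, Finset.image_insert, Function.update_self, hS, ← j3]
        congr 1
        refine Finset.image_congr fun k hk => ?_
        simp only [Finset.coe_range, Set.mem_Iio] at hk
        rw [Function.update_of_ne (by omega)]

/-- The two conditions are those delivered by `growLoop_runs` with initial exponent 0. -/
theorem eq_clog {t k : ℕ} (h : t ≤ 2 ^ k) (h' : k = 0 ∨ 2 ^ k < 2 * t) : k = Nat.clog 2 t := by
  apply le_antisymm
  · rcases h' with rfl | h'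
    · exact Nat.zero_le _
    · have h2 := Nat.le_pow_clog (b := 2) (by norm_num) t
      have h3 : 2 ^ k < 2 ^ (Nat.clog 2 t + 1) := by rw [pow_succ]; omega
      exact Nat.lt_succ_iff.1 ((Nat.pow_lt_pow_iff_right (by norm_num)).1 h3)
  · exact Nat.clog_le_of_le_pow h

/-- The initial state of the main program. -/
structure InitCtx (I : Input n m σT σP) (a : Abs) : Prop where
  r0 : a.reg 0 = n
  r1 : a.reg 1 = m
  text : ∀ i < n, a.arr 0 i = I.tx i
  pat : ∀ j < m, a.arr 0 (n + j) = I.pt j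
  arr : ∀ id, id ≠ 0 → ∀ x, a.arr id x = 0
  used : a.used = 0

theorem RoundCtx.set {N k B r : ℕ} {v : ℤ} (h : RoundCtx N k B w I a) (hr : 8 < r) :
    RoundCtx N k B w I (a.set r v) :=
  ⟨h.ready.congr (fun x _ hx => by rw [Abs.set_reg, if_neg (by omega)]) rfl rfl,
    by rw [Abs.set_reg, if_neg (by omega), h.r0], by rw [Abs.set_reg, if_neg (by omega), h.r1],
    by rw [Abs.set_reg, if_neg (by omega), h.r8], h.m_pos, h.m_le, h.B_pos, h.le, h.text, h.pat,
    h.hash, h.bits, h.hW, h.hQW, h.hσP, h.hσT⟩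

/-- The main program, with `c` times the logarithm of the length of the text rounds. -/
def mainCmd (c : ℕ) : Cmd :=
  fftSetup ;; degCmd ;; growLoop 8 10 1 0 (.lit 2 * .var 7) (.lit 2 * .var 7) ;;
  growLoop 10 9 1 0 (.var 0) (.var 0 + .lit 1) ;;
  .loop 20 (.lit c * .var 9) roundCmd ;; outCmd

/-- The number of hash values. -/
def Input.numHash (I : Input n m σT σP) : ℕ := 2 ^ Nat.clog 2 (2 * I.deg)

/-- The positions that pass the tests of `R` rounds. -/
def Survives (I : Input n m σT σP) (tape : ℕ → ℕ) (R i : ℕ) : Prop :=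
  ∀ r < R, Passes I (fun j => tape (r * m + j) % I.numHash) i

/-- The time bound for `mainCmd`. -/
def mainTime (n m D N k B R : ℕ) : ℕ :=
  2500 * m + 20 + 11 * n + 8 * D + R * (roundTime n m D N k B + 1)

open Classical in
theorem mainCmd_runs {c : ℕ} (h : InitCtx I a) (hm : 1 ≤ m) (hmn : m ≤ n)
    (hW : n + m + 16 * ((n + 8 * m) * I.numHash) < 2 ^ w) (hQW : 2 * ((4 * m) ^ 24) ^ 3 < 2 ^ w)
    (hσP : n + m + 16 * σP < 2 ^ w) (hσT : σT < 2 ^ w) (hR : c * Nat.clog 2 (n + 1) < 2 ^ w) :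
    ∃ N k, 2 * m ≤ N ∧ N ≤ 4 * m ∧ N = 2 ^ k ∧ 4 ≤ N ∧
    Runs w I tape (mainCmd c) a
      (mainTime n m I.deg N k I.numHash (c * Nat.clog 2 (n + 1)))
      (fun a' => ∃ f : ℕ → ℕ, a'.reg 11 = ((Finset.range (n - m + 1)).filter
          (Survives I tape (c * Nat.clog 2 (n + 1)))).card ∧
        (∀ k < ((Finset.range (n - m + 1)).filter
          (Survives I tape (c * Nat.clog 2 (n + 1)))).card, a'.arr 0 k = f k) ∧
        (Finset.range ((Finset.range (n - m + 1)).filter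
          (Survives I tape (c * Nat.clog 2 (n + 1)))).card).image f =
          (Finset.range (n - m + 1)).filter (Survives I tape (c * Nat.clog 2 (n + 1)))) := by
  set B := I.numHash with hB
  set R := c * Nat.clog 2 (n + 1) with hRdef
  have hBp : 1 ≤ B := Nat.one_le_two_pow
  have hW1 : n + m + 16 * (n + 8 * m) < 2 ^ w := by
    have : (n + 8 * m) * 1 ≤ (n + 8 * m) * B := Nat.mul_le_mul_left _ hBp
    omega
  have hD := I.deg_le
  -- The setup is executed separately, since `N` and `k` have to be known before the time bound can
  -- be stated.
  obtain ⟨t1, a1, ht1, ex1, N, k, hN, hN1, hN2⟩ :=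
    fftSetup_runs (I := I) (tape := tape) h.r1 hm (by omega) hQW
  have f1 := ex1.frame
  have hNN : N * 1 ≤ N * B := Nat.mul_le_mul_left _ hBp
  refine ⟨N, k, hN1, hN2, hN.eq, hN.four_le, ?_⟩
  -- The commands between the setup and the rounds change no array and no register below 7. The
  -- array `10` is still 0, so initially no position is ruled out.
  have hstart : ∀ {a2 a3 a4 : Abs}, Frame degCmd a1 a2 →
      Frame (growLoop 8 10 1 0 (.lit 2 * .var 7) (.lit 2 * .var 7)) a2 a3 →
      Frame (growLoop 10 9 1 0 (.var 0) (.var 0 + .lit 1)) a3 a4 → a4.reg 8 = B →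
      RoundCtx N k B w I (a4.set 20 0) ∧ (a4.set 20 0).used = 0 ∧ ∀ x, a4.arr 10 x = 0 := by
    intro a2 a3 a4 f2 f3 f4 e8
    have er : ∀ r, r < 7 → a4.reg r = a1.reg r := fun r hr => by
      rw [f4.reg r (by interval_cases r <;> rfl), f3.reg r (by interval_cases r <;> rfl),
        f2.reg r (by interval_cases r <;> rfl)]
    have ea : a4.arr = a1.arr := by
      funext id; rw [f4.arr id rfl, f3.arr id rfl, f2.arr id rfl]
    refine ⟨⟨hN.congr (fun r h2 h6 => ?_) (by rw [Abs.set_arr, ea]) (by rw [Abs.set_arr, ea]),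
      ?_, ?_, ?_, hm, hmn, hBp, hN1, ?_, ?_, fun b _ => ?_, fun x _ => ?_, ?_, ?_, hσP, hσT⟩,
      ?_, fun x => ?_⟩
    · rw [Abs.set_reg, if_neg (by omega), er r (by omega)]
    · rw [Abs.set_reg, if_neg (by norm_num), er 0 (by norm_num), f1.reg 0 rfl, h.r0]
    · rw [Abs.set_reg, if_neg (by norm_num), er 1 (by norm_num), f1.reg 1 rfl, h.r1]
    · rw [Abs.set_reg, if_neg (by norm_num), e8]
    · rw [Abs.set_arr, ea, f1.arr 0 rfl]; exact h.text
    · rw [Abs.set_arr, ea, f1.arr 0 rfl]; exact h.pat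
    · rw [Abs.set_arr, ea, f1.arr 7 rfl]; exact h.arr 7 (by norm_num) b
    · rw [Abs.set_arr, ea, f1.arr 8 rfl]; exact h.arr 8 (by norm_num) x
    · have : (n + 2 * N) * B ≤ (n + 8 * m) * B := Nat.mul_le_mul_right _ (by omega)
      omega
    · refine lt_of_le_of_lt ?_ hQW
      gcongr
    · rw [Abs.set_used, f4.used rfl, f3.used rfl, f2.used rfl, f1.used rfl, h.used]
    · rw [ea, f1.arr 10 rfl]; exact h.arr 10 (by norm_num) x
  have e30 : ∀ {a2 a3 : Abs}, Frame degCmd a1 a2 →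
      Frame (growLoop 8 10 1 0 (.lit 2 * .var 7) (.lit 2 * .var 7)) a2 a3 → a3.reg 0 = n :=
    fun f2 f3 => by rw [f3.reg 0 rfl, f2.reg 0 rfl, f1.reg 0 rfl, h.r0]
  refine Runs.mono (Runs.seq' (Q' := fun a' => a' = a1) ⟨t1, a1, ht1, ex1, rfl⟩
    fun b _ hb => hb ▸ Runs.seq' (degCmd_runs ((f1.reg 0 rfl).trans h.r0)
      (by rw [f1.arr 0 rfl]; exact h.text) hσP hσT) fun a2 f2 q2 =>
    Runs.seq' (growLoop_runs (L := 2 * I.deg) (t := 2 * I.deg) (by norm_num) (by norm_num)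
      (by norm_num) (by norm_num) ?_ ?_ ?_ ?_ ?_ ?_) fun a3 f3 q3 =>
    Runs.seq' (growLoop_runs (L := n) (t := n + 1) (by norm_num) (by norm_num)
      (by norm_num) (by norm_num) ?_ ?_ ?_ ?_ ?_ ?_) fun a4 f4 q4 =>
    Runs.seq' (Runs.loop (T := roundTime n m I.deg N k B) R (fun r a' => RoundCtx N k B w I a' ∧
      a'.used = r * m ∧ ∀ i ≤ n - m, a'.arr 10 i = if Survives I tape r i then 0 else 1)
      (by simp) ?_ hR rfl ⟨?_, ?_, ?_⟩ fun r hr a' h20 f hJ => ?_) fun a5 f5 q5 =>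
    outCmd_runs q5.1.r0 q5.1.r1 hm hmn (by omega) q5.2.2)
    (show 2500 * m + (2 + n * 3 + (3 + 2 * I.deg * 4 + (3 + n * 4 +
      (1 + R * (roundTime n m I.deg N k B + 1) + (2 + (n - m + 1) * 4))))) ≤ _ by
      rw [mainTime]; omega) fun _ h => h
  · intro a' hr _
    have e : a'.reg 7 = I.deg := (hr 7 (by norm_num) (by norm_num) (by norm_num)).trans q2
    exact ⟨by simp, by rw [Ex.ev_mul, Ex.ev_lit, Ex.ev_var, e]; push_cast; rfl⟩
  · intro a' hr _
    have e : a'.reg 7 = I.deg := (hr 7 (by norm_num) (by norm_num) (by norm_num)).trans q2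
    exact ⟨by simp, by rw [Ex.ev_mul, Ex.ev_lit, Ex.ev_var, e]; push_cast; rfl⟩
  · omega
  · omega
  · have := @Nat.one_le_two_pow w
    omega
  · rw [zero_add]; exact Nat.lt_two_pow_self.le
  · intro a' hr _
    exact ⟨Ex.ok_var _ _ _ _, (hr 0 (by norm_num) (by norm_num) (by norm_num)).trans (e30 f2 f3)⟩
  · intro a' hr _
    have e := (hr 0 (by norm_num) (by norm_num) (by norm_num)).trans (e30 f2 f3)
    exact ⟨by simp, by rw [Ex.ev_add, Ex.ev_lit, Ex.ev_var, e]; push_cast; rfl⟩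
  · omega
  · omega
  · omega
  · rw [zero_add]; exact Nat.lt_two_pow_self
  · obtain ⟨l, -, -, l2, l3, l4⟩ := q4
    rw [Ex.ev_mul, Ex.ev_lit, Ex.ev_var, l2, eq_clog l3 l4, hRdef]
    push_cast; rfl
  · obtain ⟨l, -, l1, -, l3, l4⟩ := q3
    have e8 : a4.reg 8 = B := by
      rw [f4.reg 8 rfl, l1, eq_clog l3 l4, hB, Input.numHash]
    exact (hstart f2 f3 f4 e8).1
  · obtain ⟨l, -, l1, -, l3, l4⟩ := q3
    rw [zero_mul]
    exact (hstart f2 f3 f4 (by rw [f4.reg 8 rfl, l1, eq_clog l3 l4, hB, Input.numHash])).2.1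
  · obtain ⟨l, -, l1, -, l3, l4⟩ := q3
    intro i _
    rw [if_pos (by simp [Survives])]
    exact (hstart f2 f3 f4 (by rw [f4.reg 8 rfl, l1, eq_clog l3 l4, hB, Input.numHash])).2.2 i
  · obtain ⟨c1, c2, c3⟩ := hJ
    refine (roundCmd_runs c1 fun i => Finset.le_sup (f := fun i : Fin n => degT I.M (I.T i))
      (Finset.mem_univ i)).imp fun a'' _ q => ⟨?_, ?_, fun i hi => ?_⟩
    · exact q.1.set (by norm_num)
    · rw [Abs.set_used, q.2.1, c2, add_mul, one_mul]
    · rw [Abs.set_arr, q.2.2 i hi, c3 i hi, c2]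
      -- Round `r` reads the random words from `r * m` on, so surviving `r + 1` rounds means
      -- surviving `r` rounds and passing with these words.
      have : Survives I tape (r + 1) i ↔
          Survives I tape r i ∧ Passes I (fun j => tape (r * m + j) % B) i := by
        constructor
        · exact fun h => ⟨fun l hl => h l (by omega), h r (by omega)⟩
        · rintro ⟨h1, h2⟩ l hl
          rcases Nat.lt_succ_iff_lt_or_eq.1 hl with h | rfl
          exacts [h1 l h, h2]
      by_cases k1 : Survives I tape r i <;>
        by_cases k2 : Passes I (fun j => tape (r * m + j) % B) i <;> simp [this, k1, k2]

end

/-! ### The probability of an error -/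

section
variable {ι α : Type*} [Fintype ι] [DecidableEq ι] [Fintype α] [DecidableEq α]

/-- Independence in the form of counting: fix all coordinates except `x`. On such a fibre of `A` the
coordinate `x` takes all values while `G` is constant, and at most half of the values lie in `G`. -/
theorem two_mul_card_filter_le (A : Finset (ι → α)) (x : ι) (G : (ι → α) → Finset α)
    (hA : ∀ ω ∈ A, ∀ v, Function.update ω x v ∈ A)
    (hG : ∀ ω v, G (Function.update ω x v) = G ω) (hcard : ∀ ω, 2 * (G ω).card ≤ Fintype.card α) :
    2 * (A.filter fun ω => ω x ∈ G ω).card ≤ A.card := by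
  rcases isEmpty_or_nonempty α with hα | ⟨⟨a0⟩⟩
  · have : A.filter (fun ω => ω x ∈ G ω) = ∅ :=
      Finset.filter_eq_empty_iff.2 fun ω _ => (hα.false (ω x)).elim
    simp [this]
  set f : (ι → α) → ι → α := fun ω => Function.update ω x a0 with hf
  have hmem : ∀ ω ∈ A, f ω ∈ A.image f := fun ω h => Finset.mem_image_of_mem f h
  rw [Finset.card_eq_sum_card_fiberwise (f := f) (t := A.image f) (s := A) hmem,
    Finset.card_eq_sum_card_fiberwise (f := f) (t := A.image f)
      (fun ω h => hmem ω (Finset.mem_filter.1 h).1), Finset.mul_sum]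
  refine Finset.sum_le_sum fun τ hτ => ?_
  obtain ⟨ω₀, hω₀, rfl⟩ := Finset.mem_image.1 hτ
  have hupd : ∀ ω, f ω = f ω₀ → ω = Function.update ω₀ x (ω x) := by
    intro ω h
    funext y
    by_cases hy : y = x
    · subst hy; simp
    · have := congrFun h y
      simpa [hf, hy] using this
  have h1 : ((A.filter fun ω => ω x ∈ G ω).filter fun ω => f ω = f ω₀).card ≤ (G ω₀).card := by
    refine Finset.card_le_card_of_injOn (fun ω => ω x) (fun ω h => ?_) fun ω h ω' h' e => ?_
    · simp only [Finset.coe_filter, Finset.mem_filter, Set.mem_ofPred_eq] at h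
      have := h.1.2
      rw [hupd ω h.2, hG] at this
      simpa using this
    · simp only [Finset.coe_filter, Finset.mem_filter, Set.mem_ofPred_eq] at h h'
      rw [hupd ω h.2, hupd ω' h'.2]
      simp only at e
      rw [e]
  have h2 : Fintype.card α ≤ (A.filter fun ω => f ω = f ω₀).card := by
    rw [← Finset.card_univ]
    refine Finset.card_le_card_of_injOn (fun v => Function.update ω₀ x v) (fun v _ => ?_)
      fun v _ v' _ e => ?_
    · simp only [Finset.coe_filter, Set.mem_ofPred_eq]
      exact ⟨hA _ hω₀ v, by simp [hf]⟩
    · simpa using congrFun e x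
  exact (Nat.mul_le_mul_left 2 h1).trans ((hcard ω₀).trans h2)

/-- The rounds test distinct coordinates `x r`, and none of the target sets depends on any of these
coordinates. Hence each further round at least halves the number of survivors. -/
theorem two_pow_mul_card_filter_le {R : ℕ} (x : ℕ → ι) (G : ℕ → (ι → α) → Finset α)
    (hx : ∀ r < R, ∀ s < R, x r = x s → r = s)
    (hG : ∀ r < R, ∀ s < R, ∀ ω v, G r (Function.update ω (x s) v) = G r ω)
    (hcard : ∀ r < R, ∀ ω, 2 * (G r ω).card ≤ Fintype.card α) :
    2 ^ R * (Finset.univ.filter fun ω : ι → α => ∀ r < R, ω (x r) ∈ G r ω).card ≤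
      Fintype.card (ι → α) := by
  have key : ∀ S ≤ R, 2 ^ S * (Finset.univ.filter fun ω : ι → α => ∀ r < S, ω (x r) ∈ G r ω).card ≤
      Fintype.card (ι → α) := by
    intro S
    induction S with
    | zero => intro _; simp
    | succ S ih =>
      intro hS
      refine le_trans ?_ (ih (by omega))
      rw [pow_succ, mul_assoc]
      refine Nat.mul_le_mul_left _ ?_
      refine le_trans (le_of_eq ?_) (two_mul_card_filter_le
        (Finset.univ.filter fun ω : ι → α => ∀ r < S, ω (x r) ∈ G r ω) (x S) (G S)
        (fun ω h v => ?_) (hG S (by omega) S (by omega)) (hcard S (by omega)))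
      · rw [Finset.filter_filter]
        congr 2
        refine Finset.filter_congr fun ω _ => ⟨fun h => ⟨fun r hr => h r (by omega), h S (by omega)⟩,
          fun h r hr => ?_⟩
        rcases Nat.lt_succ_iff_lt_or_eq.1 hr with hr | rfl
        exacts [h.1 r hr, h.2]
      · simp only [Finset.mem_filter, Finset.mem_univ, true_and] at h ⊢
        intro r hr
        rw [hG r (by omega) S (by omega), Function.update_of_ne]
        · exact h r hr
        · intro e
          have := hx r (by omega) S (by omega) e
          omega
  exact key R le_rfl

end

/-! ### Error probability of the hashing test -/

section
variable {n m σT σP : ℕ} {w : ℕ} {I : Input n m σT σP} {tape : ℕ → ℕ}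

/-- The index `l` is the last occurrence of `b`. It does not depend on `u`, so the random word that
decides the hash value of `b` is known beforehand. -/
theorem exists_hashVal_eq {p : ℕ → ℕ} {j b : ℕ} (h : ∃ l < j, p l = b) :
    ∃ l < j, p l = b ∧ ∀ u, hashVal p u j b = u l := by
  induction j with
  | zero => obtain ⟨l, hl, -⟩ := h; omega
  | succ j ih =>
    by_cases hb : p j = b
    · exact ⟨j, by omega, hb, fun u => by rw [hashVal, if_pos hb]⟩
    · obtain ⟨l, hl, e⟩ := h
      have hlj : l < j := by
        rcases Nat.lt_succ_iff_lt_or_eq.1 hl with h | rfl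
        exacts [h, absurd e hb]
      obtain ⟨l', h1, h2, h3⟩ := ih ⟨l, hlj, e⟩
      exact ⟨l', by omega, h2, fun u => by rw [hashVal, if_neg hb, h3]⟩

/-- Only the words at the positions of `b` matter, so the hash values of different characters depend
on disjoint sets of words. -/
theorem hashVal_congr {p u u' : ℕ → ℕ} {j b : ℕ} (h : ∀ l < j, p l = b → u l = u' l) :
    hashVal p u j b = hashVal p u' j b := by
  induction j with
  | zero => rfl
  | succ j ih =>
    rw [hashVal, hashVal, ih fun l hl => h l (by omega)]
    split_ifs with hb
    · exact h j (by omega) hb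
    · rfl

/-- A power of two `2 ^ b` with `b ≤ w` divides `2 ^ w`, so the residue of a random word is exactly
uniform; each residue has at most `2 ^ (w - b)` preimages. This is why the number of hash values is
a power of two. -/
theorem card_filter_mod_le {w b : ℕ} (hb : b ≤ w) {S : Finset ℕ} (hS : 2 * S.card ≤ 2 ^ b) :
    2 * (Finset.univ.filter fun v : Fin (2 ^ w) => (v : ℕ) % 2 ^ b ∈ S).card ≤
      Fintype.card (Fin (2 ^ w)) := by
  have h : (Finset.univ.filter fun v : Fin (2 ^ w) => (v : ℕ) % 2 ^ b ∈ S).card ≤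
      (S ×ˢ Finset.range (2 ^ (w - b))).card := by
    refine Finset.card_le_card_of_injOn (fun v => ((v : ℕ) % 2 ^ b, (v : ℕ) / 2 ^ b))
      (fun v hv => ?_) fun v _ v' _ e => ?_
    · simp only [Finset.coe_filter, Finset.mem_univ, true_and, Set.mem_ofPred_eq] at hv
      simp only [Finset.coe_product, Set.mem_prod, Finset.mem_coe, Finset.mem_range]
      refine ⟨hv, Nat.div_lt_of_lt_mul ?_⟩
      rw [← pow_add, Nat.add_sub_cancel' hb]
      exact v.2
    · simp only [Prod.mk.injEq] at e
      apply Fin.ext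
      rw [← Nat.div_add_mod (v : ℕ) (2 ^ b), e.1, e.2, Nat.div_add_mod]
  rw [Finset.card_product, Finset.card_range] at h
  have e : 2 ^ w = 2 ^ b * 2 ^ (w - b) := by rw [← pow_add, Nat.add_sub_cancel' hb]
  rw [Fintype.card_fin]
  calc _ ≤ 2 * (S.card * 2 ^ (w - b)) := Nat.mul_le_mul_left 2 h
    _ = 2 * S.card * 2 ^ (w - b) := by ring
    _ ≤ 2 ^ b * 2 ^ (w - b) := Nat.mul_le_mul_right _ hS
    _ = 2 ^ w := e.symm

theorem mem_occurrences {i : ℕ} (hmn : m ≤ n) : i ∈ occurrences I ↔ i ≤ n - m ∧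
    ∀ j (hj : j < m) (h : i + j < n), I.M (I.T ⟨i + j, h⟩) (I.P ⟨j, hj⟩) = true := by
  rw [occurrences, Finset.mem_filter, Finset.mem_range, Nat.lt_succ_iff]
  refine and_congr_right fun hi => ⟨fun h j hj h' => (h ⟨j, hj⟩).2, fun h j => ?_⟩
  have : i + j < n := by have := j.2; omega
  exact ⟨this, h j j.2 this⟩

/-- At an occurrence `P[j]` is itself a neighbour of the text character facing it, so its hash value
is marked for every hash function. -/
theorem survives_of_mem {i : ℕ} (hmn : m ≤ n) (hi : i ∈ occurrences I) (R : ℕ) :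
    Survives I tape R i := by
  obtain ⟨h1, h2⟩ := (mem_occurrences hmn).1 hi
  intro r _ j hj
  have hij : i + j < n := by omega
  rw [hashBit_eq_one]
  exact ⟨hij, I.P ⟨j, hj⟩, h2 j hj hij, by simp [Input.pt, hj]⟩

-- At a mismatch `j`, let `x r` be the word that decides the hash value of `P[j]` in round `r`, and
-- `G r` the words whose residue is the hash value of a neighbour of the text character facing
-- `P[j]`. As `P[j]` is not among these neighbours, `G r` does not depend on any `x s`; at most
-- `I.deg` residues, that is half of them, belong to it.
open Classical in
theorem two_pow_mul_card_survives_le {L R i : ℕ} (hmn : m ≤ n) (hL : R * m ≤ L)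
    (hB : Nat.clog 2 (2 * I.deg) ≤ w) (hi : i ≤ n - m) (hocc : i ∉ occurrences I) :
    2 ^ R * (Finset.univ.filter fun ω : Fin L → Fin (2 ^ w) => Survives I (tapeOf ω) R i).card ≤
      Fintype.card (Fin L → Fin (2 ^ w)) := by
  obtain ⟨j, hj, hij, hM⟩ : ∃ j, ∃ (hj : j < m) (h : i + j < n),
      I.M (I.T ⟨i + j, h⟩) (I.P ⟨j, hj⟩) = false := by
    by_contra hc
    push Not at hc
    exact hocc ((mem_occurrences hmn).2 ⟨hi, fun j hj h => by simpa using hc j hj h⟩)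
  obtain ⟨l, hl, hpl, hval⟩ := exists_hashVal_eq (p := I.pt) (b := I.pt j) ⟨j, hj, rfl⟩
  rcases Nat.eq_zero_or_pos R with rfl | hR
  · rw [pow_zero, one_mul, ← Finset.card_univ]; exact Finset.card_filter_le _ _
  have hlt : ∀ r < R, r * m + l < L := fun r hr => by
    have := Nat.mul_le_mul_right m (show r + 1 ≤ R by omega)
    rw [add_mul, one_mul] at this
    omega
  -- The value for `r ≥ R` is a dummy. It needs one round to fit on the tape, which is why `R = 0`
  -- was treated separately.
  set x : ℕ → Fin L := fun r => if h : r < R then ⟨r * m + l, hlt r h⟩ else ⟨l, by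
    simpa using hlt 0 hR⟩ with hx
  have hxv : ∀ r < R, (x r : ℕ) = r * m + l := fun r hr => by simp [hx, hr]
  set u : (Fin L → Fin (2 ^ w)) → ℕ → ℕ → ℕ := fun ω r j => tapeOf ω (r * m + j) % I.numHash with hu
  set S : ℕ → (Fin L → Fin (2 ^ w)) → Finset ℕ := fun r ω =>
    (Finset.univ.filter fun b => I.M (I.T ⟨i + j, hij⟩) b = true).image
      fun b : Fin σP => hashVal I.pt (u ω r) m b with hS
  set G : ℕ → (Fin L → Fin (2 ^ w)) → Finset (Fin (2 ^ w)) := fun r ω =>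
    Finset.univ.filter fun v => (v : ℕ) % I.numHash ∈ S r ω with hG
  refine le_trans (Nat.mul_le_mul_left _ (Finset.card_le_card fun ω hω => ?_))
    (two_pow_mul_card_filter_le x G (fun r hr s hs e => ?_) (fun r hr s hs ω v => ?_)
      fun r hr ω => ?_)
  · simp only [Finset.mem_filter, Finset.mem_univ, true_and] at hω ⊢
    intro r hr
    obtain ⟨h, b, hb, e⟩ := hashBit_eq_one.1 (hω r hr j hj)
    rw [hval] at e
    simp only [hG, hS, Finset.mem_filter, Finset.mem_univ, true_and, Finset.mem_image]
    refine ⟨b, hb, e.trans ?_⟩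
    have : tapeOf ω (r * m + l) = ω (x r) := by
      rw [tapeOf, dif_pos (hlt r hr)]
      simp [hx, hr]
    rw [this]
  · have e' := congrArg Fin.val e
    rw [hxv r hr, hxv s hs] at e'
    exact Nat.eq_of_mul_eq_mul_right (by omega) (Nat.add_right_cancel e')
  · have hSS : S r (Function.update ω (x s) v) = S r ω := by
      refine Finset.image_congr fun b hb => ?_
      simp only [Finset.coe_filter, Finset.mem_univ, true_and, Set.mem_ofPred_eq] at hb
      refine hashVal_congr fun k hk hkb => ?_
      have hkl : k ≠ l := by
        rintro rfl
        have hbj : b = I.P ⟨j, hj⟩ := Fin.ext (by rw [← hkb, hpl]; simp [Input.pt, hj])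
        rw [hbj, hM] at hb
        exact absurd hb (by simp)
      -- The words `r * m + k` and `s * m + l` differ already modulo `m`, whichever rounds `r` and
      -- `s` are.
      have hne : ∀ h : r * m + k < L, (⟨r * m + k, h⟩ : Fin L) ≠ x s := fun h e => by
        have e' := congrArg Fin.val e
        rw [hxv s hs] at e'
        have := congrArg (· % m) e'
        simp only [Nat.mul_add_mod', Nat.mod_eq_of_lt hk, Nat.mod_eq_of_lt hl] at this
        exact hkl this
      simp only [hu, tapeOf]
      split_ifs with h
      · rw [Function.update_of_ne (hne h)]
      · rfl
    simp only [hG, hSS]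
  · refine card_filter_mod_le hB ?_
    refine le_trans (Nat.mul_le_mul_left 2 (Finset.card_image_le.trans ?_)) (Nat.le_pow_clog (by norm_num) _)
    exact Finset.le_sup (f := fun i : Fin n => degT I.M (I.T i)) (Finset.mem_univ (⟨i + j, hij⟩ : Fin n))

-- A union bound over at most `n` positions. Since `2 ^ R ≥ n ^ (⌈c⌉₊ + 1)`, one factor `n` pays for
-- the union and the rest gives `n ^ c`, also for negative `c`.
open Classical in
theorem prob_ne_le {L R : ℕ} {c : ℝ} (hm : 1 ≤ m) (hmn : m ≤ n) (hL : R * m ≤ L)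
    (hB : Nat.clog 2 (2 * I.deg) ≤ w) (hR : (⌈c⌉₊ + 1) * Nat.clog 2 (n + 1) ≤ R) :
    prob {ω : Fin L → Fin (2 ^ w) | (Finset.range (n - m + 1)).filter (Survives I (tapeOf ω) R) ≠
      occurrences I} ≤ 1 / (n : ℝ) ^ c := by
  set E : ℕ → Finset (Fin L → Fin (2 ^ w)) := fun i =>
    Finset.univ.filter fun ω => Survives I (tapeOf ω) R i with hE
  set bad := (Finset.range (n - m + 1)) \ occurrences I with hbad
  set total := Fintype.card (Fin L → Fin (2 ^ w)) with ht
  have htot : 0 < total := Fintype.card_pos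
  have hsub : {ω : Fin L → Fin (2 ^ w) | (Finset.range (n - m + 1)).filter
      (Survives I (tapeOf ω) R) ≠ occurrences I} ⊆ ((bad.biUnion E : Finset _) : Set _) := by
    intro ω hω
    by_contra hc
    refine hω (Finset.Subset.antisymm (fun i hi => ?_) fun i hi => ?_)
    · by_contra hocc
      rw [Finset.mem_filter] at hi
      exact hc (Finset.mem_coe.2 (Finset.mem_biUnion.2 ⟨i, Finset.mem_sdiff.2 ⟨hi.1, hocc⟩,
        Finset.mem_filter.2 ⟨Finset.mem_univ _, hi.2⟩⟩))
    · rw [Finset.mem_filter, Finset.mem_range, Nat.lt_succ_iff]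
      exact ⟨((mem_occurrences hmn).1 hi).1, survives_of_mem hmn hi R⟩
  have hbadc : bad.card ≤ n := by
    refine (Finset.card_le_card Finset.sdiff_subset).trans ?_
    rw [Finset.card_range]; omega
  have h1 : 2 ^ R * (bad.biUnion E).card ≤ n * total := by
    refine (Nat.mul_le_mul_left _ Finset.card_biUnion_le).trans ?_
    rw [Finset.mul_sum]
    refine (Finset.sum_le_card_nsmul bad _ total fun i hi => ?_).trans ?_
    · obtain ⟨h1, h2⟩ := Finset.mem_sdiff.1 hi
      exact two_pow_mul_card_survives_le hmn hL hB (by rw [Finset.mem_range] at h1; omega) h2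
    · rw [smul_eq_mul]; exact Nat.mul_le_mul_right _ hbadc
  have h2 : n ^ (⌈c⌉₊ + 1) ≤ 2 ^ R := by
    calc n ^ (⌈c⌉₊ + 1) ≤ (2 ^ Nat.clog 2 (n + 1)) ^ (⌈c⌉₊ + 1) := by
          gcongr; exact (Nat.le_succ n).trans (Nat.le_pow_clog (by norm_num) _)
      _ = 2 ^ ((⌈c⌉₊ + 1) * Nat.clog 2 (n + 1)) := by rw [← pow_mul, mul_comm]
      _ ≤ 2 ^ R := Nat.pow_le_pow_right (by norm_num) hR
  have hn : (1 : ℝ) ≤ n := by exact_mod_cast hm.trans hmn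
  have h3 : (n : ℝ) ^ c ≤ (n : ℝ) ^ ⌈c⌉₊ := by
    rw [← Real.rpow_natCast]
    exact Real.rpow_le_rpow_of_exponent_le hn (Nat.le_ceil c)
  have h4 : Set.ncard {ω : Fin L → Fin (2 ^ w) | (Finset.range (n - m + 1)).filter
      (Survives I (tapeOf ω) R) ≠ occurrences I} ≤ (bad.biUnion E).card := by
    rw [← Set.ncard_coe_finset]
    exact Set.ncard_le_ncard hsub (Finset.finite_toSet _)
  have h5 : n ^ ⌈c⌉₊ * (bad.biUnion E).card ≤ total := by
    have h6 : n * (n ^ ⌈c⌉₊ * (bad.biUnion E).card) ≤ n * total :=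
      le_trans (le_trans (le_of_eq (by ring)) (Nat.mul_le_mul_right _ h2)) h1
    exact Nat.le_of_mul_le_mul_left h6 (by omega)
  rw [prob, div_le_div_iff₀ (by exact_mod_cast htot) (by positivity), one_mul]
  calc _ ≤ ((bad.biUnion E).card : ℝ) * (n : ℝ) ^ ⌈c⌉₊ := by
        gcongr
    _ = ((n ^ ⌈c⌉₊ * (bad.biUnion E).card : ℕ) : ℝ) := by push_cast; ring
    _ ≤ _ := by exact_mod_cast h5

end

/-! ### The program -/

section
variable {n m σT σP : ℕ} {w : ℕ} {I : Input n m σT σP} {tape : ℕ → ℕ}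

theorem clog_succ (hn : 1 ≤ n) : Nat.clog 2 (n + 1) = Nat.log 2 n + 1 :=
  (eq_clog (Nat.lt_pow_succ_log_self (by norm_num) n) (Or.inr (by
    have := Nat.pow_log_le_self 2 (show n ≠ 0 by omega)
    rw [pow_succ]; omega))).symm

/-- Rounding `2 * I.deg` up to a power of two at most doubles it; for `I.deg = 0` there is a single
hash value. -/
theorem Input.numHash_le (I : Input n m σT σP) : I.numHash ≤ 4 * max I.deg 1 := by
  rw [Input.numHash]
  rcases Nat.eq_zero_or_pos I.deg with h | h
  · simp [h]
  · have := Nat.pow_pred_clog_lt_self (b := 2) (by norm_num) (x := 2 * I.deg) (by omega)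
    have h0 : 0 < Nat.clog 2 (2 * I.deg) := Nat.clog_pos (by norm_num) (by omega)
    rw [show Nat.clog 2 (2 * I.deg) = (Nat.clog 2 (2 * I.deg)).pred + 1 from
      (Nat.succ_pred_eq_of_pos h0).symm, pow_succ]
    omega

theorem countTime_le {N k B l : ℕ} (hN : 4 ≤ N) (h2 : 2 ∣ N) (hNn : N ≤ 4 * n) (hk : k ≤ 3 * l)
    (hl : 1 ≤ l) : countTime n N k B ≤ 1 + 616 * (B * (n * l)) := by
  -- All windows together have at most `2 * n + N` entries, and `N ≤ 4 * n`.
  have hb : (n / (N / 2) + 1) * N ≤ 6 * n := by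
    obtain ⟨M, rfl⟩ := h2
    rw [Nat.mul_div_cancel_left _ (by norm_num)]
    have := Nat.div_mul_le_self n M
    have e : (n / M + 1) * (2 * M) = 2 * (n / M * M) + 2 * M := by ring
    omega
  have h1 : 12 + 13 * N + 2 * (k * (8 * N + 6)) ≤ N * (16 + 20 * k) := by
    have : k * (8 * N + 6) ≤ k * (10 * N) := Nat.mul_le_mul_left _ (by omega)
    have e : N * (16 + 20 * k) = 16 * N + 2 * (k * (10 * N)) := by ring
    omega
  have h3 : 8 + 8 * N + k * (8 * N + 6) ≤ N * (10 + 10 * k) := by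
    have : k * (8 * N + 6) ≤ k * (10 * N) := Nat.mul_le_mul_left _ (by omega)
    have e : N * (10 + 10 * k) = 10 * N + k * (10 * N) := by ring
    omega
  have h4 : (n / (N / 2) + 1) * (12 + 13 * N + 2 * (k * (8 * N + 6))) ≤ 6 * n * (16 + 20 * k) :=
    (Nat.mul_le_mul_left _ h1).trans (by rw [← mul_assoc]; exact Nat.mul_le_mul_right _ hb)
  have h5 : N * (10 + 10 * k) ≤ 4 * n * (10 + 10 * k) := Nat.mul_le_mul_right _ hNn
  have h6 : n * k ≤ 3 * (n * l) := (Nat.mul_le_mul_left n hk).trans (by rw [mul_left_comm])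
  have h7 : n * 1 ≤ n * l := Nat.mul_le_mul_left n hl
  rw [countTime, mul_left_comm 616]
  gcongr 1 + B * ?_
  have e1 : 6 * n * (16 + 20 * k) = 96 * n + 120 * (n * k) := by ring
  have e2 : 4 * n * (10 + 10 * k) = 40 * n + 40 * (n * k) := by ring
  omega

/-- Every summand is absorbed into a multiple of `D' * n * l` or `D' * n * l * L`. In a round, `4 *
616` comes from the correlations and 29 from the rest; 2539 is `2500 + 20 + 11 + 8`. -/
theorem mainTime_le {D D' N k B l L c : ℕ} (hm : 1 ≤ m) (hmn : m ≤ n) (hN : 4 ≤ N) (h2 : 2 ∣ N)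
    (hNn : N ≤ 4 * m) (hk : k ≤ 3 * l) (hl : 1 ≤ l) (hL : 1 ≤ L) (hD : D ≤ D') (hD' : 1 ≤ D')
    (hB : B ≤ 4 * D') :
    mainTime n m D N k B (c * L) ≤ (2539 + 2493 * c) * D' * n * l * L := by
  have hn : 1 ≤ n := hm.trans hmn
  have h0 : n * 1 ≤ n * l := Nat.mul_le_mul_left n hl
  have h1 : 1 * n ≤ D' * n := Nat.mul_le_mul_right n hD'
  have h3 : D' * n ≤ D' * (n * l) := Nat.mul_le_mul_left _ (by omega)
  have h4 : D' * (n * l) * 1 ≤ D' * (n * l) * L := Nat.mul_le_mul_left _ hL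
  have h5 : D' * 1 ≤ D' * n := Nat.mul_le_mul_left _ hn
  have h6 : n * B ≤ 4 * (D' * n) :=
    (Nat.mul_le_mul_left n hB).trans (le_of_eq (by ring))
  have h7 : n * (2 + D * 2) ≤ 2 * n + 2 * (D' * n) :=
    (Nat.mul_le_mul_left n (show 2 + D * 2 ≤ 2 + D' * 2 by omega)).trans (le_of_eq (by ring))
  have h8 : B * (n * l) ≤ 4 * (D' * (n * l)) :=
    (Nat.mul_le_mul_right _ hB).trans (le_of_eq (by ring))
  have hc := countTime_le (n := n) (B := B) hN h2 (by omega) hk hl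
  have hr : roundTime n m D N k B + 1 ≤ 2493 * (D' * (n * l)) := by
    rw [roundTime]; omega
  have hm := Nat.mul_le_mul_left (c * L) hr
  have e : (2539 + 2493 * c) * D' * n * l * L =
    2539 * (D' * (n * l) * L) + c * L * (2493 * (D' * (n * l))) := by ring
  rw [mainTime, e]
  omega

/-- Copy the lengths of the text and of the pattern, run the main program, and report. -/
def gpmProg (c : ℕ) : Prog :=
  -- Registers 20, 24 and 64 are `rg 0`, `rg 1` and `rg 11`. Register 9 is initially 0 and serves
  -- for copying; register 5 receives the base address `n + m` of the interleaved arrays.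
  .seq (.instr (.bin .add 20 0 9)) <| .seq (.instr (.bin .add 24 1 9)) <|
  .seq (.instr (.bin .add 5 0 1)) <| .seq (mainCmd c).comp <|
  .seq (.instr (.const 1 0)) (.instr (.bin .add 0 64 1))

/-- The abstract initial state. -/
def initAbs (w : ℕ) (I : Input n m σT σP) : Abs where
  reg r := if r = 0 then n else if r = 1 then m else 0
  arr id x := if id = 0 then (initState w I).mem x else 0
  used := 0

theorem initAbs_ctx (w : ℕ) (I : Input n m σT σP) : InitCtx I (initAbs w I) where
  r0 := by simp [initAbs]
  r1 := by simp [initAbs]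
  text i hi := by simp [initAbs, initState, Input.tx, hi]
  pat j hj := by simp [initAbs, initState, Input.pt, hj]
  arr id h x := by simp [initAbs, h]
  used := rfl

/-- All memory cells beyond the input are initially 0, so the interleaved arrays need no
initialisation. -/
theorem initState_rep (hW : n + m < 2 ^ w) (hσT : σT < 2 ^ w) (hσP : σP < 2 ^ w) :
    Rep w (n + m) ((((initState w I).set 20 n).set 24 m).set 5 (n + m)) (initAbs w I) where
  reg r := by
    simp only [State.set_reg, rg, initAbs, initState]
    rcases Nat.lt_trichotomy r 1 with h | rfl | h
    · obtain rfl : r = 0 := by omega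
      simp [enc_natCast, Nat.mod_eq_of_lt (show n < 2 ^ w by omega)]
    · simp [enc_natCast, Nat.mod_eq_of_lt (show m < 2 ^ w by omega)]
    · rw [if_neg (by omega), if_neg (by omega), if_neg (by omega), if_neg (by omega),
        if_neg (by omega), if_neg (by omega), if_neg (by omega), if_neg (by omega),
        if_neg (by omega), if_neg (by omega)]
      simp [enc]
  mem id x h := by
    have hmem : (initState w I).mem x < 2 ^ w := by
      simp only [initState]
      split_ifs
      · exact (Fin.is_lt _).trans hσT
      · exact (Fin.is_lt _).trans hσP
      · positivity
    by_cases h0 : id = 0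
    · subst h0
      change (initState w I).mem x = _
      simp only [initAbs, if_true]
      rw [enc_natCast, Nat.mod_eq_of_lt hmem]
    · simp only [initAbs, if_neg h0, addr, State.set]
      have : (initState w I).mem (n + m + 16 * x + id) = 0 := by
        simp only [initState]
        rw [dif_neg (by omega), dif_neg (by omega)]
      rw [this]
      simp [enc]
  base := by simp [State.set_reg]
  lt := hW
  used := rfl

open Classical in
theorem gpmProg_exec {c : ℕ} (hm : 1 ≤ m) (hmn : m ≤ n)
    (hW : n + m + 16 * ((n + 8 * m) * I.numHash) < 2 ^ w) (hQW : 2 * ((4 * m) ^ 24) ^ 3 < 2 ^ w)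
    (hσP : n + m + 16 * σP < 2 ^ w) (hσT : σT < 2 ^ w) (hR : c * Nat.clog 2 (n + 1) < 2 ^ w) :
    ∃ t s, t ≤ timeBound ((mainCmd c).cost * (2539 + 2493 * c) + 5) (maxDeg I.M) n m ∧
      Exec w I tape (gpmProg c) (initState w I) t s ∧
      Reports s ((Finset.range (n - m + 1)).filter
        (Survives I tape (c * Nat.clog 2 (n + 1)))) := by
  obtain ⟨N, k, hN1, hN2, hNk, hN4, t, a', ht, hex, f, q1, q2, q3⟩ :=
    mainCmd_runs (tape := tape) (initAbs_ctx w I) hm hmn hW hQW hσP hσT hR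
  obtain ⟨t', s', ht', hex', hrep, -⟩ :=
    hex.comp _ (initState_rep (I := I) (by omega) hσT (by omega))
  set S := (Finset.range (n - m + 1)).filter (Survives I tape (c * Nat.clog 2 (n + 1))) with hS
  have hcard : S.card ≤ n := (Finset.card_filter_le _ _).trans (by rw [Finset.card_range]; omega)
  have hlt : ∀ k < S.card, f k < 2 ^ w := fun k hk => by
    have : f k ∈ S := by
      rw [← q3]; exact Finset.mem_image_of_mem f (Finset.mem_range.2 hk)
    have := Finset.mem_range.1 (Finset.mem_filter.1 this).1
    omega
  have hmem : ∀ k < S.card, s'.mem k = f k := fun k hk => by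
    have := hrep.mem 0 k (addrOk_zero (by omega))
    rw [addr, if_pos rfl, q2 k hk, enc_natCast_of_lt (hlt k hk)] at this
    exact this
  have e64 : s'.reg 64 = S.card := by
    have := hrep.reg 11
    rwa [q1, enc_natCast_of_lt (by omega)] at this
  have hp1 : (Instr.bin .add 20 0 9).apply w I tape (initState w I) = (initState w I).set 20 n := by
    simp [Instr.apply, BinOp.eval, initState, Nat.mod_eq_of_lt (show n < 2 ^ w by omega)]
  have hp2 : (Instr.bin .add 24 1 9).apply w I tape ((initState w I).set 20 n) =
      ((initState w I).set 20 n).set 24 m := by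
    simp [Instr.apply, BinOp.eval, State.set_reg, initState,
      Nat.mod_eq_of_lt (show m < 2 ^ w by omega)]
  have hp3 : (Instr.bin .add 5 0 1).apply w I tape (((initState w I).set 20 n).set 24 m) =
      (((initState w I).set 20 n).set 24 m).set 5 (n + m) := by
    simp [Instr.apply, BinOp.eval, State.set_reg, initState,
      Nat.mod_eq_of_lt (show n + m < 2 ^ w by omega)]
  refine ⟨_, _, ?_, .seq (.instr _ _) (.seq (.instr _ _) (.seq (.instr _ _) (.seq
    (by rw [hp1, hp2, hp3]; exact hex') (.seq (.instr _ _) (.instr _ _))))), ?_⟩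
  -- Here `2 ^ k = N ≤ 4 * m` gives `k ≤ log m + 2`. The 5 in the constant accounts for the
  -- instructions around the main program.
  · have hl : k ≤ 3 * (Nat.log 2 m + 1) := by
      have h1 : 2 ^ k < 2 ^ (Nat.log 2 m + 3) := by
        have := Nat.lt_pow_succ_log_self (b := 2) (by norm_num) m
        rw [← hNk, show Nat.log 2 m + 3 = (Nat.log 2 m).succ + 2 by omega, pow_add]
        omega
      have := (Nat.pow_lt_pow_iff_right (by norm_num)).1 h1
      omega
    have h2 : 2 ∣ N := by
      rw [hNk]
      refine dvd_pow_self 2 ?_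
      rintro rfl
      omega
    have hmain := mainTime_le (c := c) hm hmn hN4 h2 hN2 hl (Nat.le_add_left 1 _)
      (Nat.le_add_left 1 (Nat.log 2 n)) (I.deg_le_maxDeg.trans (le_max_left _ 1)) (le_max_right _ 1)
      (I.numHash_le.trans (Nat.mul_le_mul_left 4 (max_le_max I.deg_le_maxDeg le_rfl)))
    rw [clog_succ (hm.trans hmn)] at ht
    have h3 := ht'.trans (Nat.mul_le_mul_left _ (ht.trans hmain))
    set D' := max (maxDeg I.M) 1 with hD'
    have h4 : 0 < D' * n * (Nat.log 2 m + 1) * (Nat.log 2 n + 1) := by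
      have : 0 < D' := lt_of_lt_of_le one_pos (le_max_right _ _)
      have : 0 < n := hm.trans hmn
      positivity
    rw [timeBound, ← hD']
    calc _ ≤ (mainCmd c).cost * ((2539 + 2493 * c) * D' * n * (Nat.log 2 m + 1) *
          (Nat.log 2 n + 1)) + 5 * (D' * n * (Nat.log 2 m + 1) * (Nat.log 2 n + 1)) := by omega
      _ = _ := by ring
  · have e1 : (Instr.const 1 0).apply w I tape s' = s'.set 1 0 := by simp [Instr.apply]
    rw [e1]
    have e2 : (Instr.bin .add 0 64 1).apply w I tape (s'.set 1 0) = (s'.set 1 0).set 0 S.card := by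
      simp [Instr.apply, BinOp.eval, State.set_reg, e64,
        Nat.mod_eq_of_lt (show S.card < 2 ^ w by omega)]
    rw [e2]
    refine ⟨by simp [State.set_reg], ?_⟩
    simp only [State.set_reg, if_true, one_ne_zero, if_false, zero_add]
    refine Eq.trans (Finset.image_congr fun k hk => ?_) q3
    simp only [Finset.coe_range, Set.mem_Iio] at hk
    exact hmem k hk

/-- Since `n + 1 ≥ 2`, constant factors are absorbed into powers of `n + 1`. The fixed-point numbers
need the exponent `145 + 72`, the arrays `10 + (d + 1)`, and the number of rounds `c + 1`. -/
theorem word_bounds {c d : ℕ} (hm : 1 ≤ m) (hmn : m ≤ n) (hσT : σT ≤ (n + 1) ^ d)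
    (hσP : σP ≤ (n + 1) ^ d) (hw : (n + 1) ^ (d + c + 300) ≤ 2 ^ w) (I : Input n m σT σP) :
    n + m + 16 * ((n + 8 * m) * I.numHash) < 2 ^ w ∧ 2 * ((4 * m) ^ 24) ^ 3 < 2 ^ w ∧
    n + m + 16 * σP < 2 ^ w ∧ σT < 2 ^ w ∧ c * Nat.clog 2 (n + 1) < 2 ^ w := by
  have hn : 1 ≤ n := hm.trans hmn
  have h2 : ∀ e, 2 ^ e ≤ (n + 1) ^ e := fun e => Nat.pow_le_pow_left (by omega) e
  have hd : 1 ≤ (n + 1) ^ d := Nat.one_le_pow _ _ (by omega)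
  have hle : ∀ e, e ≤ d + c + 300 → (n + 1) ^ e ≤ 2 ^ w := fun e he =>
    (Nat.pow_le_pow_right (by omega) he).trans hw
  have hbig : 1024 * ((n + 1) ^ d * (n + 1)) ≤ 2 ^ w := by
    refine le_trans ?_ (hle (10 + (d + 1)) (by omega))
    rw [pow_add, pow_succ]
    exact Nat.mul_le_mul_right _ (h2 10)
  have h1 : n + 1 ≤ (n + 1) ^ d * (n + 1) := Nat.le_mul_of_pos_left _ hd
  have h3 : (n + 1) ^ d ≤ (n + 1) ^ d * (n + 1) := Nat.le_mul_of_pos_right _ (by omega)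
  have hB : I.numHash ≤ 4 * (n + 1) ^ d := I.numHash_le.trans
    (Nat.mul_le_mul_left 4 (max_le (I.deg_le.trans hσP) hd))
  refine ⟨?_, ?_, by omega, by omega, ?_⟩
  · have h4 : (n + 8 * m) * I.numHash ≤ 9 * (n + 1) * (4 * (n + 1) ^ d) :=
      Nat.mul_le_mul (by omega) hB
    have e : 9 * (n + 1) * (4 * (n + 1) ^ d) = 36 * ((n + 1) ^ d * (n + 1)) := by ring
    omega
  · calc 2 * ((4 * m) ^ 24) ^ 3 = 2 ^ 145 * m ^ 72 := by ring
      _ < 2 ^ 145 * (n + 1) ^ 72 :=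
        Nat.mul_lt_mul_of_pos_left (Nat.pow_lt_pow_left (by omega) (by norm_num)) (by positivity)
      _ ≤ (n + 1) ^ 145 * (n + 1) ^ 72 := Nat.mul_le_mul_right _ (h2 145)
      _ ≤ 2 ^ w := by rw [← pow_add]; exact hle _ (by omega)
  · have h5 : Nat.clog 2 (n + 1) ≤ n + 1 := Nat.clog_le_of_le_pow Nat.lt_two_pow_self.le
    calc c * Nat.clog 2 (n + 1) ≤ c * (n + 1) := Nat.mul_le_mul_left _ h5
      _ < 2 ^ c * (n + 1) := Nat.mul_lt_mul_of_pos_right Nat.lt_two_pow_self (by omega)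
      _ ≤ (n + 1) ^ c * (n + 1) := Nat.mul_le_mul_right _ (h2 c)
      _ ≤ 2 ^ w := by rw [← pow_succ]; exact hle _ (by omega)

theorem timeBound_mono {C C' D : ℕ} (h : C ≤ C') : timeBound C D n m ≤ timeBound C' D n m := by
  unfold timeBound
  gcongr

/-- Each round uses `m` random words; all of them must lie on a tape whose length is the time bound.
-/
theorem rounds_mul_le {c C D : ℕ} (hm : 1 ≤ m) (hmn : m ≤ n) (h : c ≤ C) :
    c * Nat.clog 2 (n + 1) * m ≤ timeBound C D n m := by
  rw [clog_succ (hm.trans hmn), timeBound]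
  calc c * (Nat.log 2 n + 1) * m ≤ C * (Nat.log 2 n + 1) * n := by gcongr
    _ = C * 1 * n * 1 * (Nat.log 2 n + 1) := by ring
    _ ≤ _ := by
      gcongr
      · exact le_max_right _ _
      · exact Nat.le_add_left 1 _

end
end GPM

theorem mainTheorem4 (c : ℝ) :
    ∃ p : GPM.Prog, ∀ d : ℕ, ∃ K C : ℕ,
      ∀ (n m σT σP w : ℕ), 1 ≤ m → m ≤ n → σT ≤ (n + 1) ^ d → σP ≤ (n + 1) ^ d →
        (n + 1) ^ K ≤ 2 ^ w →
      ∀ I : GPM.Input n m σT σP,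
      ∃ out : (Fin (GPM.timeBound C (GPM.maxDeg I.M) n m) → Fin (2 ^ w)) → Finset ℕ,
        (∀ ω, ∃ t s, t ≤ GPM.timeBound C (GPM.maxDeg I.M) n m ∧
          GPM.Exec w I (GPM.tapeOf ω) p (GPM.initState w I) t s ∧ GPM.Reports s (out ω)) ∧
        (∀ ω, GPM.occurrences I ⊆ out ω ∧ out ω ⊆ Finset.range (n - m + 1)) ∧
        GPM.prob {ω | out ω ≠ GPM.occurrences I} ≤ 1 / (n : ℝ) ^ c := by
  classical
  -- The additional 1 pays for the union bound over the positions.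
  set c' := ⌈c⌉₊ + 1 with hc'
  set C₀ := (GPM.mainCmd c').cost * (2539 + 2493 * c') + 5 with hC₀
  -- The summand `c'` in the time constant makes it immediate that the tape is long enough for all
  -- rounds.
  refine ⟨GPM.gpmProg c', fun d => ⟨d + c' + 300, C₀ + c', ?_⟩⟩
  intro n m σT σP w hm hmn hσT hσP hw I
  obtain ⟨h1, h2, h3, h4, h5⟩ := GPM.word_bounds hm hmn hσT hσP hw I
  refine ⟨fun ω => (Finset.range (n - m + 1)).filter
    (GPM.Survives I (GPM.tapeOf ω) (c' * Nat.clog 2 (n + 1))), fun ω => ?_, fun ω => ⟨?_,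
    Finset.filter_subset _ _⟩, ?_⟩
  · obtain ⟨t, s, ht, hex, hrep⟩ := GPM.gpmProg_exec (tape := GPM.tapeOf ω) hm hmn h1 h2 h3 h4 h5
    exact ⟨t, s, ht.trans (GPM.timeBound_mono (Nat.le_add_right _ _)), hex, by convert hrep⟩
  · intro i hi
    rw [Finset.mem_filter, Finset.mem_range, Nat.lt_succ_iff]
    exact ⟨((GPM.mem_occurrences hmn).1 hi).1, GPM.survives_of_mem hmn hi _⟩
  -- The number of hash values fits into a word, hence divides `2 ^ w`.
  · have hB : Nat.clog 2 (2 * I.deg) ≤ w := by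
      have h6 : 2 ^ Nat.clog 2 (2 * I.deg) < 2 ^ w := by
        change I.numHash < 2 ^ w
        have := Nat.le_mul_of_pos_left I.numHash (show 0 < n + 8 * m by omega)
        omega
      exact ((Nat.pow_lt_pow_iff_right (by norm_num)).1 h6).le
    convert GPM.prob_ne_le (c := c) hm hmn
      (GPM.rounds_mul_le hm hmn (Nat.le_add_left c' C₀)) hB le_rfl using 1
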